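/- **Setting.** Let $\Phi:\mathbb Z\to\mathbb R$ and $\gamma\in\mathbb R$. Put $\widehat\Phi(k)=\sum_{x\in\mathbb Z}\Phi(x)e^{-2\pi i kx}$, $\omega(k)=\sqrt{\widehat\Phi(k)}$, $v(k)=\omega'(k)/(2\pi)$, $\Omega(k)=\frac{\gamma}{2}\sqrt{1-(2\omega(k)/\gamma)^2}$ and $$\widehat A_t(k)=\frac{e^{-\gamma t/2}}{\Omega}\begin{pmatrix}\frac{\gamma}{2}\sinh\Omega t+\Omega\cosh\Omega t & -\omega^2\sinh\Omega t\\ \sinh\Omega t & -\frac{\gamma}{2}\sinh\Omega t+\Omega\cosh\Omega t\end{pmatrix},\qquad \Omega=\Omega(k),\ \omega=\omega(k).$$ Assume: (1) $|\Phi(x)|\le Ce^{-\delta|x|}$ for some $C,\delta>0$; (2) $\Phi(-x)=\Phi(x)$; (3) $\omega\ge\omega_0$ for some $\omega_0>0$; (4) $\gamma>2\max_k\omega(k)$; (5) for every $\varepsilon>0$ there is $C_\varepsilon>0$ such that, with $F_t=\widehat A_t^{22}$, $\int_0^\infty dt\int_0^1 dk\,\big(F_t(k+\tfrac{k_0}{2})-F_t(k-\tfrac{k_0}{2})\big)^2\ge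 C_\varepsilon$ whenever $\varepsilon\le|k_0|\le\frac12$. For $L\ge1$ let $\Lambda_L=\{n\in\mathbb Z:-L/2<n\le L/2\}$ with addition modulo $L$ (representatives $[\,\cdot\,]_L\in\Lambda_L$), $\Lambda_L^*=\Lambda_L/L$ and $(\Phi_L)_{x',x}=\Phi([x'-x]_L)$. The velocity-flip process is the Markov process $X(t)=(q(t),p(t))=(X^1(t),X^2(t))\in\mathbb R^{\Lambda_L}\times\mathbb R^{\Lambda_L}$ (with arbitrary initial law) with generator $$(\mathcal LF)(q,p)=\sum_{x}\big(p_x\partial_{q_x}F-(\Phi_Lq)_x\partial_{p_x}F\big)+\frac{\gamma}{2}\sum_{x_0}\big(F(S_{x_0}(q,p))-F(q,p)\big),$$ where $S_{x_0}$ changes the sign of $p_{x_0}$. Its energy is $H_L(q,p)=\frac12\sum_xp_x^2+\frac12\sum_{x',x}q_{x'}q_x(\Phi_L)_{x',x}$. Write $C_t^{ij}(x,y)=\mathbb E[X^i_x(t)X^j_y(t)]$, $T_t(x)=\mathbb E[p_x(t)^2]$, $\nabla T_t(x)=T_t(x+1)-T_t(x)$ and $$U_t(x,k)=\sum_{y\in\Lambda_L}e^{-2\pi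 iky}\,C_t(x,x+y).$$ With $P^{(2)}=\mathrm{diag}(0,1)$ let (reserving $U_0,U_1$ with the single argument $k$ for the following matrices) $$U_0(k)=2\gamma\int_0^\infty\widehat A_t(k)^\top P^{(2)}\widehat A_t(k)\,dt,\qquad U_1(k)=\frac{\gamma}{\pi}\int_0^\infty(\partial_k\widehat A_t(k))^\top P^{(2)}\widehat A_t(k)\,dt .$$ **Theorem.** Under (1)–(5) these integrals converge absolutely and, for all $k$, $$U_0(k)=\begin{pmatrix}\omega(k)^{-2}&0\\0&1\end{pmatrix},\qquad U_1(k)=-\frac{v(k)}{\omega(k)}\begin{pmatrix}\omega(k)^{-2}&-\gamma^{-1}\\\gamma^{-1}&0\end{pmatrix}.$$ Moreover there is $L_0>0$ such that for all $\mathcal E_0,c_0>0$ there is $c_1>0$ with the following property for every $L\ge L_0$ and every velocity-flip process $X$ on $\Lambda_L$ whose initial energy is integrable with density $L^{-1}\,\mathbb E[H_L(X(0))]\le\mathcal E_0$: all second moments $C_t^{ij}(x,y)$, $t\ge0$, are finite (so $U_t(x,k)$ is a finite function), and for all $t\ge c_0L^2$, $x\in\Lambda_L$, $k\in\Lambda_L^*$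 and $i,j\in\{1,2\}$, $$\Big|U_t^{ij}(x,k)-\big(T_t(x)\,U_0^{ij}(k)+i\,\nabla T_t(x)\,U_1^{ij}(k)\big)\Big|\le c_1L^{-2}.$$ -/

import Mathlib

open MeasureTheory ProbabilityTheory Filter Topology
open scoped NNReal ContDiff

noncomputable section

namespace VelocityFlip

/-! ### Dispersion relation and propagator of the first moments -/

/-- The Fourier transform `k ↦ ∑ₓ Φ(x) exp(-2πi k x)` of a function on `ℤ`, as a `1`-periodic
function of `k : ℝ`. -/
def fourierZ (Φ : ℤ → ℝ) (k : ℝ) : ℂ :=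
  ∑' x : ℤ, (Φ x : ℂ) * Complex.exp (-(Complex.I * ((2 * Real.pi * k * (x : ℝ) : ℝ) : ℂ)))

/-- The dispersion relation `ω = √Φ̂` (the transform is real when `Φ` is symmetric). -/
def disp (Φ : ℤ → ℝ) (k : ℝ) : ℝ := Real.sqrt (fourierZ Φ k).re

/-- The lattice wave velocity `v(k) = ω'(k) / (2π)`. -/
def velocity (Φ : ℤ → ℝ) (k : ℝ) : ℝ := deriv (disp Φ) k / (2 * Real.pi)

/-- `Ω(k) = (γ/2) √(1 - (2ω(k)/γ)²)`. -/
def bigOmega (Φ : ℤ → ℝ) (γ k : ℝ) : ℝ :=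
  γ / 2 * Real.sqrt (1 - (2 * disp Φ k / γ) ^ 2)

/-- The matrix `Â_t(k)`: the exponential `exp (-t [[0, ω(k)²], [-1, γ]])` in closed form. -/
def Ahat (Φ : ℤ → ℝ) (γ t k : ℝ) : Matrix (Fin 2) (Fin 2) ℝ :=
  let W := bigOmega Φ γ k
  (Real.exp (-(γ * t / 2)) / W) •
    !![γ / 2 * Real.sinh (W * t) + W * Real.cosh (W * t), -(disp Φ k ^ 2 * Real.sinh (W * t));
       Real.sinh (W * t), -(γ / 2 * Real.sinh (W * t)) + W * Real.cosh (W * t)]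

/-- The entrywise derivative `∂ₖ Â_t(k)`. -/
def dAhat (Φ : ℤ → ℝ) (γ t k : ℝ) : Matrix (Fin 2) (Fin 2) ℝ :=
  Matrix.of fun i j => deriv (fun κ => Ahat Φ γ t κ i j) k

/-- The projection `P⁽²⁾ = diag(0, 1)` onto the momentum component. -/
def projP : Matrix (Fin 2) (Fin 2) ℝ := !![0, 0; 0, 1]

/-- `𝒜_t(k) = Â_t(k)ᵀ P⁽²⁾ Â_t(k)`. -/
def calA (Φ : ℤ → ℝ) (γ t k : ℝ) : Matrix (Fin 2) (Fin 2) ℝ :=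
  (Ahat Φ γ t k).transpose * projP * Ahat Φ γ t k

/-- `𝒜̃_t(k) = (2π)⁻¹ (∂ₖ Â_t(k))ᵀ P⁽²⁾ Â_t(k)`. -/
def calAtilde (Φ : ℤ → ℝ) (γ t k : ℝ) : Matrix (Fin 2) (Fin 2) ℝ :=
  (1 / (2 * Real.pi)) • ((dAhat Φ γ t k).transpose * projP * Ahat Φ γ t k)

/-- The local equilibrium symbol `U₀(k) = 2γ ∫₀^∞ 𝒜_t(k) dt`. -/
def U0 (Φ : ℤ → ℝ) (γ k : ℝ) : Matrix (Fin 2) (Fin 2) ℝ :=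
  Matrix.of fun i j => 2 * γ * ∫ t in Set.Ioi (0 : ℝ), calA Φ γ t k i j

/-- The gradient correction symbol `U₁(k) = 2γ ∫₀^∞ 𝒜̃_t(k) dt`. -/
def U1 (Φ : ℤ → ℝ) (γ k : ℝ) : Matrix (Fin 2) (Fin 2) ℝ :=
  Matrix.of fun i j => 2 * γ * ∫ t in Set.Ioi (0 : ℝ), calAtilde Φ γ t k i j

/-- The assumptions on the interaction `Φ` and the flip rate parameter `γ`. -/
structure Admissible (Φ : ℤ → ℝ) (γ : ℝ) : Prop where
  /-- exponential decay -/
  exp_decay : ∃ C > (0 : ℝ), ∃ δ > (0 : ℝ), ∀ x : ℤ, |Φ x| ≤ C * Real.exp (-(δ * |(x : ℝ)|))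
  /-- symmetry -/
  symm : ∀ x : ℤ, Φ (-x) = Φ x
  /-- pinning -/
  pinning : ∃ ω₀ > (0 : ℝ), ∀ k : ℝ, ω₀ ≤ disp Φ k
  /-- noise dominates -/
  noise : ∀ k : ℝ, 2 * disp Φ k < γ
  /-- the harmonic forces are nondegenerate -/
  nondegenerate : ∀ ε > (0 : ℝ), ∃ Cε > (0 : ℝ), ∀ k₀ : ℝ, ε ≤ |k₀| → |k₀| ≤ 1 / 2 →
    Cε ≤ ∫ t in Set.Ioi (0 : ℝ), ∫ k in (0 : ℝ)..1,
      (Ahat Φ γ t (k + k₀ / 2) 1 1 - Ahat Φ γ t (k - k₀ / 2) 1 1) ^ 2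

/-! ### The periodic chain

The sites are `ZMod L`; a site `x` stands for its representative `x.valMinAbs` in
`Λ_L = {n ∈ ℤ : -L/2 < n ≤ L/2}`, and addition in `ZMod L` is the periodic arithmetic. -/

theorem mem_range_valMinAbs_iff (L : ℕ) [NeZero L] (n : ℤ) :
    n ∈ Set.range (ZMod.valMinAbs : ZMod L → ℤ) ↔ -(L : ℤ) < 2 * n ∧ 2 * n ≤ L := by
  constructor
  · rintro ⟨x, rfl⟩
    have h := x.valMinAbs_mem_Ioc
    exact ⟨by linarith [h.1], by linarith [h.2]⟩
  · rintro ⟨h1, h2⟩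
    exact ⟨(n : ZMod L), (ZMod.valMinAbs_spec _ n).2 ⟨rfl, by constructor <;> linarith⟩⟩

/-- The momentum `k ∈ Λ_L* = Λ_L / L` labelled by `κ : ZMod L`. -/
def dualPoint (L : ℕ) (κ : ZMod L) : ℝ := (κ.valMinAbs : ℝ) / L

/-- Phase space: `X 0 x` is the position `q_x` and `X 1 x` the momentum `p_x` at the site `x`. -/
abbrev Phase (L : ℕ) := Fin 2 → ZMod L → ℝ

/-- The periodic interaction matrix `(Φ_L)_{x',x} = Φ([x' - x]_L)`. -/
def PhiL (Φ : ℤ → ℝ) (L : ℕ) : Matrix (ZMod L) (ZMod L) ℝ :=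
  Matrix.of fun x' x => Φ (x' - x).valMinAbs

/-- The Hamiltonian `H_L(X)`. -/
def hamiltonian (Φ : ℤ → ℝ) (L : ℕ) [NeZero L] (X : Phase L) : ℝ :=
  ∑ x, 1 / 2 * (X 1 x) ^ 2 + ∑ x', ∑ x, 1 / 2 * (X 0 x' * X 0 x * PhiL Φ L x' x)

/-- The flip `S_{x₀}` of the momentum at the site `x₀`. -/
def flip {L : ℕ} (x₀ : ZMod L) (X : Phase L) : Phase L :=
  fun i x => if i = 1 ∧ x = x₀ then -X i x else X i x

/-- The partial derivative of `F` at `X` in the coordinate `X^i_x`. -/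
def partialDeriv {L : ℕ} [NeZero L] (F : Phase L → ℝ) (i : Fin 2) (x : ZMod L) (X : Phase L) : ℝ :=
  fderiv ℝ F X (Pi.single i (Pi.single x 1))

/-- The generator `ℒ = 𝒜 + 𝒮` of the velocity flip model: Hamiltonian flow and, for every site
independently, momentum flips at the rate `γ/2`. -/
def generator (Φ : ℤ → ℝ) (γ : ℝ) (L : ℕ) [NeZero L] (F : Phase L → ℝ) (X : Phase L) : ℝ :=
  (∑ x, (X 1 x * partialDeriv F 0 x X
      - (PhiL Φ L).mulVec (X 0) x * partialDeriv F 1 x X))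
    + γ / 2 * ∑ x₀, (F (flip x₀ X) - F X)

/-- `X` is a velocity flip process with generator `ℒ`: a càdlàg process which solves the martingale
problem for `ℒ` on smooth compactly supported functions. The initial law is arbitrary. -/
structure IsVelocityFlipProcess (Φ : ℤ → ℝ) (γ : ℝ) (L : ℕ) [NeZero L]
    {S : Type*} [mS : MeasurableSpace S] (P : Measure S) (X : ℝ≥0 → S → Phase L) : Prop where
  right_cont : ∀ s : S, ∀ t : ℝ≥0, ContinuousWithinAt (fun u => X u s) (Set.Ici t) t
  left_lim : ∀ s : S, ∀ t : ℝ≥0, ∃ l : Phase L, Tendsto (fun u => X u s) (𝓝[<] t) (𝓝 l)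
  martingale : ∃ ℱ : Filtration ℝ≥0 mS, StronglyAdapted ℱ X ∧
    ∀ F : Phase L → ℝ, ContDiff ℝ ∞ F → HasCompactSupport F →
      Martingale (fun (t : ℝ≥0) (s : S) => F (X t s) - F (X 0 s)
        - ∫ u in (0 : ℝ)..(t : ℝ), generator Φ γ L F (X u.toNNReal s)) ℱ P

section Observables

variable {L : ℕ} [NeZero L] {S : Type*} [MeasurableSpace S]

/-- The matrix of second moments `C_t^{ij}(x,y) = 𝔼[X^i_x(t) X^j_y(t)]`. -/
def corr (P : Measure S) (X : ℝ≥0 → S → Phase L) (t : ℝ≥0) (i j : Fin 2) (x y : ZMod L) : ℝ :=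
  ∫ s, X t s i x * X t s j y ∂P

/-- The kinetic temperature `T_t(x) = 𝔼[p_x(t)²]`. -/
def temp (P : Measure S) (X : ℝ≥0 → S → Phase L) (t : ℝ≥0) (x : ZMod L) : ℝ :=
  ∫ s, (X t s 1 x) ^ 2 ∂P

/-- The discrete gradient `∇T_t(x) = T_t(x+1) - T_t(x)`. -/
def gradTemp (P : Measure S) (X : ℝ≥0 → S → Phase L) (t : ℝ≥0) (x : ZMod L) : ℝ :=
  temp P X t (x + 1) - temp P X t x

/-- The Wigner-type transform `U_t(x,k) = ∑_{y ∈ Λ_L} exp(-2πi k y) C_t(x, x+y)`. -/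
def wigner (P : Measure S) (X : ℝ≥0 → S → Phase L) (t : ℝ≥0) (x : ZMod L) (k : ℝ) :
    Matrix (Fin 2) (Fin 2) ℂ :=
  Matrix.of fun i j => ∑ y : ZMod L,
    Complex.exp (-(Complex.I * ((2 * Real.pi * k * (y.valMinAbs : ℝ) : ℝ) : ℂ)))
      * (corr P X t i j x (x + y) : ℂ)

end Observables

end VelocityFlip

end

/-! The second moments form a closed system. Energy is conserved by the Hamiltonian flow and
invariant under every flip, so all second moments stay finite and obey a linear ODE (`momentRate`),
in which the flips damp every moment containing a momentum except the diagonal ones `𝔼[p_x²]`. After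
a Fourier transform in both sites the total frequency `ξ` is conserved. For each `ξ` there remains a
system (`FiberSol`) for four functions `p, q, r, s` of `κ`, with coefficients `a = Φ̂_L(κ - ξ)` and
`b = Φ̂_L(κ)`, which couples different `κ` only through the mean `f = avg s`. This mean is the
Fourier mode of the temperature at `ξ`.

The claim becomes: in each fiber the state is close to `f V(κ)`, where `V = U₀ - 2πh U₁`, `h` being
the momentum of `ξ`, solves the stationary fiber equations up to `O(h² + L⁻²)`
(`Admissible.exists_symbol_residual`). Since `i(e^{2πih} - 1) = -2πh + O(h²)` is the multiplier of
`i∇`, this is the expansion `T U₀ + i ∇T U₁`.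

The estimates are hypocoercive. The form `ab p² + a q² + b r² + s²` is conserved by the Hamiltonian
part and its fiber mean dissipates through `q`, `r` and `s - f`. A small multiple of `(q + r)((a +
b)p - 2f)` added to it makes `(a + b)p - 2f` dissipate as well (`FiberSol.fiberLyap_dissipation`).
Only `f` is then slow. With `δ = |h|`, three facts control it. (i) The energy bounds `f`, so the
state relaxes to the size of `f` at a rate independent of `L` and `ξ` (`exists_relaxation`). (ii) A
second cross term, built on `(q - r)(a - b)p`, gives decay at rate of order `δ²` if `avg (a - b)² ≥
c δ²` (`exists_diffusive_decay`). This lower bound is where nondegeneracy enters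
(`Admissible.exists_gradient_bound`). (iii) Relative to the state, `f'` is `O(δ²)` after an initial
layer: the velocity of a solution is again a solution, whose energy mode is the mean of `-(a - b)(q
- r)/2`, and `q - r` is itself `O(δ)` (`exists_velocity_bound`). For given `f` every `κ` is
uniformly damped (`exists_local_decay`), and the difference to `f V` is driven only by `f` times the
residual of `V` and by `f' V` (`exists_fiber_expansion`).

For `t ≥ c₀L²` and `h = n/L` the decay `e^{-cδ²t}` is Gaussian in `n`, while polynomial powers of
`L` from the initial data are killed by `e^{-cL²}`. Then `f` is `O(L e^{-cn²})` and the fiber error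
is `O((n² + 1)L⁻¹ e^{-cn²})`; Fourier inversion contributes another `L⁻¹`, and summing over `n`
gives `L⁻²`.

The explicit symbols come from a damped oscillator: the second row of `Â_t` solves it, the
`k`-derivative of that row is its first variation, and the integrals follow from linear relations
(`DampedPair.integrals`). -/

noncomputable section

namespace VelocityFlip

/-! ### The real Fourier transform of the interaction -/

/-- The cosine series `∑ₓ Φ(x) cos(2πkx)`. -/
def phiHat (Φ : ℤ → ℝ) (k : ℝ) : ℝ := ∑' x : ℤ, Φ x * Real.cos (2 * Real.pi * k * x)

/-- The termwise derivative of `phiHat`. -/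
def phiHatDeriv (Φ : ℤ → ℝ) (k : ℝ) : ℝ :=
  ∑' x : ℤ, Φ x * (-(2 * Real.pi * x) * Real.sin (2 * Real.pi * k * x))

/-- The absolute moments `∑ₓ |x|ⁿ |Φ(x)|`. -/
def absMoment (Φ : ℤ → ℝ) (n : ℕ) : ℝ := ∑' x : ℤ, |(x : ℝ)| ^ n * |Φ x|

theorem absMoment_nonneg (Φ : ℤ → ℝ) (n : ℕ) : 0 ≤ absMoment Φ n :=
  tsum_nonneg fun _ => by positivity

section

variable {Φ : ℤ → ℝ} {γ : ℝ}

theorem Admissible.summable_moment (hΦ : Admissible Φ γ) (n : ℕ) :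
    Summable fun x : ℤ => |(x : ℝ)| ^ n * |Φ x| := by
  obtain ⟨C, hC, δ, hδ, h⟩ := hΦ.exp_decay
  have h1 : Summable fun x : ℤ => |(x : ℝ)| ^ n * (C * Real.exp (-(δ * |(x : ℝ)|))) := by
    have h2 : Summable fun m : ℕ => C * ((m : ℝ) ^ n * Real.exp (-δ * m)) :=
      (Real.summable_pow_mul_exp_neg_nat_mul n hδ).mul_left C
    refine Summable.of_nat_of_neg ?_ ?_
    · refine h2.congr fun m => ?_
      simp only [Int.cast_natCast, Nat.abs_cast, neg_mul]; ring
    · refine h2.congr fun m => ?_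
      simp only [Int.cast_neg, abs_neg, Int.cast_natCast, Nat.abs_cast, neg_mul]; ring
  exact Summable.of_nonneg_of_le (fun _ => by positivity)
    (fun x => mul_le_mul_of_nonneg_left (h x) (by positivity)) h1

theorem Admissible.summable_abs (hΦ : Admissible Φ γ) : Summable fun x : ℤ => |Φ x| := by
  simpa using hΦ.summable_moment 0

theorem Admissible.summable_mul_of_abs_le (hΦ : Admissible Φ γ) (n : ℕ) (c : ℝ) {g : ℤ → ℝ}
    (hg : ∀ x : ℤ, |g x| ≤ c * |(x : ℝ)| ^ n) : Summable fun x : ℤ => Φ x * g x := by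
  refine Summable.of_norm_bounded ((hΦ.summable_moment n).mul_left c) fun x => ?_
  rw [Real.norm_eq_abs, abs_mul]
  calc |Φ x| * |g x| ≤ |Φ x| * (c * |(x : ℝ)| ^ n) :=
        mul_le_mul_of_nonneg_left (hg x) (abs_nonneg _)
    _ = _ := by ring

theorem Admissible.summable_phiHat (hΦ : Admissible Φ γ) (k : ℝ) :
    Summable fun x : ℤ => Φ x * Real.cos (2 * Real.pi * k * x) :=
  hΦ.summable_mul_of_abs_le 0 1 fun x => by simpa using Real.abs_cos_le_one _

theorem Admissible.summable_phiHatDeriv (hΦ : Admissible Φ γ) (k : ℝ) :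
    Summable fun x : ℤ => Φ x * (-(2 * Real.pi * x) * Real.sin (2 * Real.pi * k * x)) :=
  hΦ.summable_mul_of_abs_le 1 (2 * Real.pi) fun x => by
    rw [abs_mul, abs_neg, abs_mul, abs_of_pos Real.two_pi_pos, pow_one]
    exact mul_le_of_le_one_right (by positivity) (Real.abs_sin_le_one _)

/-- The bounds `|cos β - 1| ≤ β²` and `|β - sin β| ≤ β²` hold for all real `β`, so summing against
the second moment of `Φ` needs no splitting into near and far sites. -/
theorem abs_cos_taylor (α β : ℝ) :
    |Real.cos (α + β) - Real.cos α + β * Real.sin α| ≤ 2 * β ^ 2 := by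
  rw [Real.cos_add]
  have h1 : |Real.cos β - 1| ≤ β ^ 2 := by
    rw [abs_le]; constructor
    · nlinarith [Real.one_sub_sq_div_two_le_cos (x := β), sq_nonneg β]
    · nlinarith [Real.cos_le_one β, sq_nonneg β]
  have h2 : |β - Real.sin β| ≤ β ^ 2 := by
    have key : ∀ y : ℝ, 0 ≤ y → |y - Real.sin y| ≤ y ^ 2 := by
      intro y hy
      rw [abs_of_nonneg (by linarith [Real.sin_le hy])]
      rcases le_or_gt y 1 with h | h
      · rcases hy.eq_or_lt with rfl | hy'
        · simp
        · have := Real.sin_gt_sub_cube hy'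
          nlinarith [mul_nonneg hy hy]
      · rcases le_or_gt y 2 with h' | h'
        · have := Real.sin_nonneg_of_nonneg_of_le_pi hy (by linarith [Real.pi_gt_three])
          nlinarith
        · nlinarith [Real.neg_one_le_sin y]
    rcases le_total 0 β with h | h
    · exact key β h
    · have := key (-β) (by linarith)
      rw [Real.sin_neg, ← abs_neg] at this
      simpa [sub_eq_add_neg, add_comm] using this
  have h3 : Real.cos α * Real.cos β - Real.sin α * Real.sin β - Real.cos α + β * Real.sin α
      = Real.cos α * (Real.cos β - 1) + Real.sin α * (β - Real.sin β) := by ring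
  rw [h3]
  calc _ ≤ |Real.cos α * (Real.cos β - 1)| + |Real.sin α * (β - Real.sin β)| := abs_add_le _ _
    _ = |Real.cos α| * |Real.cos β - 1| + |Real.sin α| * |β - Real.sin β| := by
        rw [abs_mul, abs_mul]
    _ ≤ 1 * β ^ 2 + 1 * β ^ 2 := by
        gcongr
        · exact Real.abs_cos_le_one _
        · exact Real.abs_sin_le_one _
    _ = 2 * β ^ 2 := by ring

theorem abs_tsum_le_of_abs_le {f g : ℤ → ℝ} (hg : Summable g) (h : ∀ x, |f x| ≤ g x) :
    |∑' x, f x| ≤ ∑' x, g x := by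
  have := tsum_of_norm_bounded (f := f) hg.hasSum (fun x => by simpa using h x)
  simpa using this

/-- The remainder is uniform in `k`. Besides differentiability it supplies the `O(h²)` error when
`Φ̂(k - h)` is linearised in the symbol residual. -/
theorem Admissible.phiHat_taylor (hΦ : Admissible Φ γ) (k h : ℝ) :
    |phiHat Φ (k + h) - phiHat Φ k - h * phiHatDeriv Φ k|
      ≤ 8 * Real.pi ^ 2 * absMoment Φ 2 * h ^ 2 := by
  have e : phiHat Φ (k + h) - phiHat Φ k - h * phiHatDeriv Φ k
      = ∑' x : ℤ, (Φ x * Real.cos (2 * Real.pi * (k + h) * x)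
        - Φ x * Real.cos (2 * Real.pi * k * x)
        - h * (Φ x * (-(2 * Real.pi * x) * Real.sin (2 * Real.pi * k * x)))) := by
    rw [((hΦ.summable_phiHat (k + h)).sub (hΦ.summable_phiHat k)).tsum_sub
      ((hΦ.summable_phiHatDeriv k).mul_left h), (hΦ.summable_phiHat (k + h)).tsum_sub
      (hΦ.summable_phiHat k), tsum_mul_left]
    rfl
  rw [e]
  have e2 : 8 * Real.pi ^ 2 * absMoment Φ 2 * h ^ 2
      = ∑' x : ℤ, 8 * Real.pi ^ 2 * h ^ 2 * (|(x : ℝ)| ^ 2 * |Φ x|) := by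
    rw [tsum_mul_left, absMoment]; ring
  rw [e2]
  refine abs_tsum_le_of_abs_le ((hΦ.summable_moment 2).mul_left _) fun x => ?_
  have t := abs_cos_taylor (2 * Real.pi * k * x) (2 * Real.pi * h * x)
  have e3 : Φ x * Real.cos (2 * Real.pi * (k + h) * x)
        - Φ x * Real.cos (2 * Real.pi * k * x)
        - h * (Φ x * (-(2 * Real.pi * x) * Real.sin (2 * Real.pi * k * x)))
      = Φ x * (Real.cos (2 * Real.pi * k * x + 2 * Real.pi * h * x)
        - Real.cos (2 * Real.pi * k * x)
        + 2 * Real.pi * h * x * Real.sin (2 * Real.pi * k * x)) := by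
    rw [show 2 * Real.pi * (k + h) * x = 2 * Real.pi * k * x + 2 * Real.pi * h * x by ring]
    ring
  rw [e3, abs_mul]
  calc _ ≤ |Φ x| * (2 * (2 * Real.pi * h * x) ^ 2) :=
        mul_le_mul_of_nonneg_left t (abs_nonneg _)
    _ = _ := by rw [sq_abs]; ring

theorem hasDerivAt_of_taylor {f : ℝ → ℝ} {k D C : ℝ}
    (h : ∀ h : ℝ, |f (k + h) - f k - h * D| ≤ C * h ^ 2) : HasDerivAt f D k := by
  rw [hasDerivAt_iff_isLittleO_nhds_zero]
  refine Asymptotics.IsBigO.trans_isLittleO (g := fun h : ℝ => h ^ 2) ?_ ?_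
  · refine Asymptotics.IsBigO.of_bound C (Eventually.of_forall fun x => ?_)
    simpa using h x
  · simpa using Asymptotics.isLittleO_pow_id (𝕜 := ℝ) (n := 2) (by norm_num)

theorem Admissible.hasDerivAt_phiHat (hΦ : Admissible Φ γ) (k : ℝ) :
    HasDerivAt (phiHat Φ) (phiHatDeriv Φ k) k :=
  hasDerivAt_of_taylor (hΦ.phiHat_taylor k)

theorem Admissible.fourierZ_re (hΦ : Admissible Φ γ) (k : ℝ) :
    (fourierZ Φ k).re = phiHat Φ k := by
  have hs : Summable fun x : ℤ =>
      (Φ x : ℂ) * Complex.exp (-(Complex.I * ((2 * Real.pi * k * (x : ℝ) : ℝ) : ℂ))) := by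
    refine Summable.of_norm_bounded hΦ.summable_abs fun x => ?_
    rw [norm_mul, Complex.norm_real, ← mul_neg, ← Complex.ofReal_neg, mul_comm Complex.I,
      Complex.norm_exp_ofReal_mul_I, mul_one, Real.norm_eq_abs]
  rw [fourierZ, Complex.re_tsum hs, phiHat]
  refine tsum_congr fun x => ?_
  rw [← mul_neg, ← Complex.ofReal_neg, mul_comm Complex.I, Complex.re_ofReal_mul,
    Complex.exp_ofReal_mul_I_re, Real.cos_neg]

theorem Admissible.disp_eq (hΦ : Admissible Φ γ) (k : ℝ) :
    disp Φ k = Real.sqrt (phiHat Φ k) := by rw [disp, hΦ.fourierZ_re]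

theorem Admissible.disp_pos (hΦ : Admissible Φ γ) (k : ℝ) : 0 < disp Φ k := by
  obtain ⟨w, hw, h⟩ := hΦ.pinning
  exact hw.trans_le (h k)

theorem Admissible.phiHat_pos (hΦ : Admissible Φ γ) (k : ℝ) : 0 < phiHat Φ k := by
  have := hΦ.disp_pos k
  rw [hΦ.disp_eq, Real.sqrt_pos] at this
  exact this

theorem Admissible.disp_sq (hΦ : Admissible Φ γ) (k : ℝ) : disp Φ k ^ 2 = phiHat Φ k := by
  rw [hΦ.disp_eq, Real.sq_sqrt (hΦ.phiHat_pos k).le]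

theorem Admissible.exists_le_phiHat (hΦ : Admissible Φ γ) :
    ∃ m > (0 : ℝ), ∀ k, m ≤ phiHat Φ k := by
  obtain ⟨w, hw, h⟩ := hΦ.pinning
  refine ⟨w ^ 2, by positivity, fun k => ?_⟩
  rw [← hΦ.disp_sq]
  exact pow_le_pow_left₀ hw.le (h k) 2

theorem Admissible.hasDerivAt_disp (hΦ : Admissible Φ γ) (k : ℝ) :
    HasDerivAt (disp Φ) (phiHatDeriv Φ k / (2 * disp Φ k)) k := by
  have h := (hΦ.hasDerivAt_phiHat k).sqrt (hΦ.phiHat_pos k).ne'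
  have e : disp Φ = fun y => Real.sqrt (phiHat Φ y) := funext hΦ.disp_eq
  rw [e]
  exact h

theorem Admissible.gamma_pos (hΦ : Admissible Φ γ) : 0 < γ := by
  linarith [hΦ.noise 0, hΦ.disp_pos 0]

theorem Admissible.velocity_div_disp (hΦ : Admissible Φ γ) (k : ℝ) :
    velocity Φ k / disp Φ k = phiHatDeriv Φ k / (4 * Real.pi * phiHat Φ k) := by
  have h := (hΦ.disp_pos k).ne'
  rw [velocity, (hΦ.hasDerivAt_disp k).deriv, ← hΦ.disp_sq]
  have := Real.pi_ne_zero
  field_simp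
  ring

end

/-! ### Integrals of exponentially decaying solutions of the damped oscillator -/

/-- Continuous functions on the half line with exponential decay. -/
def ExpDecay (lam : ℝ) (f : ℝ → ℝ) : Prop :=
  Continuous f ∧ ∃ C, ∀ t, 0 ≤ t → |f t| ≤ C * Real.exp (-(lam * t))

namespace ExpDecay

variable {lam : ℝ} {f g f' g' : ℝ → ℝ}

theorem const_mul (c : ℝ) (hf : ExpDecay lam f) : ExpDecay lam fun t => c * f t := by
  obtain ⟨h, C, hC⟩ := hf
  refine ⟨by fun_prop, |c| * C, fun t ht => ?_⟩
  rw [abs_mul, mul_assoc]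
  exact mul_le_mul_of_nonneg_left (hC t ht) (abs_nonneg _)

theorem add (hf : ExpDecay lam f) (hg : ExpDecay lam g) : ExpDecay lam fun t => f t + g t := by
  obtain ⟨h, C, hC⟩ := hf
  obtain ⟨h', C', hC'⟩ := hg
  refine ⟨by fun_prop, C + C', fun t ht => (abs_add_le _ _).trans ?_⟩
  rw [add_mul]
  exact add_le_add (hC t ht) (hC' t ht)

theorem isBigO_mul (hf : ExpDecay lam f) (hg : ExpDecay lam g) :
    (fun t => f t * g t) =O[atTop] fun t => Real.exp (-(2 * lam) * t) := by
  obtain ⟨h, C, hC⟩ := hf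
  obtain ⟨h', C', hC'⟩ := hg
  refine Asymptotics.IsBigO.of_bound (C * C') ?_
  filter_upwards [eventually_ge_atTop 0] with t ht
  rw [Real.norm_eq_abs, abs_mul, Real.norm_eq_abs, Real.abs_exp]
  calc |f t| * |g t| ≤ (C * Real.exp (-(lam * t))) * (C' * Real.exp (-(lam * t))) :=
        mul_le_mul (hC t ht) (hC' t ht) (abs_nonneg _) ((abs_nonneg _).trans (hC t ht))
    _ = C * C' * Real.exp (-(2 * lam) * t) := by
        rw [show -(2 * lam) * t = -(lam * t) + -(lam * t) by ring, Real.exp_add]; ring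

theorem integrableOn_mul (hlam : 0 < lam) (hf : ExpDecay lam f) (hg : ExpDecay lam g) :
    IntegrableOn (fun t => f t * g t) (Set.Ioi 0) :=
  integrable_of_isBigO_exp_neg (b := 2 * lam) (by positivity)
    (hf.1.mul hg.1).continuousOn (hf.isBigO_mul hg)

theorem tendsto_mul (hlam : 0 < lam) (hf : ExpDecay lam f) (hg : ExpDecay lam g) :
    Tendsto (fun t => f t * g t) atTop (𝓝 0) := by
  refine (hf.isBigO_mul hg).trans_tendsto ?_
  refine Real.tendsto_exp_atBot.comp ?_
  exact tendsto_id.const_mul_atTop_of_neg (by linarith)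

/-- Integration by parts: decay removes the boundary term at infinity, so each product of two
solutions yields one linear relation between integrals. -/
theorem integral_deriv_mul (hlam : 0 < lam) (hf : ExpDecay lam f) (hg : ExpDecay lam g)
    (hf' : ExpDecay lam f') (hg' : ExpDecay lam g')
    (df : ∀ t, HasDerivAt f (f' t) t) (dg : ∀ t, HasDerivAt g (g' t) t) :
    (∫ t in Set.Ioi 0, f' t * g t) + ∫ t in Set.Ioi 0, f t * g' t = -(f 0 * g 0) := by
  have i1 := integrableOn_mul hlam hf' hg
  have i2 := integrableOn_mul hlam hf hg'
  rw [← integral_add i1 i2]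
  have := integral_Ioi_of_hasDerivAt_of_tendsto' (a := 0) (f := fun t => f t * g t)
    (f' := fun t => f' t * g t + f t * g' t) (m := 0)
    (fun t _ => (df t).mul (dg t)) (i1.add i2) (tendsto_mul hlam hf hg)
  rw [this]; ring

end ExpDecay

/-- The damped oscillator `α' = β, β' = -w α - γ β` with `α 0 = 0, β 0 = 1`, together with its
first variation `(a, b)` in the direction `w ↦ w + g`. -/
structure DampedPair (γ w g lam : ℝ) (α β a b : ℝ → ℝ) : Prop where
  decay_α : ExpDecay lam α
  decay_β : ExpDecay lam β
  decay_a : ExpDecay lam a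
  decay_b : ExpDecay lam b
  deriv_α : ∀ t, HasDerivAt α (β t) t
  deriv_β : ∀ t, HasDerivAt β (-w * α t + -γ * β t) t
  deriv_a : ∀ t, HasDerivAt a (b t) t
  deriv_b : ∀ t, HasDerivAt b (-w * a t + -γ * b t + -g * α t) t
  α_zero : α 0 = 0
  β_zero : β 0 = 1
  a_zero : a 0 = 0
  b_zero : b 0 = 0

namespace DampedPair

variable {γ w g lam : ℝ} {α β a b : ℝ → ℝ}

theorem integral_linear_comb (hlam : 0 < lam) {f u v : ℝ → ℝ} (hf : ExpDecay lam f)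
    (hu : ExpDecay lam u) (hv : ExpDecay lam v) (c d : ℝ) :
    ∫ t in Set.Ioi 0, f t * (c * u t + d * v t)
      = c * (∫ t in Set.Ioi 0, f t * u t) + d * ∫ t in Set.Ioi 0, f t * v t := by
  rw [← integral_const_mul, ← integral_const_mul, ← integral_add
    ((hf.integrableOn_mul hlam hu).const_mul c) ((hf.integrableOn_mul hlam hv).const_mul d)]
  congr 1; ext t; ring

theorem integral_comm (f u : ℝ → ℝ) :
    ∫ t in Set.Ioi (0 : ℝ), f t * u t = ∫ t in Set.Ioi (0 : ℝ), u t * f t := by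
  congr 1; ext t; ring

/-- The derivatives of the seven products are again linear combinations of these products, because
the equations are linear. Integrating them over the half line gives seven linear equations that
determine the seven integrals; no hyperbolic integral is computed. -/
theorem integrals (h : DampedPair γ w g lam α β a b) (hlam : 0 < lam) (hγ : 0 < γ) (hw : 0 < w) :
    (∫ t in Set.Ioi 0, α t * α t) = (2 * γ * w)⁻¹ ∧
    (∫ t in Set.Ioi 0, α t * β t) = 0 ∧
    (∫ t in Set.Ioi 0, β t * β t) = (2 * γ)⁻¹ ∧
    (∫ t in Set.Ioi 0, a t * α t) = -g / (4 * γ * w ^ 2) ∧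
    (∫ t in Set.Ioi 0, a t * β t) = g / (4 * γ ^ 2 * w) ∧
    (∫ t in Set.Ioi 0, b t * α t) = -g / (4 * γ ^ 2 * w) ∧
    (∫ t in Set.Ioi 0, b t * β t) = 0 := by
  obtain ⟨hα, hβ, ha, hb, dα, dβ, da, db, α0, β0, a0, b0⟩ := h
  have hβ' : ExpDecay lam fun t => -w * α t + -γ * β t := (hα.const_mul _).add (hβ.const_mul _)
  have hb' : ExpDecay lam fun t => -w * a t + -γ * b t + -g * α t :=
    ((ha.const_mul _).add (hb.const_mul _)).add (hα.const_mul _)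
  have e1 := ExpDecay.integral_deriv_mul hlam hα hα hβ hβ dα dα
  have e2 := ExpDecay.integral_deriv_mul hlam hα hβ hβ hβ' dα dβ
  have e3 := ExpDecay.integral_deriv_mul hlam hβ hβ hβ' hβ' dβ dβ
  have e4 := ExpDecay.integral_deriv_mul hlam ha hα hb hβ da dα
  have e5 := ExpDecay.integral_deriv_mul hlam ha hβ hb hβ' da dβ
  have e6 := ExpDecay.integral_deriv_mul hlam hb hα hb' hβ db dα
  have e7 := ExpDecay.integral_deriv_mul hlam hb hβ hb' hβ' db dβ
  have three : ∀ {f : ℝ → ℝ}, ExpDecay lam f →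
      ∫ t in Set.Ioi 0, (-w * a t + -γ * b t + -g * α t) * f t
        = -w * (∫ t in Set.Ioi 0, a t * f t) + -γ * (∫ t in Set.Ioi 0, b t * f t)
          + -g * ∫ t in Set.Ioi 0, α t * f t := by
    intro f hf
    have := integral_linear_comb hlam hf ((ha.const_mul (-w)).add (hb.const_mul (-γ))) hα 1 (-g)
    simp only [one_mul] at this
    rw [integral_comm, this, integral_linear_comb hlam hf ha hb, integral_comm f a,
      integral_comm f b, integral_comm f α]
  rw [integral_comm (fun t => -w * α t + -γ * β t) β] at e3
  rw [integral_comm β α] at e1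
  simp only [three hα, three hβ, integral_linear_comb hlam hα hα hβ,
    integral_linear_comb hlam hβ hα hβ, integral_linear_comb hlam ha hα hβ,
    integral_linear_comb hlam hb hα hβ, integral_comm β α, α0, β0, a0, b0] at e1 e2 e3 e4 e5 e6 e7
  generalize (∫ t in Set.Ioi 0, α t * α t) = Iαα at *
  generalize (∫ t in Set.Ioi 0, α t * β t) = Iαβ at *
  generalize (∫ t in Set.Ioi 0, β t * β t) = Iββ at *
  generalize (∫ t in Set.Ioi 0, a t * α t) = Iaα at *
  generalize (∫ t in Set.Ioi 0, a t * β t) = Iaβ at *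
  generalize (∫ t in Set.Ioi 0, b t * α t) = Ibα at *
  generalize (∫ t in Set.Ioi 0, b t * β t) = Ibβ at *
  have r1 : Iαβ = 0 := by linarith
  subst r1
  have r2 : Iββ = (2 * γ)⁻¹ := by
    refine eq_inv_of_mul_eq_one_left ?_
    linarith
  have r3 : Iαα = (2 * γ * w)⁻¹ := by
    have : w * Iαα = (2 * γ)⁻¹ := by linarith
    rw [eq_div_of_mul_eq hw.ne' ((mul_comm _ _).trans this)]; field_simp
  have r4 : Iaβ = -Ibα := by linarith
  subst r4
  -- In `e7` the terms with `w` cancel because the integrals of `a β` and `b α` are opposite, and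
  -- the term with `g` vanishes because that of `α β` does.
  have r5 : Ibβ = 0 := by
    have : γ * Ibβ = 0 := by linarith
    exact (mul_eq_zero.mp this).resolve_left hγ.ne'
  subst r5
  have r6 : Ibα = -g / (4 * γ ^ 2 * w) := by
    have : 2 * γ * Ibα = -g * Iαα := by linarith
    rw [r3] at this
    field_simp at this ⊢
    linarith
  have r7 : Iaα = -g / (4 * γ * w ^ 2) := by
    have : w * Iaα = γ * Ibα := by linarith
    rw [r6] at this
    field_simp at this ⊢
    linarith
  refine ⟨r3, rfl, r2, r7, ?_, r6, rfl⟩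
  rw [r6]; ring

end DampedPair

/-! ### The explicit propagator -/

section

variable (γ W : ℝ)

/-- `e^{-γt/2} sinh(Wt)/W`. -/
def oscPos (t : ℝ) : ℝ := Real.exp (-(γ * t / 2)) * (Real.sinh (W * t) / W)

/-- The time derivative of `oscPos`. -/
def oscVel (t : ℝ) : ℝ :=
  Real.exp (-(γ * t / 2)) * (-(γ / 2) * (Real.sinh (W * t) / W) + Real.cosh (W * t))

/-- The derivative of `oscPos` in `W`. -/
def oscPosVar (t : ℝ) : ℝ :=
  Real.exp (-(γ * t / 2)) * (t * Real.cosh (W * t) / W - Real.sinh (W * t) / W ^ 2)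

/-- The derivative of `oscVel` in `W`. -/
def oscVelVar (t : ℝ) : ℝ :=
  Real.exp (-(γ * t / 2)) * (-(γ / 2) * (t * Real.cosh (W * t) / W - Real.sinh (W * t) / W ^ 2)
    + t * Real.sinh (W * t))

variable {γ W}

theorem hasDerivAt_damping (γ t : ℝ) : HasDerivAt (fun t => Real.exp (-(γ * t / 2)))
    (Real.exp (-(γ * t / 2)) * (-(γ / 2))) t := by
  have h : HasDerivAt (fun t : ℝ => -(γ * t / 2)) (-(γ / 2)) t := by
    have := (((hasDerivAt_id t).const_mul γ).div_const 2).fun_neg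
    simpa using this
  exact h.exp

theorem hasDerivAt_sinh_mul (W t : ℝ) :
    HasDerivAt (fun t => Real.sinh (W * t)) (W * Real.cosh (W * t)) t := by
  have h : HasDerivAt (fun t : ℝ => W * t) W t := by
    simpa using (hasDerivAt_id t).const_mul W
  simpa [mul_comm] using h.sinh

theorem hasDerivAt_cosh_mul (W t : ℝ) :
    HasDerivAt (fun t => Real.cosh (W * t)) (W * Real.sinh (W * t)) t := by
  have h : HasDerivAt (fun t : ℝ => W * t) W t := by
    simpa using (hasDerivAt_id t).const_mul W
  simpa [mul_comm] using h.cosh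

theorem hasDerivAt_oscPos (hW : W ≠ 0) (t : ℝ) :
    HasDerivAt (oscPos γ W) (oscVel γ W t) t := by
  have h := (hasDerivAt_damping γ t).mul ((hasDerivAt_sinh_mul W t).div_const W)
  refine h.congr_deriv ?_
  simp only [oscVel]; field_simp

theorem hasDerivAt_oscVel (hW : W ≠ 0) (t : ℝ) : HasDerivAt (oscVel γ W)
    (-(γ ^ 2 / 4 - W ^ 2) * oscPos γ W t + -γ * oscVel γ W t) t := by
  have h := (hasDerivAt_damping γ t).mul ((((hasDerivAt_sinh_mul W t).div_const W).const_mul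
    (-(γ / 2))).add (hasDerivAt_cosh_mul W t))
  refine h.congr_deriv ?_
  simp only [oscVel, oscPos, Pi.add_apply]; field_simp; ring

theorem hasDerivAt_oscPosVar (hW : W ≠ 0) (t : ℝ) :
    HasDerivAt (oscPosVar γ W) (oscVelVar γ W t) t := by
  have h := (hasDerivAt_damping γ t).mul
    ((((hasDerivAt_id t).mul (hasDerivAt_cosh_mul W t)).div_const W).sub
      ((hasDerivAt_sinh_mul W t).div_const (W ^ 2)))
  refine h.congr_deriv ?_
  simp only [oscVelVar, id, Pi.mul_apply, Pi.sub_apply]; field_simp; ring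

theorem hasDerivAt_oscVelVar (hW : W ≠ 0) (t : ℝ) : HasDerivAt (oscVelVar γ W)
    (-(γ ^ 2 / 4 - W ^ 2) * oscPosVar γ W t + -γ * oscVelVar γ W t + 2 * W * oscPos γ W t) t := by
  have h := (hasDerivAt_damping γ t).mul
    ((((((hasDerivAt_id t).mul (hasDerivAt_cosh_mul W t)).div_const W).sub
      ((hasDerivAt_sinh_mul W t).div_const (W ^ 2))).const_mul (-(γ / 2))).add
      ((hasDerivAt_id t).mul (hasDerivAt_sinh_mul W t)))
  refine h.congr_deriv ?_
  simp only [oscVelVar, oscPos, oscPosVar, id, Pi.mul_apply, Pi.add_apply, Pi.sub_apply]; field_simp; ring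

theorem hasDerivAt_oscPos_param (hW : W ≠ 0) (t : ℝ) :
    HasDerivAt (fun V => oscPos γ V t) (oscPosVar γ W t) W := by
  have hs : HasDerivAt (fun V => Real.sinh (V * t)) (t * Real.cosh (W * t)) W := by
    have h : HasDerivAt (fun V : ℝ => V * t) t W := by
      simpa using (hasDerivAt_id W).mul_const t
    simpa [mul_comm] using h.sinh
  have h := (hs.div (hasDerivAt_id W) hW).const_mul (Real.exp (-(γ * t / 2)))
  refine h.congr_deriv ?_
  simp only [oscPosVar, id]; field_simp

theorem hasDerivAt_oscVel_param (hW : W ≠ 0) (t : ℝ) :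
    HasDerivAt (fun V => oscVel γ V t) (oscVelVar γ W t) W := by
  have hs : HasDerivAt (fun V => Real.sinh (V * t)) (t * Real.cosh (W * t)) W := by
    have h : HasDerivAt (fun V : ℝ => V * t) t W := by
      simpa using (hasDerivAt_id W).mul_const t
    simpa [mul_comm] using h.sinh
  have hc : HasDerivAt (fun V => Real.cosh (V * t)) (t * Real.sinh (W * t)) W := by
    have h : HasDerivAt (fun V : ℝ => V * t) t W := by
      simpa using (hasDerivAt_id W).mul_const t
    simpa [mul_comm] using h.cosh
  have h := (((hs.div (hasDerivAt_id W) hW).const_mul (-(γ / 2))).add hc).const_mul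
    (Real.exp (-(γ * t / 2)))
  refine h.congr_deriv ?_
  simp only [oscVelVar, id]; field_simp

/-- The hyperbolic functions grow like `e^{Wt}` against the damping `e^{-γt/2}`. Half of the gap
`γ/2 - W` pays for the factor `1 + t` created by differentiation in `W`; the other half remains as
decay rate. -/
theorem expDecay_of_hyperbolic {A B : ℝ} (hW : 0 ≤ W) {lam : ℝ} (hlam : 0 < lam)
    (hl : 2 * lam ≤ γ / 2 - W) {u v : ℝ → ℝ} (hu : Continuous u) (hv : Continuous v)
    (hu' : ∀ t, 0 ≤ t → |u t| ≤ A * (1 + t)) (hv' : ∀ t, 0 ≤ t → |v t| ≤ B * (1 + t)) :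
    ExpDecay lam fun t =>
      Real.exp (-(γ * t / 2)) * (u t * Real.sinh (W * t) + v t * Real.cosh (W * t)) := by
  refine ⟨by fun_prop, (A + B) * (1 + lam⁻¹), fun t ht => ?_⟩
  have hA : 0 ≤ A := by simpa using (abs_nonneg _).trans (hu' 0 le_rfl)
  have hB : 0 ≤ B := by simpa using (abs_nonneg _).trans (hv' 0 le_rfl)
  have hWt : 0 ≤ W * t := by positivity
  have hc : |Real.cosh (W * t)| ≤ Real.exp (W * t) := by
    rw [abs_of_pos (Real.cosh_pos _), Real.cosh_eq]
    linarith [Real.exp_le_exp.2 (show -(W * t) ≤ W * t by linarith)]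
  have hs : |Real.sinh (W * t)| ≤ Real.exp (W * t) := by
    rw [abs_of_nonneg (Real.sinh_nonneg_iff.2 hWt), Real.sinh_eq]
    linarith [Real.exp_pos (-(W * t)), Real.exp_pos (W * t)]
  have h1 : 1 + t ≤ (1 + lam⁻¹) * Real.exp (lam * t) := by
    have := Real.add_one_le_exp (lam * t)
    have h2 : lam⁻¹ * (lam * t + 1) ≤ lam⁻¹ * Real.exp (lam * t) :=
      mul_le_mul_of_nonneg_left this (by positivity)
    have h3 : lam⁻¹ * (lam * t + 1) = t + lam⁻¹ := by field_simp
    have h4 : 1 ≤ Real.exp (lam * t) := Real.one_le_exp (by positivity)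
    have h5 : 0 < lam⁻¹ := by positivity
    nlinarith
  rw [abs_mul, Real.abs_exp]
  calc Real.exp (-(γ * t / 2)) * |u t * Real.sinh (W * t) + v t * Real.cosh (W * t)|
      ≤ Real.exp (-(γ * t / 2)) * (|u t| * |Real.sinh (W * t)| + |v t| * |Real.cosh (W * t)|) := by
        gcongr
        refine (abs_add_le _ _).trans ?_
        rw [abs_mul, abs_mul]
    _ ≤ Real.exp (-(γ * t / 2)) *
        (A * (1 + t) * Real.exp (W * t) + B * (1 + t) * Real.exp (W * t)) := by
        gcongr
        · exact hu' t ht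
        · exact hv' t ht
    _ = (A + B) * (1 + t) * Real.exp (-(γ * t / 2) + W * t) := by rw [Real.exp_add]; ring
    _ ≤ (A + B) * ((1 + lam⁻¹) * Real.exp (lam * t)) * Real.exp (-(2 * lam * t)) := by
        gcongr
        nlinarith
    _ = (A + B) * (1 + lam⁻¹) * Real.exp (-(lam * t)) := by
        rw [show -(lam * t) = lam * t + -(2 * lam * t) by ring, Real.exp_add]; ring

/-- Since `w = γ²/4 - W²`, moving `W` at speed `V` moves `w` at speed `-2WV`, which is the direction
of the variation. -/
theorem dampedPair_osc (hW : 0 < W) (hγ : W < γ / 2) (V : ℝ) :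
    DampedPair γ (γ ^ 2 / 4 - W ^ 2) (-(2 * W * V)) ((γ / 2 - W) / 2) (oscPos γ W) (oscVel γ W)
      (fun t => V * oscPosVar γ W t) (fun t => V * oscVelVar γ W t) := by
  have hlam : 0 < (γ / 2 - W) / 2 := by linarith
  have hl : 2 * ((γ / 2 - W) / 2) ≤ γ / 2 - W := by linarith
  have hc : ∀ c : ℝ, ∀ t : ℝ, 0 ≤ t → |c| ≤ |c| * (1 + t) := fun c t ht =>
    le_mul_of_one_le_right (abs_nonneg _) (by linarith)
  have hcl : ∀ c : ℝ, ∀ t : ℝ, 0 ≤ t → |c * t| ≤ |c| * (1 + t) := fun c t ht => by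
    rw [abs_mul, abs_of_nonneg ht]
    exact mul_le_mul_of_nonneg_left (by linarith) (abs_nonneg _)
  have hcc : ∀ c d : ℝ, ∀ t : ℝ, 0 ≤ t → |c + d * t| ≤ (|c| + |d|) * (1 + t) := fun c d t ht => by
    refine (abs_add_le _ _).trans ?_
    rw [add_mul]
    exact add_le_add (hc c t ht) (hcl d t ht)
  have dα : ExpDecay ((γ / 2 - W) / 2) (oscPos γ W) := by
    convert expDecay_of_hyperbolic hW.le hlam hl (continuous_const (y := W⁻¹))
      (continuous_const (y := (0 : ℝ))) (hc _) (hc _) using 2 with t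
    simp only [oscPos]; ring
  have dβ : ExpDecay ((γ / 2 - W) / 2) (oscVel γ W) := by
    convert expDecay_of_hyperbolic hW.le hlam hl (continuous_const (y := -(γ / 2) * W⁻¹))
      (continuous_const (y := (1 : ℝ))) (hc _) (hc _) using 2 with t
    simp only [oscVel]; ring
  have da : ExpDecay ((γ / 2 - W) / 2) (oscPosVar γ W) := by
    convert expDecay_of_hyperbolic hW.le hlam hl (continuous_const (y := -(W ^ 2)⁻¹))
      (by fun_prop : Continuous fun t : ℝ => W⁻¹ * t)
      (hc _) (hcl _) using 2 with t
    simp only [oscPosVar]; ring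
  have db : ExpDecay ((γ / 2 - W) / 2) (oscVelVar γ W) := by
    convert expDecay_of_hyperbolic hW.le hlam hl
      (by fun_prop : Continuous fun t : ℝ => (γ / 2) * (W ^ 2)⁻¹ + 1 * t)
      (by fun_prop : Continuous fun t : ℝ => -(γ / 2) * W⁻¹ * t)
      (hcc _ _) (hcl _) using 2 with t
    simp only [oscVelVar]; ring
  refine ⟨dα, dβ, da.const_mul V, db.const_mul V, hasDerivAt_oscPos hW.ne',
    hasDerivAt_oscVel hW.ne', fun t => (hasDerivAt_oscPosVar hW.ne' t).const_mul V, fun t =>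
    ((hasDerivAt_oscVelVar hW.ne' t).const_mul V).congr_deriv (by ring), ?_, ?_, ?_, ?_⟩ <;>
  simp [oscPos, oscVel, oscPosVar, oscVelVar]

end

/-! ### The symbols `U₀` and `U₁` -/

section

variable {Φ : ℤ → ℝ} {γ : ℝ}

theorem Ahat_one_zero (t k : ℝ) : Ahat Φ γ t k 1 0 = oscPos γ (bigOmega Φ γ k) t := by
  simp [Ahat, oscPos]; ring

theorem Ahat_one_one {t k : ℝ} (h : bigOmega Φ γ k ≠ 0) :
    Ahat Φ γ t k 1 1 = oscVel γ (bigOmega Φ γ k) t := by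
  simp [Ahat, oscVel]; field_simp

theorem Admissible.bigOmega_arg_pos (hΦ : Admissible Φ γ) (k : ℝ) :
    0 < 1 - (2 * disp Φ k / γ) ^ 2 := by
  have h1 : 2 * disp Φ k / γ < 1 := (div_lt_one hΦ.gamma_pos).2 (hΦ.noise k)
  have h0 : 0 ≤ 2 * disp Φ k / γ := div_nonneg (by linarith [hΦ.disp_pos k]) hΦ.gamma_pos.le
  nlinarith

theorem Admissible.bigOmega_pos (hΦ : Admissible Φ γ) (k : ℝ) : 0 < bigOmega Φ γ k :=
  mul_pos (by linarith [hΦ.gamma_pos]) (Real.sqrt_pos.2 (hΦ.bigOmega_arg_pos k))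

theorem Admissible.bigOmega_sq (hΦ : Admissible Φ γ) (k : ℝ) :
    γ ^ 2 / 4 - bigOmega Φ γ k ^ 2 = phiHat Φ k := by
  have := hΦ.gamma_pos.ne'
  rw [bigOmega, mul_pow, Real.sq_sqrt (hΦ.bigOmega_arg_pos k).le, ← hΦ.disp_sq]
  field_simp; ring

theorem Admissible.bigOmega_lt (hΦ : Admissible Φ γ) (k : ℝ) : bigOmega Φ γ k < γ / 2 := by
  have h1 := hΦ.bigOmega_sq k
  have h2 := hΦ.phiHat_pos k
  have h3 := hΦ.gamma_pos
  nlinarith [hΦ.bigOmega_pos k]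

theorem Admissible.bigOmega_eq (hΦ : Admissible Φ γ) (k : ℝ) :
    bigOmega Φ γ k = Real.sqrt (γ ^ 2 / 4 - phiHat Φ k) := by
  rw [← hΦ.bigOmega_sq k, sub_sub_cancel, Real.sqrt_sq (hΦ.bigOmega_pos k).le]

theorem Admissible.hasDerivAt_bigOmega (hΦ : Admissible Φ γ) (k : ℝ) :
    HasDerivAt (bigOmega Φ γ) (-phiHatDeriv Φ k / (2 * bigOmega Φ γ k)) k := by
  have h0 : γ ^ 2 / 4 - phiHat Φ k ≠ 0 := by
    rw [← hΦ.bigOmega_sq k, sub_sub_cancel]; exact pow_ne_zero 2 (hΦ.bigOmega_pos k).ne'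
  have h := ((hΦ.hasDerivAt_phiHat k).const_sub (γ ^ 2 / 4)).sqrt h0
  rw [← hΦ.bigOmega_eq k] at h
  rw [funext hΦ.bigOmega_eq] at *
  exact h

theorem Admissible.dAhat_one_zero (hΦ : Admissible Φ γ) (t k : ℝ) :
    dAhat Φ γ t k 1 0 = -phiHatDeriv Φ k / (2 * bigOmega Φ γ k)
      * oscPosVar γ (bigOmega Φ γ k) t := by
  simp only [dAhat, Matrix.of_apply, Ahat_one_zero]
  rw [mul_comm]
  exact ((hasDerivAt_oscPos_param (hΦ.bigOmega_pos k).ne' t).comp k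
    (hΦ.hasDerivAt_bigOmega k)).deriv

theorem Admissible.dAhat_one_one (hΦ : Admissible Φ γ) (t k : ℝ) :
    dAhat Φ γ t k 1 1 = -phiHatDeriv Φ k / (2 * bigOmega Φ γ k)
      * oscVelVar γ (bigOmega Φ γ k) t := by
  simp only [dAhat, Matrix.of_apply, fun κ => Ahat_one_one (t := t) (hΦ.bigOmega_pos κ).ne']
  rw [mul_comm]
  exact ((hasDerivAt_oscVel_param (hΦ.bigOmega_pos k).ne' t).comp k
    (hΦ.hasDerivAt_bigOmega k)).deriv

theorem calA_apply (t k : ℝ) (i j : Fin 2) :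
    calA Φ γ t k i j = Ahat Φ γ t k 1 i * Ahat Φ γ t k 1 j := by
  simp [calA, projP, Matrix.mul_apply, Fin.sum_univ_two]

theorem calAtilde_apply (t k : ℝ) (i j : Fin 2) :
    calAtilde Φ γ t k i j = (2 * Real.pi)⁻¹ * (dAhat Φ γ t k 1 i * Ahat Φ γ t k 1 j) := by
  simp [calAtilde, projP, Matrix.mul_apply, Fin.sum_univ_two]

/-- Only the second row of `Â_t` survives `projP`; it is an oscillator solution and its velocity,
with squared frequency `Φ̂(k)`. By the chain rule `-2ΩΩ' = Φ̂'`, the direction of the first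
variation. -/
theorem Admissible.dampedPair (hΦ : Admissible Φ γ) (k : ℝ) :
    DampedPair γ (phiHat Φ k) (phiHatDeriv Φ k) ((γ / 2 - bigOmega Φ γ k) / 2)
      (fun t => Ahat Φ γ t k 1 0) (fun t => Ahat Φ γ t k 1 1)
      (fun t => dAhat Φ γ t k 1 0) (fun t => dAhat Φ γ t k 1 1) := by
  have hW := (hΦ.bigOmega_pos k)
  have h := dampedPair_osc hW (hΦ.bigOmega_lt k) (-phiHatDeriv Φ k / (2 * bigOmega Φ γ k))
  rw [hΦ.bigOmega_sq k, show -(2 * bigOmega Φ γ k * (-phiHatDeriv Φ k / (2 * bigOmega Φ γ k)))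
    = phiHatDeriv Φ k by field_simp] at h
  simpa only [Ahat_one_zero, Ahat_one_one hW.ne', hΦ.dAhat_one_zero, hΦ.dAhat_one_one] using h

theorem Admissible.decayRate_pos (hΦ : Admissible Φ γ) (k : ℝ) :
    0 < (γ / 2 - bigOmega Φ γ k) / 2 := by linarith [hΦ.bigOmega_lt k]

theorem Admissible.integrable_symbols (hΦ : Admissible Φ γ) (k : ℝ) (i j : Fin 2) :
    IntegrableOn (fun t => calA Φ γ t k i j) (Set.Ioi 0) ∧
      IntegrableOn (fun t => calAtilde Φ γ t k i j) (Set.Ioi 0) := by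
  have h := hΦ.dampedPair k
  have hl := hΦ.decayRate_pos k
  have hA : ∀ i, ExpDecay ((γ / 2 - bigOmega Φ γ k) / 2) fun t => Ahat Φ γ t k 1 i := by
    intro i; fin_cases i
    · exact h.decay_α
    · exact h.decay_β
  have hB : ∀ i, ExpDecay ((γ / 2 - bigOmega Φ γ k) / 2) fun t => dAhat Φ γ t k 1 i := by
    intro i; fin_cases i
    · exact h.decay_a
    · exact h.decay_b
  simp only [calA_apply, calAtilde_apply]
  exact ⟨(hA i).integrableOn_mul hl (hA j), ((hB i).integrableOn_mul hl (hA j)).const_mul _⟩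

theorem Admissible.U0_eq (hΦ : Admissible Φ γ) (k : ℝ) :
    U0 Φ γ k = !![(disp Φ k ^ 2)⁻¹, 0; 0, 1] := by
  obtain ⟨h1, h2, h3, -⟩ := (hΦ.dampedPair k).integrals (hΦ.decayRate_pos k) hΦ.gamma_pos
    (hΦ.phiHat_pos k)
  have hγ := hΦ.gamma_pos.ne'
  have hp := (hΦ.phiHat_pos k).ne'
  rw [hΦ.disp_sq]
  ext i j
  fin_cases i <;> fin_cases j <;> simp only [U0, Matrix.of_apply, calA_apply, Fin.zero_eta,
    Fin.mk_one, Matrix.cons_val', Matrix.cons_val_zero, Matrix.cons_val_one,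
    Matrix.cons_val_fin_one, Fin.isValue]
  · rw [h1]; field_simp
  · rw [h2]; simp
  · rw [DampedPair.integral_comm, h2]; simp
  · rw [h3]; field_simp

theorem Admissible.U1_eq (hΦ : Admissible Φ γ) (k : ℝ) :
    U1 Φ γ k = (-(velocity Φ k / disp Φ k)) • !![(disp Φ k ^ 2)⁻¹, -γ⁻¹; γ⁻¹, 0] := by
  obtain ⟨-, -, -, h1, h2, h3, h4⟩ := (hΦ.dampedPair k).integrals (hΦ.decayRate_pos k)
    hΦ.gamma_pos (hΦ.phiHat_pos k)
  have hγ := hΦ.gamma_pos.ne'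
  have hp := (hΦ.phiHat_pos k).ne'
  have hπ := Real.pi_ne_zero
  rw [hΦ.disp_sq, hΦ.velocity_div_disp]
  ext i j
  fin_cases i <;> fin_cases j <;> simp only [U1, Matrix.of_apply, calAtilde_apply, Fin.zero_eta,
    Fin.mk_one, Matrix.cons_val', Matrix.cons_val_zero, Matrix.cons_val_one,
    Matrix.cons_val_fin_one, Fin.isValue, Matrix.smul_apply, smul_eq_mul, integral_const_mul]
  · rw [h1]; field_simp
  · rw [h2]; field_simp
  · rw [h3]; field_simp
  · rw [h4]; simp

end

/-! ### Differential inequalities -/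

theorem exp_neg_mul_le {c c' t : ℝ} (h : c ≤ c') (ht : 0 ≤ t) :
    Real.exp (-(c' * t)) ≤ Real.exp (-(c * t)) :=
  Real.exp_le_exp.2 (neg_le_neg (mul_le_mul_of_nonneg_right h ht))

theorem le_exp_mul_of_deriv_le {c : ℝ} {Y Y' : ℝ → ℝ}
    (hY : ∀ t, 0 ≤ t → HasDerivAt Y (Y' t) t) (h : ∀ t, 0 ≤ t → Y' t ≤ -c * Y t)
    {t : ℝ} (ht : 0 ≤ t) : Y t ≤ Real.exp (-(c * t)) * Y 0 := by
  have hG : ∀ t, 0 ≤ t → HasDerivAt (fun t => Real.exp (c * t) * Y t)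
      (Real.exp (c * t) * c * Y t + Real.exp (c * t) * Y' t) t := by
    intro t ht
    have h1 : HasDerivAt (fun t : ℝ => c * t) c t := by
      simpa using (hasDerivAt_id t).const_mul c
    exact h1.exp.mul (hY t ht)
  have hanti : AntitoneOn (fun t => Real.exp (c * t) * Y t) (Set.Ici 0) := by
    refine antitoneOn_of_deriv_nonpos (convex_Ici 0)
      (fun t ht => (hG t ht).continuousAt.continuousWithinAt) (fun t ht => ?_) (fun t ht => ?_)
    · rw [interior_Ici] at ht
      exact (hG t ht.le).differentiableAt.differentiableWithinAt
    · rw [interior_Ici] at ht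
      rw [(hG t ht.le).deriv, mul_assoc, ← mul_add]
      exact mul_nonpos_of_nonneg_of_nonpos (Real.exp_pos _).le (by linarith [h t ht.le])
  have := hanti (Set.mem_Ici.2 le_rfl) (Set.mem_Ici.2 ht) ht
  simp only [mul_zero, Real.exp_zero, one_mul] at this
  calc Y t = Real.exp (-(c * t)) * (Real.exp (c * t) * Y t) := by
        rw [← mul_assoc, ← Real.exp_add]; simp
    _ ≤ _ := mul_le_mul_of_nonneg_left this (Real.exp_pos _).le

/-- The multiple `2/c` of the forcing is a supersolution: as the forcing decays at most half as fast
as `e^{-ct}`, subtracting this multiple from `Y` leaves the homogeneous inequality. The forcing thus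
keeps its own rates. -/
theorem le_of_deriv_le_forcing {c α β A B : ℝ} {Y Y' : ℝ → ℝ} (hc : 0 < c)
    (hA : 0 ≤ A) (hB : 0 ≤ B) (hα : 2 * α ≤ c) (hβ : 2 * β ≤ c)
    (hY : ∀ t, 0 ≤ t → HasDerivAt Y (Y' t) t)
    (h : ∀ t, 0 ≤ t → Y' t ≤ -c * Y t + (A * Real.exp (-(α * t)) + B * Real.exp (-(β * t))))
    {t : ℝ} (ht : 0 ≤ t) : Y t ≤ Real.exp (-(c * t)) * Y 0
      + 2 / c * (A * Real.exp (-(α * t)) + B * Real.exp (-(β * t))) := by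
  have he : ∀ α t : ℝ, HasDerivAt (fun t => Real.exp (-(α * t))) (Real.exp (-(α * t)) * -α) t := by
    intro α t
    have h1 : HasDerivAt (fun t : ℝ => -(α * t)) (-α) t := by
      simpa using ((hasDerivAt_id t).const_mul α).fun_neg
    exact h1.exp
  have key := le_exp_mul_of_deriv_le (c := c)
    (Y := fun t => Y t - 2 / c * (A * Real.exp (-(α * t)) + B * Real.exp (-(β * t))))
    (fun t ht => (hY t ht).sub
      ((((he α t).const_mul A).add ((he β t).const_mul B)).const_mul (2 / c)))
    (fun t ht => ?_) ht
  · simp only [mul_zero, neg_zero, Real.exp_zero, mul_one] at key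
    have h0 : 0 ≤ Real.exp (-(c * t)) * (2 / c * (A + B)) := by positivity
    linarith [mul_sub (Real.exp (-(c * t))) (Y 0) (2 / c * (A + B))]
  · have h1 : 2 / c * (A * Real.exp (-(α * t)) * α) ≤ A * Real.exp (-(α * t)) := by
      rw [div_mul_eq_mul_div, div_le_iff₀ hc]
      have : 0 ≤ A * Real.exp (-(α * t)) := by positivity
      nlinarith
    have h2 : 2 / c * (B * Real.exp (-(β * t)) * β) ≤ B * Real.exp (-(β * t)) := by
      rw [div_mul_eq_mul_div, div_le_iff₀ hc]
      have : 0 ≤ B * Real.exp (-(β * t)) := by positivity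
      nlinarith
    have h3 : -c * (Y t - 2 / c * (A * Real.exp (-(α * t)) + B * Real.exp (-(β * t))))
        = -c * Y t + 2 * (A * Real.exp (-(α * t)) + B * Real.exp (-(β * t))) := by
      field_simp; ring
    rw [h3]
    linarith [h t ht]

/-! ### Averages over a finite set -/

section Avg

variable {ι : Type} [Fintype ι]

/-- The mean value of a function on a finite type. -/
def avg (g : ι → ℝ) : ℝ := (Fintype.card ι : ℝ)⁻¹ * ∑ κ, g κ

theorem avg_add (g h : ι → ℝ) : avg (fun κ => g κ + h κ) = avg g + avg h := by
  simp [avg, Finset.sum_add_distrib, mul_add]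

theorem avg_sub (g h : ι → ℝ) : avg (fun κ => g κ - h κ) = avg g - avg h := by
  simp [avg, Finset.sum_sub_distrib, mul_sub]

theorem avg_const_mul (c : ℝ) (g : ι → ℝ) : avg (fun κ => c * g κ) = c * avg g := by
  simp only [avg, ← Finset.mul_sum]; ring

theorem avg_const [Nonempty ι] (c : ℝ) : avg (fun _ : ι => c) = c := by
  simp [avg]

theorem avg_mono {g h : ι → ℝ} (hgh : ∀ κ, g κ ≤ h κ) : avg g ≤ avg h :=
  mul_le_mul_of_nonneg_left (Finset.sum_le_sum fun κ _ => hgh κ) (by positivity)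

theorem avg_nonneg {g : ι → ℝ} (hg : ∀ κ, 0 ≤ g κ) : 0 ≤ avg g :=
  mul_nonneg (by positivity) (Finset.sum_nonneg fun κ _ => hg κ)

theorem sq_avg_le (g : ι → ℝ) [Nonempty ι] : avg g ^ 2 ≤ avg fun κ => g κ ^ 2 := by
  have h : 0 ≤ avg fun κ => (g κ - avg g) ^ 2 := avg_nonneg fun _ => sq_nonneg _
  have e : (fun κ => (g κ - avg g) ^ 2)
      = fun κ => (g κ ^ 2 - (2 * avg g) * g κ) + avg g ^ 2 := by
    ext κ; ring
  rw [e, avg_add, avg_sub, avg_const_mul, avg_const] at h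
  nlinarith

theorem hasDerivAt_avg {g : ℝ → ι → ℝ} {g' : ι → ℝ} {t : ℝ}
    (h : ∀ κ, HasDerivAt (fun t => g t κ) (g' κ) t) : HasDerivAt (fun t => avg (g t)) (avg g') t :=
  (HasDerivAt.fun_sum fun κ _ => h κ).const_mul _

theorem avg_expand₅ (c₁ c₂ c₃ c₄ c₅ : ℝ) (g₁ g₂ g₃ g₄ g₅ : ι → ℝ) :
    avg (fun κ => c₁ * g₁ κ + c₂ * g₂ κ + c₃ * g₃ κ + c₄ * g₄ κ + c₅ * g₅ κ)
      = c₁ * avg g₁ + c₂ * avg g₂ + c₃ * avg g₃ + c₄ * avg g₄ + c₅ * avg g₅ := by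
  simp only [avg_add, avg_const_mul]

end Avg

/-! ### The pointwise Lyapunov density -/

/-- The density of the modified energy. -/
def lyap (ε a b p q r s f : ℝ) : ℝ :=
  a * b * p ^ 2 + a * q ^ 2 + b * r ^ 2 + s ^ 2 + ε * ((q + r) * ((a + b) * p - 2 * f))

/-- The derivative of `lyap` along a curve with velocity `(p', q', r', s', f')`. -/
def lyapDot (ε a b p q r s f p' q' r' s' f' : ℝ) : ℝ :=
  2 * (a * b) * (p * p') + 2 * a * (q * q') + 2 * b * (r * r') + 2 * (s * s')
    + ε * ((q' + r') * ((a + b) * p - 2 * f) + (q + r) * ((a + b) * p' - 2 * f'))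

theorem hasDerivAt_lyap {ε a b t p' q' r' s' f' : ℝ} {p q r s f : ℝ → ℝ}
    (hp : HasDerivAt p p' t) (hq : HasDerivAt q q' t) (hr : HasDerivAt r r' t)
    (hs : HasDerivAt s s' t) (hf : HasDerivAt f f' t) :
    HasDerivAt (fun t => lyap ε a b (p t) (q t) (r t) (s t) (f t))
      (lyapDot ε a b (p t) (q t) (r t) (s t) (f t) p' q' r' s' f') t := by
  have h := (((((hp.fun_pow 2).const_mul (a * b)).fun_add ((hq.fun_pow 2).const_mul a)).fun_add
    ((hr.fun_pow 2).const_mul b)).fun_add (hs.fun_pow 2)).fun_add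
    (((hq.fun_add hr).fun_mul ((hp.const_mul (a + b)).fun_sub (hf.const_mul 2))).const_mul ε)
  refine h.congr_deriv ?_
  simp only [lyapDot]; push_cast; ring

/-- Smallness of the parameter of the modified energy. -/
structure SmallParam (γ m M ε : ℝ) : Prop where
  pos : 0 < ε
  h1 : 2 * ε * (γ ^ 2 + 2 * M + 1) + 2 * ε * M ^ 2 ≤ γ * m
  h2 : 2 * ε ≤ γ
  h3 : 2 * ε ≤ m
  h4 : 8 * ε * M ^ 2 ≤ m ^ 2
  h5 : 8 * ε ≤ 1

theorem exists_smallParam {γ m M : ℝ} (hγ : 0 < γ) (hm : 0 < m) (hM : 0 < M) :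
    ∃ ε, SmallParam γ m M ε := by
  have key : ∀ A B : ℝ, 0 < A → 0 < B → ∀ᶠ ε in 𝓝[>] (0 : ℝ), ε * A ≤ B := by
    intro A B hA hB
    filter_upwards [Ioo_mem_nhdsGT (div_pos hB hA)] with ε hε
    exact ((lt_div_iff₀ hA).1 hε.2).le
  obtain ⟨ε, ⟨⟨⟨⟨⟨h0, h1⟩, h2⟩, h3⟩, h4⟩, h5⟩⟩ := (((((eventually_mem_nhdsWithin.and
    (key (2 * (γ ^ 2 + 2 * M + 1) + 2 * M ^ 2) (γ * m) (by positivity) (by positivity))).and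
    (key 2 γ (by positivity) hγ)).and (key 2 m (by positivity) hm)).and
    (key (8 * M ^ 2) (m ^ 2) (by positivity) (by positivity))).and
    (key 8 1 (by positivity) one_pos)).exists
  exact ⟨ε, h0, by linarith, by linarith, by linarith, by linarith, by linarith⟩

section Pointwise

variable {γ m M ε a b : ℝ}

/-- The dissipation of the modified energy along the fiber dynamics. -/
theorem lyapDot_le (hm : 0 < m) (hγ : 0 < γ) (hε : SmallParam γ m M ε) (ha : m ≤ a) (ha' : a ≤ M)
    (hb : m ≤ b) (hb' : b ≤ M) (p q r s f f' : ℝ) :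
    lyapDot ε a b p q r s f (q + r) (s - b * p - γ * q) (s - a * p - γ * r)
        (-(a * q) - b * r - 2 * γ * (s - f)) f'
      ≤ -(γ * m + 2 * ε * M ^ 2) * (q ^ 2 + r ^ 2) - 2 * γ * (s - f) ^ 2
        - ε / 2 * ((a + b) * p - 2 * f) ^ 2 - 4 * γ * (f * (s - f)) + ε * f' ^ 2 := by
  have h0 := hε.pos
  set h := (a + b) * p - 2 * f with hh
  set g := s - f with hg
  -- The Hamiltonian exchange terms cancel in the main quadratic form, and `-4γ s g` splits into
  -- `-4γ g²` and `-4γ f g`. The latter will have zero mean over the fiber, so it is kept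
  -- unestimated.
  have e : lyapDot ε a b p q r s f (q + r) (s - b * p - γ * q) (s - a * p - γ * r)
        (-(a * q) - b * r - 2 * γ * g) f'
      = -2 * γ * (a * q ^ 2 + b * r ^ 2) - 4 * γ * g ^ 2 - 4 * γ * (f * g)
        + ε * (2 * (g * h) - h ^ 2 - γ * (q + r) * h + (a + b) * (q + r) ^ 2
          - 2 * (q + r) * f') := by
    rw [lyapDot, ← hh, show s = g + f by rw [hg]; ring]
    have hp : (a + b) * p = h + 2 * f := by rw [hh]; ring
    linear_combination (ε * h * (-1)) * hp
  rw [e]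
  -- The gain of the cross term is `-h²`. Young's inequality spends half of it; the other products
  -- are charged to the damping of `q`, `r` and `g`.
  have i1 : 2 * (g * h) ≤ 4 * g ^ 2 + h ^ 2 / 4 := by nlinarith [sq_nonneg (2 * g - h / 2)]
  have i2 : -γ * (q + r) * h ≤ γ ^ 2 * (q + r) ^ 2 + h ^ 2 / 4 := by
    nlinarith [sq_nonneg (γ * (q + r) + h / 2)]
  have i3 : (a + b) * (q + r) ^ 2 ≤ 2 * M * (q + r) ^ 2 :=
    mul_le_mul_of_nonneg_right (by linarith) (sq_nonneg _)
  have i4 : -2 * (q + r) * f' ≤ (q + r) ^ 2 + f' ^ 2 := by nlinarith [sq_nonneg (q + r + f')]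
  have hM : 0 < M := by linarith
  have i5 : (γ ^ 2 + 2 * M + 1) * (q + r) ^ 2 ≤ (γ ^ 2 + 2 * M + 1) * (2 * (q ^ 2 + r ^ 2)) :=
    mul_le_mul_of_nonneg_left (by nlinarith [sq_nonneg (q - r)]) (by positivity)
  have i6 : ε * (2 * (g * h) - h ^ 2 - γ * (q + r) * h + (a + b) * (q + r) ^ 2
      - 2 * (q + r) * f') ≤ ε * (4 * g ^ 2 - h ^ 2 / 2
        + (γ ^ 2 + 2 * M + 1) * (2 * (q ^ 2 + r ^ 2)) + f' ^ 2) :=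
    mul_le_mul_of_nonneg_left (by linarith) h0.le
  have i7 : γ * (m * (q ^ 2 + r ^ 2)) ≤ γ * (a * q ^ 2 + b * r ^ 2) := by
    refine mul_le_mul_of_nonneg_left ?_ hγ.le
    nlinarith [mul_le_mul_of_nonneg_right ha (sq_nonneg q),
      mul_le_mul_of_nonneg_right hb (sq_nonneg r)]
  -- The choice of `ε` leaves `2εM²(q² + r²)` in reserve, to absorb `ε f'²` after averaging.
  have i8 := mul_le_mul_of_nonneg_right hε.h1 (by positivity : 0 ≤ q ^ 2 + r ^ 2)
  have i9 := mul_le_mul_of_nonneg_right hε.h2 (sq_nonneg g)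
  linarith

/-- The cross term is dominated by the diagonal form except for `4ε f²`, as `f` is not controlled by
`s` at a single point. When `f` is the mean of `s`, the defect `-f²/2` is recovered by averaging. -/
theorem le_lyap (hm : 0 < m) (hε : SmallParam γ m M ε) (ha : m ≤ a) (ha' : a ≤ M)
    (hb : m ≤ b) (hb' : b ≤ M) (p q r s f : ℝ) :
    m ^ 2 / 2 * p ^ 2 + m / 2 * q ^ 2 + m / 2 * r ^ 2 + s ^ 2 - f ^ 2 / 2
      ≤ lyap ε a b p q r s f := by
  have h0 := hε.pos
  have i1 : -((q + r) * ((a + b) * p - 2 * f))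
      ≤ q ^ 2 + r ^ 2 + 4 * M ^ 2 * p ^ 2 + 4 * f ^ 2 := by
    have : ((a + b) * p - 2 * f) ^ 2 ≤ 2 * ((a + b) ^ 2 * p ^ 2) + 8 * f ^ 2 := by
      nlinarith [sq_nonneg ((a + b) * p + 2 * f)]
    have h2 : (a + b) ^ 2 * p ^ 2 ≤ (2 * M) ^ 2 * p ^ 2 :=
      mul_le_mul_of_nonneg_right (pow_le_pow_left₀ (by linarith) (by linarith) 2) (sq_nonneg p)
    nlinarith [sq_nonneg (q + r + ((a + b) * p - 2 * f)), sq_nonneg (q - r)]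
  have i2 := mul_le_mul_of_nonneg_left i1 h0.le
  have i3 : m ^ 2 * p ^ 2 ≤ a * b * p ^ 2 :=
    mul_le_mul_of_nonneg_right (by nlinarith) (sq_nonneg p)
  have i4 := mul_le_mul_of_nonneg_right ha (sq_nonneg q)
  have i5 := mul_le_mul_of_nonneg_right hb (sq_nonneg r)
  have i6 := mul_le_mul_of_nonneg_right hε.h3 (sq_nonneg q)
  have i7 := mul_le_mul_of_nonneg_right hε.h3 (sq_nonneg r)
  have i8 := mul_le_mul_of_nonneg_right hε.h4 (sq_nonneg p)
  have i9 := mul_le_mul_of_nonneg_right hε.h5 (sq_nonneg f)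
  rw [lyap]
  linarith

theorem lyap_le (hm : 0 < m) (hε : SmallParam γ m M ε) (ha : m ≤ a) (ha' : a ≤ M)
    (hb : m ≤ b) (hb' : b ≤ M) (p q r s f : ℝ) :
    lyap ε a b p q r s f
      ≤ (2 * M ^ 2 + M + 1) * (p ^ 2 + q ^ 2 + r ^ 2 + s ^ 2 + f ^ 2) := by
  have h0 := hε.pos
  have hM : 0 < M := by linarith
  have i1 : (q + r) * ((a + b) * p - 2 * f)
      ≤ q ^ 2 + r ^ 2 + 4 * M ^ 2 * p ^ 2 + 4 * f ^ 2 := by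
    have : ((a + b) * p - 2 * f) ^ 2 ≤ 2 * ((a + b) ^ 2 * p ^ 2) + 8 * f ^ 2 := by
      nlinarith [sq_nonneg ((a + b) * p + 2 * f)]
    have h2 : (a + b) ^ 2 * p ^ 2 ≤ (2 * M) ^ 2 * p ^ 2 :=
      mul_le_mul_of_nonneg_right (pow_le_pow_left₀ (by linarith) (by linarith) 2) (sq_nonneg p)
    nlinarith [sq_nonneg (q + r - ((a + b) * p - 2 * f)), sq_nonneg (q - r)]
  have i2 := mul_le_mul_of_nonneg_left i1 h0.le
  have hX : 0 ≤ q ^ 2 + r ^ 2 + 4 * M ^ 2 * p ^ 2 + 4 * f ^ 2 := by positivity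
  have i2' := mul_le_mul_of_nonneg_right hε.h5 hX
  have i3 : a * b * p ^ 2 ≤ M ^ 2 * p ^ 2 :=
    mul_le_mul_of_nonneg_right (by nlinarith) (sq_nonneg p)
  have i4 := mul_le_mul_of_nonneg_right ha' (sq_nonneg q)
  have i5 := mul_le_mul_of_nonneg_right hb' (sq_nonneg r)
  rw [lyap]
  have j1 : 0 ≤ M ^ 2 * (q ^ 2 + r ^ 2 + s ^ 2 + f ^ 2) := by positivity
  have j2 : 0 ≤ M * (p ^ 2 + s ^ 2 + f ^ 2) := by positivity
  linarith [sq_nonneg p, sq_nonneg q, sq_nonneg r, sq_nonneg s, sq_nonneg f]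

end Pointwise

/-! ### The dynamics of a Fourier fiber -/

section Fiber

variable {ι : Type} [Fintype ι]

/-- Solutions of the fiber dynamics of the second moments: `p, q, r, s` are the entries
`11, 12, 21, 22`, and the diagonal noise acts through the mean of `s`. -/
structure FiberSol (γ : ℝ) (a b : ι → ℝ) (p q r s : ℝ → ι → ℝ) : Prop where
  dp : ∀ t, 0 ≤ t → ∀ κ, HasDerivAt (fun t => p t κ) (q t κ + r t κ) t
  dq : ∀ t, 0 ≤ t → ∀ κ, HasDerivAt (fun t => q t κ) (s t κ - b κ * p t κ - γ * q t κ) t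
  dr : ∀ t, 0 ≤ t → ∀ κ, HasDerivAt (fun t => r t κ) (s t κ - a κ * p t κ - γ * r t κ) t
  ds : ∀ t, 0 ≤ t → ∀ κ, HasDerivAt (fun t => s t κ)
    (-(a κ * q t κ) - b κ * r t κ - 2 * γ * (s t κ - avg (s t))) t

/-- The unweighted mean square of a fiber state. -/
def meanSq (p q r s : ι → ℝ) : ℝ := avg fun κ => p κ ^ 2 + q κ ^ 2 + r κ ^ 2 + s κ ^ 2

/-- The mean square of the fast components of a fiber state. -/
def fastSq (a b p q r s : ι → ℝ) : ℝ :=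
  avg fun κ => q κ ^ 2 + r κ ^ 2 + (s κ - avg s) ^ 2 + ((a κ + b κ) * p κ - 2 * avg s) ^ 2

/-- The modified energy of a fiber state. -/
def fiberLyap (ε : ℝ) (a b p q r s : ι → ℝ) : ℝ :=
  avg fun κ => lyap ε (a κ) (b κ) (p κ) (q κ) (r κ) (s κ) (avg s)

/-- Uniform bounds on the coefficients of the fiber dynamics. -/
def CoeffBound (m M : ℝ) (a b : ι → ℝ) : Prop :=
  ∀ κ, m ≤ a κ ∧ a κ ≤ M ∧ m ≤ b κ ∧ b κ ≤ M

theorem meanSq_nonneg (p q r s : ι → ℝ) : 0 ≤ meanSq p q r s :=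
  avg_nonneg fun _ => by positivity

theorem fastSq_nonneg (a b p q r s : ι → ℝ) : 0 ≤ fastSq a b p q r s :=
  avg_nonneg fun _ => by positivity

theorem avg_sq_le_meanSq [Nonempty ι] (p q r s : ι → ℝ) : avg s ^ 2 ≤ meanSq p q r s :=
  (sq_avg_le s).trans <| avg_mono fun κ => by
    linarith [sq_nonneg (p κ), sq_nonneg (q κ), sq_nonneg (r κ)]

theorem FiberSol.hasDerivAt_avg_s {γ : ℝ} {a b : ι → ℝ} {p q r s : ℝ → ι → ℝ} [Nonempty ι]
    (h : FiberSol γ a b p q r s) {t : ℝ} (ht : 0 ≤ t) :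
    HasDerivAt (fun t => avg (s t)) (-avg fun κ => a κ * q t κ + b κ * r t κ) t := by
  refine (hasDerivAt_avg (h.ds t ht)).congr_deriv ?_
  have e : (fun κ => -(a κ * q t κ) - b κ * r t κ - 2 * γ * (s t κ - avg (s t)))
      = fun κ => (-1) * (a κ * q t κ + b κ * r t κ) - (2 * γ) * (s t κ - avg (s t)) := by
    ext κ; ring
  rw [e, avg_sub, avg_const_mul, avg_const_mul, avg_sub, avg_const]
  ring

/-- The velocity field of the fiber dynamics maps solutions to solutions. -/
theorem FiberSol.velocity {γ : ℝ} {a b : ι → ℝ} {p q r s : ℝ → ι → ℝ} [Nonempty ι]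
    (h : FiberSol γ a b p q r s) :
    FiberSol γ a b (fun t κ => q t κ + r t κ) (fun t κ => s t κ - b κ * p t κ - γ * q t κ)
      (fun t κ => s t κ - a κ * p t κ - γ * r t κ)
      (fun t κ => -(a κ * q t κ) - b κ * r t κ - 2 * γ * (s t κ - avg (s t))) := by
  constructor <;> intro t ht κ
  · exact (h.dq t ht κ).add (h.dr t ht κ)
  · refine (((h.ds t ht κ).fun_sub ((h.dp t ht κ).const_mul (b κ))).fun_sub
      ((h.dq t ht κ).const_mul γ)).congr_deriv ?_
    ring
  · refine (((h.ds t ht κ).fun_sub ((h.dp t ht κ).const_mul (a κ))).fun_sub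
      ((h.dr t ht κ).const_mul γ)).congr_deriv ?_
    ring
  · refine ((((h.dq t ht κ).const_mul (a κ)).fun_neg.fun_sub
      ((h.dr t ht κ).const_mul (b κ))).fun_sub (((h.ds t ht κ).fun_sub
        (hasDerivAt_avg (h.ds t ht))).const_mul (2 * γ))).congr_deriv ?_
    ring

variable {γ m M ε : ℝ} {a b : ι → ℝ}

/-- Averaging `lyapDot_le` removes the term `f (s - f)`. The derivative `f' = -avg (a q + b r)`
satisfies `f'² ≤ 2M² avg (q² + r²)`, which is exactly covered by the reserve. -/
theorem FiberSol.hasDerivAt_fiberLyap [Nonempty ι] {p q r s : ℝ → ι → ℝ} (hγ : 0 < γ) (hm : 0 < m)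
    (hε : SmallParam γ m M ε) (hab : CoeffBound m M a b) (h : FiberSol γ a b p q r s)
    {t : ℝ} (ht : 0 ≤ t) :
    ∃ D, HasDerivAt (fun t => fiberLyap ε a b (p t) (q t) (r t) (s t)) D t ∧
      D ≤ -(γ * m) * (avg fun κ => q t κ ^ 2 + r t κ ^ 2)
        - 2 * γ * (avg fun κ => (s t κ - avg (s t)) ^ 2)
        - ε / 2 * avg fun κ => ((a κ + b κ) * p t κ - 2 * avg (s t)) ^ 2 := by
  refine ⟨_, hasDerivAt_avg fun κ => hasDerivAt_lyap (h.dp t ht κ) (h.dq t ht κ) (h.dr t ht κ)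
    (h.ds t ht κ) (h.hasDerivAt_avg_s ht), ?_⟩
  set f := avg (s t) with hf
  set f' := -avg fun κ => a κ * q t κ + b κ * r t κ with hf'
  refine (avg_mono fun κ => lyapDot_le hm hγ hε (hab κ).1 (hab κ).2.1 (hab κ).2.2.1 (hab κ).2.2.2
    _ _ _ _ _ _).trans ?_
  have e : (fun κ => -(γ * m + 2 * ε * M ^ 2) * (q t κ ^ 2 + r t κ ^ 2) - 2 * γ * (s t κ - f) ^ 2
        - ε / 2 * ((a κ + b κ) * p t κ - 2 * f) ^ 2 - 4 * γ * (f * (s t κ - f)) + ε * f' ^ 2)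
      = fun κ => -(γ * m + 2 * ε * M ^ 2) * (q t κ ^ 2 + r t κ ^ 2)
        + (-(2 * γ)) * (s t κ - f) ^ 2 + (-(ε / 2)) * ((a κ + b κ) * p t κ - 2 * f) ^ 2
        + (-(4 * γ * f)) * (s t κ - f) + ε * f' ^ 2 := by
    ext κ; ring
  rw [e, avg_expand₅, avg_sub, avg_const, avg_const, ← hf]
  have i1 : f' ^ 2 ≤ 2 * M ^ 2 * avg fun κ => q t κ ^ 2 + r t κ ^ 2 := by
    rw [hf', neg_sq, ← avg_const_mul]
    refine (sq_avg_le _).trans (avg_mono fun κ => ?_)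
    obtain ⟨h1, h2, h3, h4⟩ := hab κ
    have j1 : a κ ^ 2 * q t κ ^ 2 ≤ M ^ 2 * q t κ ^ 2 :=
      mul_le_mul_of_nonneg_right (pow_le_pow_left₀ (by linarith) h2 2) (sq_nonneg _)
    have j2 : b κ ^ 2 * r t κ ^ 2 ≤ M ^ 2 * r t κ ^ 2 :=
      mul_le_mul_of_nonneg_right (pow_le_pow_left₀ (by linarith) h4 2) (sq_nonneg _)
    linarith [sq_nonneg (a κ * q t κ - b κ * r t κ)]
  have i2 := mul_le_mul_of_nonneg_left i1 hε.pos.le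
  linarith

theorem fastSq_eq (a b p q r s : ι → ℝ) : fastSq a b p q r s = (avg fun κ => q κ ^ 2 + r κ ^ 2)
    + (avg fun κ => (s κ - avg s) ^ 2) + avg fun κ => ((a κ + b κ) * p κ - 2 * avg s) ^ 2 := by
  rw [fastSq, avg_add, avg_add]

/-- The rate at which the modified energy controls the fast components. -/
def fastRate (γ m ε : ℝ) : ℝ := min (γ * m) (min (2 * γ) (ε / 2))

theorem fastRate_pos (hγ : 0 < γ) (hm : 0 < m) (hε : 0 < ε) : 0 < fastRate γ m ε :=
  lt_min (by positivity) (lt_min (by positivity) (by positivity))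

theorem FiberSol.fiberLyap_dissipation [Nonempty ι] {p q r s : ℝ → ι → ℝ} (hγ : 0 < γ)
    (hm : 0 < m) (hε : SmallParam γ m M ε) (hab : CoeffBound m M a b)
    (h : FiberSol γ a b p q r s) {t : ℝ} (ht : 0 ≤ t) :
    ∃ D, HasDerivAt (fun t => fiberLyap ε a b (p t) (q t) (r t) (s t)) D t ∧
      D ≤ -fastRate γ m ε * fastSq a b (p t) (q t) (r t) (s t) := by
  obtain ⟨D, hD, hD'⟩ := h.hasDerivAt_fiberLyap hγ hm hε hab ht
  refine ⟨D, hD, hD'.trans ?_⟩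
  rw [fastSq_eq]
  have c1 : fastRate γ m ε ≤ γ * m := min_le_left _ _
  have c2 : fastRate γ m ε ≤ 2 * γ := (min_le_right _ _).trans (min_le_left _ _)
  have c3 : fastRate γ m ε ≤ ε / 2 := (min_le_right _ _).trans (min_le_right _ _)
  have n1 : 0 ≤ avg fun κ => q t κ ^ 2 + r t κ ^ 2 := avg_nonneg fun _ => by positivity
  have n2 : 0 ≤ avg fun κ => (s t κ - avg (s t)) ^ 2 := avg_nonneg fun _ => by positivity
  have n3 : 0 ≤ avg fun κ => ((a κ + b κ) * p t κ - 2 * avg (s t)) ^ 2 :=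
    avg_nonneg fun _ => by positivity
  linarith [mul_le_mul_of_nonneg_right c1 n1, mul_le_mul_of_nonneg_right c2 n2,
    mul_le_mul_of_nonneg_right c3 n3]

/-- Half of `avg s²` pays for the defect `f²/2` by Jensen's inequality; the other half gives
coercivity in `s`. -/
theorem le_fiberLyap [Nonempty ι] (hm : 0 < m) (hε : SmallParam γ m M ε)
    (hab : CoeffBound m M a b) (p q r s : ι → ℝ) :
    min (m ^ 2 / 2) (min (m / 2) (1 / 2)) * meanSq p q r s ≤ fiberLyap ε a b p q r s := by
  set c := min (m ^ 2 / 2) (min (m / 2) (1 / 2)) with hc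
  have c1 : c ≤ m ^ 2 / 2 := min_le_left _ _
  have c2 : c ≤ m / 2 := (min_le_right _ _).trans (min_le_left _ _)
  have c3 : c ≤ 1 / 2 := (min_le_right _ _).trans (min_le_right _ _)
  have h1 : avg (fun κ => c * (p κ ^ 2 + q κ ^ 2 + r κ ^ 2 + s κ ^ 2)
      + (1 / 2) * (s κ ^ 2 - avg s ^ 2)) ≤ fiberLyap ε a b p q r s := by
    refine avg_mono fun κ => le_trans ?_ (le_lyap hm hε (hab κ).1 (hab κ).2.1 (hab κ).2.2.1
      (hab κ).2.2.2 _ _ _ _ _)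
    linarith [mul_le_mul_of_nonneg_right c1 (sq_nonneg (p κ)),
      mul_le_mul_of_nonneg_right c2 (sq_nonneg (q κ)),
      mul_le_mul_of_nonneg_right c2 (sq_nonneg (r κ)),
      mul_le_mul_of_nonneg_right c3 (sq_nonneg (s κ))]
  rw [avg_add, avg_const_mul, avg_const_mul, avg_sub, avg_const] at h1
  have := sq_avg_le s
  rw [meanSq]
  linarith

theorem fiberLyap_le [Nonempty ι] (hm : 0 < m) (hε : SmallParam γ m M ε)
    (hab : CoeffBound m M a b) (p q r s : ι → ℝ) :
    fiberLyap ε a b p q r s ≤ 2 * (2 * M ^ 2 + M + 1) * meanSq p q r s := by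
  have h1 : fiberLyap ε a b p q r s ≤ avg (fun κ => (2 * M ^ 2 + M + 1) *
      ((p κ ^ 2 + q κ ^ 2 + r κ ^ 2 + s κ ^ 2) + avg s ^ 2)) :=
    avg_mono fun κ => lyap_le hm hε (hab κ).1 (hab κ).2.1 (hab κ).2.2.1
      (hab κ).2.2.2 _ _ _ _ _
  rw [avg_const_mul, avg_add, avg_const] at h1
  have h2 := avg_sq_le_meanSq p q r s
  obtain ⟨κ⟩ := ‹Nonempty ι›
  have hM : 0 < M := by linarith [(hab κ).1, (hab κ).2.1]
  have h3 : (2 * M ^ 2 + M + 1) * avg s ^ 2 ≤ (2 * M ^ 2 + M + 1) * meanSq p q r s :=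
    mul_le_mul_of_nonneg_left h2 (by positivity)
  rw [meanSq] at *
  linarith

/-- The fast components and the mean `f` of `s` determine the state: `s = (s - f) + f`, and `p = (h
+ 2f)/(a + b)` with `a + b ≥ 2m`. -/
theorem meanSq_le [Nonempty ι] (hm : 0 < m) (hab : CoeffBound m M a b) (p q r s : ι → ℝ) :
    meanSq p q r s ≤ (2 + m⁻¹ ^ 2) * fastSq a b p q r s + (2 + 2 * m⁻¹ ^ 2) * avg s ^ 2 := by
  have key : meanSq p q r s ≤ avg fun κ => (2 + m⁻¹ ^ 2) * (q κ ^ 2 + r κ ^ 2 + (s κ - avg s) ^ 2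
      + ((a κ + b κ) * p κ - 2 * avg s) ^ 2) + (2 + 2 * m⁻¹ ^ 2) * avg s ^ 2 := by
    refine avg_mono fun κ => ?_
    obtain ⟨h1, -, h3, -⟩ := hab κ
    set h := (a κ + b κ) * p κ - 2 * avg s with hh
    have j1 : p κ ^ 2 ≤ m⁻¹ ^ 2 * (1 / 2 * h ^ 2 + 2 * avg s ^ 2) := by
      have e : (2 * m) ^ 2 * p κ ^ 2 ≤ (h + 2 * avg s) ^ 2 := by
        rw [show h + 2 * avg s = (a κ + b κ) * p κ by rw [hh]; ring, mul_pow (a κ + b κ)]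
        exact mul_le_mul_of_nonneg_right (pow_le_pow_left₀ (by linarith : 0 ≤ 2 * m)
          (by linarith : 2 * m ≤ a κ + b κ) 2) (sq_nonneg _)
      have e2 : p κ ^ 2 = m⁻¹ ^ 2 * (m ^ 2 * p κ ^ 2) := by field_simp
      rw [e2]
      refine mul_le_mul_of_nonneg_left ?_ (by positivity)
      nlinarith [sq_nonneg (h - 2 * avg s)]
    have j2 : s κ ^ 2 ≤ 2 * (s κ - avg s) ^ 2 + 2 * avg s ^ 2 := by
      nlinarith [sq_nonneg (s κ - 2 * avg s)]
    have n : 0 ≤ m⁻¹ ^ 2 := by positivity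
    have j3 : 0 ≤ m⁻¹ ^ 2 * (q κ ^ 2 + r κ ^ 2 + (s κ - avg s) ^ 2 + h ^ 2) := by positivity
    nlinarith [sq_nonneg (q κ), sq_nonneg (r κ), sq_nonneg h]
  rw [avg_add, avg_const_mul, avg_const] at key
  exact key

end Fiber

/-! ### Relaxation and diffusive decay of the fiber dynamics -/

set_option linter.unusedSectionVars false

section Decay

variable {ι : Type} [Fintype ι] [Nonempty ι] {γ m M ε : ℝ} {a b : ι → ℝ} {p q r s : ℝ → ι → ℝ}

theorem CoeffBound.upper_pos (hm : 0 < m) (hab : CoeffBound m M a b) : 0 < M := by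
  obtain ⟨κ⟩ := ‹Nonempty ι›
  linarith [(hab κ).1, (hab κ).2.1]

/-- Dissipation of the fast part becomes decay of the whole modified energy once the state is
bounded by its fast part and a scalar `E`. In the relaxation estimate `E` bounds `f²`; in the slow
control it is the square of the energy mode. -/
theorem FiberSol.fiberLyap_deriv_le (hγ : 0 < γ) (hm : 0 < m) (hε : SmallParam γ m M ε)
    (hab : CoeffBound m M a b) (h : FiberSol γ a b p q r s) {A B E t : ℝ} (hA : 0 < A)
    (ht : 0 ≤ t)
    (hN : meanSq (p t) (q t) (r t) (s t) ≤ A * fastSq a b (p t) (q t) (r t) (s t) + B * E) :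
    ∃ D, HasDerivAt (fun t => fiberLyap ε a b (p t) (q t) (r t) (s t)) D t ∧
      D ≤ -(fastRate γ m ε / A / (2 * (2 * M ^ 2 + M + 1)))
          * fiberLyap ε a b (p t) (q t) (r t) (s t) + fastRate γ m ε / A * B * E := by
  have hM := hab.upper_pos hm
  obtain ⟨D, hD, hD'⟩ := h.fiberLyap_dissipation hγ hm hε hab ht
  refine ⟨D, hD, hD'.trans ?_⟩
  have hρ : 0 < fastRate γ m ε := fastRate_pos hγ hm hε.pos
  have h1 := fiberLyap_le hm hε hab (p t) (q t) (r t) (s t)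
  set L := fiberLyap ε a b (p t) (q t) (r t) (s t)
  set N := meanSq (p t) (q t) (r t) (s t)
  set F := fastSq a b (p t) (q t) (r t) (s t)
  set U := 2 * (2 * M ^ 2 + M + 1) with hU
  have hU0 : 0 < U := by positivity
  have h2 : L / U ≤ A * F + B * E := ((div_le_iff₀' hU0).2 h1).trans hN
  have h3 : fastRate γ m ε / A * (L / U) ≤ fastRate γ m ε / A * (A * F + B * E) :=
    mul_le_mul_of_nonneg_left h2 (by positivity)
  have h4 : fastRate γ m ε / A * (A * F + B * E)
      = fastRate γ m ε * F + fastRate γ m ε / A * B * E := by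
    field_simp
  have h5 : -(fastRate γ m ε / A / U) * L = -(fastRate γ m ε / A * (L / U)) := by
    field_simp
  rw [h5]
  linarith

/-- A bounded temperature mode acts as a bounded forcing of the exponentially damped fast
components. The rate does not depend on the size of `a - b`, so this also covers small frequencies;
it replaces the crude a priori bound on the fiber by the square of the temperature bound. -/
theorem exists_relaxation (γ m M : ℝ) (hγ : 0 < γ) (hm : 0 < m) (hM : 0 < M) :
    ∃ C > 0, ∃ c > 0, ∀ {ι : Type} [Fintype ι] [Nonempty ι] {a b : ι → ℝ} {p q r s : ℝ → ι → ℝ},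
      CoeffBound m M a b → FiberSol γ a b p q r s → ∀ F : ℝ,
      (∀ t, 0 ≤ t → |avg (s t)| ≤ F) → ∀ t, 0 ≤ t → meanSq (p t) (q t) (r t) (s t)
        ≤ C * (Real.exp (-(c * t)) * meanSq (p 0) (q 0) (r 0) (s 0) + F ^ 2) := by
  obtain ⟨ε, hε⟩ := exists_smallParam hγ hm hM
  set A := 2 + m⁻¹ ^ 2 with hA
  set B := 2 + 2 * m⁻¹ ^ 2 with hB
  set ρ := fastRate γ m ε with hρ'
  have hρ : 0 < ρ := fastRate_pos hγ hm hε.pos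
  set U := 2 * (2 * M ^ 2 + M + 1) with hU
  set l := min (m ^ 2 / 2) (min (m / 2) (1 / 2)) with hl
  have hl0 : 0 < l := lt_min (by positivity) (lt_min (by positivity) (by positivity))
  set c := ρ / A / U with hc
  have hc0 : 0 < c := by positivity
  set G := ρ / A * B with hG
  have hG0 : 0 < G := by positivity
  refine ⟨l⁻¹ * (U + 2 / c * G), by positivity, c, hc0, ?_⟩
  intro ι _ _ a b p q r s hab h F hF t ht
  have key : ∀ t, 0 ≤ t → ∃ D, HasDerivAt (fun t => fiberLyap ε a b (p t) (q t) (r t) (s t)) D t ∧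
      D ≤ -c * fiberLyap ε a b (p t) (q t) (r t) (s t) + G * F ^ 2 := by
    intro t ht
    refine h.fiberLyap_deriv_le hγ hm hε hab (by positivity) ht
      ((meanSq_le hm hab _ _ _ _).trans ?_)
    have : avg (s t) ^ 2 ≤ F ^ 2 := sq_le_sq' (by linarith [(abs_le.1 (hF t ht)).1])
      (abs_le.1 (hF t ht)).2
    have := mul_le_mul_of_nonneg_left this (by positivity : 0 ≤ B)
    linarith
  choose! D hD hD' using key
  have := le_of_deriv_le_forcing (α := 0) (β := 0) (A := G * F ^ 2) (B := 0) hc0 (by positivity)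
    le_rfl (by linarith) (by linarith) hD (by simpa using hD') ht
  simp only [zero_mul, neg_zero, Real.exp_zero, mul_one, add_zero] at this
  have h1 := le_fiberLyap hm hε hab (p t) (q t) (r t) (s t)
  have h2 := fiberLyap_le hm hε hab (p 0) (q 0) (r 0) (s 0)
  set N := meanSq (p t) (q t) (r t) (s t)
  set N0 := meanSq (p 0) (q 0) (r 0) (s 0)
  have hN0 : 0 ≤ N0 := meanSq_nonneg _ _ _ _
  have he := Real.exp_pos (-(c * t))
  rw [mul_assoc, ← div_eq_inv_mul, le_div_iff₀' hl0]
  have h3 := mul_le_mul_of_nonneg_left h2 he.le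
  have h4 : 0 ≤ U * F ^ 2 := by positivity
  have h5 : 0 ≤ 2 / c * G * (Real.exp (-(c * t)) * N0) := by positivity
  linarith

theorem hasDerivAt_crossTerm (h : FiberSol γ a b p q r s) {t : ℝ} (ht : 0 ≤ t) :
    HasDerivAt (fun t => avg fun κ => (q t κ - r t κ) * ((a κ - b κ) * p t κ))
      (avg fun κ => ((a κ - b κ) * p t κ - γ * (q t κ - r t κ)) * ((a κ - b κ) * p t κ)
        + (q t κ - r t κ) * ((a κ - b κ) * (q t κ + r t κ))) t :=
  hasDerivAt_avg fun κ => (((h.dq t ht κ).fun_sub (h.dr t ht κ)).fun_mul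
    ((h.dp t ht κ).const_mul (a κ - b κ))).congr_deriv (by ring)

theorem sq_sub_coeff_le (hm : 0 < m) (hab : CoeffBound m M a b) (κ : ι) :
    (a κ - b κ) ^ 2 ≤ M ^ 2 := by
  obtain ⟨h1, h2, h3, h4⟩ := hab κ
  exact sq_le_sq' (by linarith) (by linarith)

/-- A lower bound for the production of the gradient mode. -/
theorem le_avg_gradient_sq (hm : 0 < m) (hab : CoeffBound m M a b) (p q r s : ι → ℝ) :
    avg (fun κ => (a κ - b κ) ^ 2) * avg s ^ 2 / (2 * M ^ 2) - fastSq a b p q r s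
      ≤ avg fun κ => ((a κ - b κ) * p κ) ^ 2 := by
  have hM := hab.upper_pos hm
  have key : avg (fun κ => (avg s ^ 2 / (2 * M ^ 2)) * (a κ - b κ) ^ 2
      - (q κ ^ 2 + r κ ^ 2 + (s κ - avg s) ^ 2 + ((a κ + b κ) * p κ - 2 * avg s) ^ 2))
      ≤ avg fun κ => ((a κ - b κ) * p κ) ^ 2 := by
    refine avg_mono fun κ => ?_
    obtain ⟨h1, h2, h3, h4⟩ := hab κ
    set f := avg s
    set σ := a κ + b κ with hσ
    set d := a κ - b κ with hd
    set g := σ * p κ - 2 * f with hg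
    have hσ0 : 0 < σ := by linarith
    have hdσ : d ^ 2 ≤ σ ^ 2 := sq_le_sq' (by linarith) (by linarith)
    have hσM : σ ^ 2 ≤ (2 * M) ^ 2 := pow_le_pow_left₀ hσ0.le (by linarith) 2
    have e : (d * p κ) ^ 2 = d ^ 2 / σ ^ 2 * (g + 2 * f) ^ 2 := by
      rw [show g + 2 * f = σ * p κ by rw [hg]; ring]; field_simp
    have w1 : d ^ 2 / σ ^ 2 ≤ 1 := (div_le_one (by positivity)).2 hdσ
    have w2 : d ^ 2 / (4 * M ^ 2) ≤ d ^ 2 / σ ^ 2 :=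
      div_le_div_of_nonneg_left (sq_nonneg _) (by positivity) (by linarith)
    have w0 : 0 ≤ d ^ 2 / σ ^ 2 := by positivity
    have j1 : d ^ 2 / σ ^ 2 * (2 * f ^ 2 - g ^ 2) ≤ d ^ 2 / σ ^ 2 * (g + 2 * f) ^ 2 :=
      mul_le_mul_of_nonneg_left (by nlinarith [sq_nonneg (g + f)]) w0
    have j2 := mul_le_mul_of_nonneg_right w2 (by positivity : 0 ≤ 2 * f ^ 2)
    have j3 := mul_le_mul_of_nonneg_right w1 (sq_nonneg g)
    have j4 : d ^ 2 / (4 * M ^ 2) * (2 * f ^ 2) = f ^ 2 / (2 * M ^ 2) * d ^ 2 := by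
      field_simp; ring
    rw [e]
    linarith [sq_nonneg (q κ), sq_nonneg (r κ), sq_nonneg (s κ - f)]
  rw [avg_sub, avg_const_mul] at key
  refine le_trans (le_of_eq ?_) key
  rw [fastSq]; ring

/-- The difference `q - r` is driven by `(a - b) p`, so the square of this source appears in the
derivative of the cross term with a favourable sign; what remains is quadratic in the fast
variables. -/
theorem FiberSol.crossTerm_deriv_ge (hγ : 0 < γ) (hm : 0 < m)
    (hab : CoeffBound m M a b) (p q r s : ι → ℝ) :
    1 / 2 * (avg fun κ => ((a κ - b κ) * p κ) ^ 2)
        - (γ ^ 2 + M ^ 2 + 1) * fastSq a b p q r s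
      ≤ avg fun κ => ((a κ - b κ) * p κ - γ * (q κ - r κ)) * ((a κ - b κ) * p κ)
        + (q κ - r κ) * ((a κ - b κ) * (q κ + r κ)) := by
  rw [fastSq, ← avg_const_mul, ← avg_const_mul, ← avg_sub]
  refine avg_mono fun κ => ?_
  have hd := sq_sub_coeff_le hm hab κ
  set d := a κ - b κ
  set u := q κ - r κ with hu
  set y := q κ + r κ with hy
  have huy : u ^ 2 + y ^ 2 = 2 * (q κ ^ 2 + r κ ^ 2) := by rw [hu, hy]; ring
  have i1 : γ * u * (d * p κ) ≤ 1 / 2 * (d * p κ) ^ 2 + γ ^ 2 * u ^ 2 / 2 := by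
    nlinarith [sq_nonneg (d * p κ - γ * u)]
  have i2 : -(u * (d * y)) ≤ d ^ 2 * u ^ 2 / 2 + y ^ 2 / 2 := by
    nlinarith [sq_nonneg (d * u + y)]
  have i3 := mul_le_mul_of_nonneg_right hd (sq_nonneg u)
  have n1 : 0 ≤ (γ ^ 2 + M ^ 2) * y ^ 2 := by positivity
  have n2 : 0 ≤ (γ ^ 2 + M ^ 2 + 1) * ((s κ - avg s) ^ 2
    + ((a κ + b κ) * p κ - 2 * avg s) ^ 2) := by positivity
  have e : (γ ^ 2 + M ^ 2 + 1) * (q κ ^ 2 + r κ ^ 2)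
    = (γ ^ 2 + M ^ 2 + 1) * ((u ^ 2 + y ^ 2) / 2) := by rw [huy]; ring
  linarith [sq_nonneg u]

theorem abs_crossTerm_le (hm : 0 < m) (hab : CoeffBound m M a b) (p q r s : ι → ℝ) :
    |avg fun κ => (q κ - r κ) * ((a κ - b κ) * p κ)| ≤ (1 + M ^ 2) * meanSq p q r s := by
  have h : ∀ κ, |(q κ - r κ) * ((a κ - b κ) * p κ)|
      ≤ (1 + M ^ 2) * (p κ ^ 2 + q κ ^ 2 + r κ ^ 2 + s κ ^ 2) := by
    intro κ
    have hd := mul_le_mul_of_nonneg_right (sq_sub_coeff_le hm hab κ) (sq_nonneg (p κ))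
    set d := a κ - b κ
    have n : 0 ≤ M ^ 2 * (p κ ^ 2 + q κ ^ 2 + r κ ^ 2 + s κ ^ 2) := by positivity
    have n' : 0 ≤ M ^ 2 * (q κ ^ 2 + r κ ^ 2 + s κ ^ 2) := by positivity
    rw [abs_le]
    constructor
    · nlinarith [sq_nonneg (q κ - r κ + d * p κ), sq_nonneg (q κ + r κ), sq_nonneg (s κ),
        sq_nonneg (p κ)]
    · nlinarith [sq_nonneg (q κ - r κ - d * p κ), sq_nonneg (q κ + r κ), sq_nonneg (s κ),
        sq_nonneg (p κ)]
  rw [meanSq, ← avg_const_mul, abs_le, ← neg_one_mul, ← avg_const_mul]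
  exact ⟨avg_mono fun κ => by linarith [(abs_le.1 (h κ)).1],
    avg_mono fun κ => (abs_le.1 (h κ)).2⟩

/-- The fast dissipation alone does not damp `f`. Subtracting `η avg ((q - r)(a - b)p)` from the
modified energy adds a dissipation of order `avg ((a - b)p)²`. Since `p` is `2f/(a + b)` up to fast
terms, this is at least of order `δ² f²`, and the corrected functional decays at a rate of order
`δ²`. -/
theorem exists_diffusive_decay (γ m M cD : ℝ) (hγ : 0 < γ) (hm : 0 < m) (hM : 0 < M)
    (hcD : 0 < cD) :
    ∃ C > 0, ∃ c > 0, ∀ {ι : Type} [Fintype ι] [Nonempty ι] {a b : ι → ℝ} {p q r s : ℝ → ι → ℝ},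
      CoeffBound m M a b → FiberSol γ a b p q r s → ∀ δ : ℝ, 0 ≤ δ → δ ≤ 1 →
      cD * δ ^ 2 ≤ avg (fun κ => (a κ - b κ) ^ 2) →
      ∀ t, 0 ≤ t → meanSq (p t) (q t) (r t) (s t)
        ≤ C * (Real.exp (-(c * δ ^ 2 * t)) * meanSq (p 0) (q 0) (r 0) (s 0)) := by
  obtain ⟨ε, hε⟩ := exists_smallParam hγ hm hM
  set A := 2 + m⁻¹ ^ 2 with hA
  set B := 2 + 2 * m⁻¹ ^ 2 with hB
  set ρ := fastRate γ m ε with hρ'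
  have hρ : 0 < ρ := fastRate_pos hγ hm hε.pos
  set U := 2 * (2 * M ^ 2 + M + 1) with hU
  set l := min (m ^ 2 / 2) (min (m / 2) (1 / 2)) with hl
  have hl0 : 0 < l := lt_min (by positivity) (lt_min (by positivity) (by positivity))
  set K := γ ^ 2 + M ^ 2 + 1 with hK
  have hK0 : 0 < K := by positivity
  -- The first bound on `η` keeps half of the fast dissipation, the second keeps half of the
  -- coercivity constant `l`.
  set η := min (ρ / (2 * (K + 1 / 2))) (l / (2 * (1 + M ^ 2))) with hη
  have hη0 : 0 < η := lt_min (by positivity) (by positivity)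
  have hη1 : η * (K + 1 / 2) ≤ ρ / 2 := by
    have : η ≤ ρ / (2 * (K + 1 / 2)) := min_le_left _ _
    rw [le_div_iff₀ (by positivity)] at this
    linarith
  have hη2 : η * (1 + M ^ 2) ≤ l / 2 := by
    have : η ≤ l / (2 * (1 + M ^ 2)) := min_le_right _ _
    rw [le_div_iff₀ (by positivity)] at this
    linarith
  set U2 := U + l / 2 with hU2
  have hU0 : 0 < U2 := by positivity
  -- The two parts of `meanSq_le` are charged separately: `θ A` to the remaining fast dissipation,
  -- `θ B` to the dissipation of the gradient mode.
  set θ := min (ρ / (2 * A)) (η * cD / (4 * M ^ 2) / B) with hθ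
  have hθ0 : 0 < θ := lt_min (by positivity) (by positivity)
  have hθ1 : θ * A ≤ ρ / 2 := by
    have : θ ≤ ρ / (2 * A) := min_le_left _ _
    rw [le_div_iff₀ (by positivity)] at this
    linarith
  have hθ2 : θ * B ≤ η * cD / (4 * M ^ 2) := by
    have : θ ≤ η * cD / (4 * M ^ 2) / B := min_le_right _ _
    rwa [le_div_iff₀ (by positivity)] at this
  refine ⟨2 / l * U2, by positivity, θ / U2, by positivity, ?_⟩
  intro ι _ _ a b p q r s hab h δ hδ0 hδ1 hδ t ht
  set Y : ℝ → ℝ := fun t => fiberLyap ε a b (p t) (q t) (r t) (s t)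
    - η * avg (fun κ => (q t κ - r t κ) * ((a κ - b κ) * p t κ)) with hY
  have hYup : ∀ t, Y t ≤ U2 * meanSq (p t) (q t) (r t) (s t) := by
    intro t
    have h1 := fiberLyap_le hm hε hab (p t) (q t) (r t) (s t)
    have h2 := (abs_le.1 (abs_crossTerm_le hm hab (p t) (q t) (r t) (s t))).1
    have h3 := mul_le_mul_of_nonneg_left h2 hη0.le
    have h4 := mul_le_mul_of_nonneg_right hη2 (meanSq_nonneg (p t) (q t) (r t) (s t))
    rw [← hU] at h1
    simp only [hY]
    rw [hU2, add_mul]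
    linarith
  have hYlow : ∀ t, l / 2 * meanSq (p t) (q t) (r t) (s t) ≤ Y t := by
    intro t
    have h1 := le_fiberLyap hm hε hab (p t) (q t) (r t) (s t)
    have h2 := (abs_le.1 (abs_crossTerm_le hm hab (p t) (q t) (r t) (s t))).2
    have h3 := mul_le_mul_of_nonneg_left h2 hη0.le
    have h4 := mul_le_mul_of_nonneg_right hη2 (meanSq_nonneg (p t) (q t) (r t) (s t))
    simp only [hY]
    linarith
  have key : ∀ t, 0 ≤ t → ∃ D, HasDerivAt Y D t ∧ D ≤ -(θ / U2 * δ ^ 2) * Y t := by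
    intro t ht
    obtain ⟨D, hD, hD'⟩ := h.fiberLyap_dissipation hγ hm hε hab ht
    refine ⟨_, hD.fun_sub ((hasDerivAt_crossTerm h ht).const_mul η), ?_⟩
    have h1 := FiberSol.crossTerm_deriv_ge hγ hm hab (p t) (q t) (r t) (s t)
    have h2 := le_avg_gradient_sq hm hab (p t) (q t) (r t) (s t)
    have h3 := meanSq_le hm hab (p t) (q t) (r t) (s t)
    have h4 := hYup t
    have hF := fastSq_nonneg a b (p t) (q t) (r t) (s t)
    set F := fastSq a b (p t) (q t) (r t) (s t)
    set N := meanSq (p t) (q t) (r t) (s t)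
    set G := avg fun κ => ((a κ - b κ) * p t κ) ^ 2
    set X := avg fun κ => ((a κ - b κ) * p t κ - γ * (q t κ - r t κ)) * ((a κ - b κ) * p t κ)
        + (q t κ - r t κ) * ((a κ - b κ) * (q t κ + r t κ))
    set f := avg (s t)
    have h5 : cD * δ ^ 2 * f ^ 2 / (2 * M ^ 2) - F ≤ G := by
      refine le_trans ?_ h2
      have := mul_le_mul_of_nonneg_right hδ (sq_nonneg f)
      have := div_le_div_of_nonneg_right this (by positivity : 0 ≤ 2 * M ^ 2)
      linarith
    have h6 : D - η * X ≤ -(ρ / 2) * F - η * cD / (4 * M ^ 2) * δ ^ 2 * f ^ 2 := by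
      have e1 := mul_le_mul_of_nonneg_left h1 hη0.le
      have e2 := mul_le_mul_of_nonneg_left h5 hη0.le
      have e3 := mul_le_mul_of_nonneg_right hη1 hF
      have e4 : η * (cD * δ ^ 2 * f ^ 2 / (2 * M ^ 2))
        = 2 * (η * cD / (4 * M ^ 2) * δ ^ 2 * f ^ 2) := by field_simp; ring
      linarith
    have hδ2 : δ ^ 2 ≤ 1 := pow_le_one₀ hδ0 hδ1
    have h7 : θ * A * (δ ^ 2 * F) ≤ ρ / 2 * F := by
      have e1 : δ ^ 2 * F ≤ F := mul_le_of_le_one_left hF hδ2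
      exact (mul_le_mul_of_nonneg_right hθ1 (by positivity)).trans
        (mul_le_mul_of_nonneg_left e1 (by positivity))
    have h8 := mul_le_mul_of_nonneg_right hθ2 (by positivity : 0 ≤ δ ^ 2 * f ^ 2)
    have h9 := mul_le_mul_of_nonneg_left h3 (by positivity : 0 ≤ θ * δ ^ 2)
    have h10 : θ / U2 * δ ^ 2 * Y t ≤ θ * δ ^ 2 * N := by
      have := mul_le_mul_of_nonneg_left h4 (by positivity : 0 ≤ θ / U2 * δ ^ 2)
      refine this.trans (le_of_eq ?_)
      field_simp
    linarith
  choose! D hD hD' using key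
  have h1 := le_exp_mul_of_deriv_le hD hD' ht
  have h2 := mul_le_mul_of_nonneg_left (hYup 0) (Real.exp_pos (-(θ / U2 * δ ^ 2 * t))).le
  have h3 := hYlow t
  have h4 : l / 2 * meanSq (p t) (q t) (r t) (s t) ≤ U2 * (Real.exp (-(θ / U2 * δ ^ 2 * t))
      * meanSq (p 0) (q 0) (r 0) (s 0)) := by linarith
  have h5 := (le_div_iff₀' (by positivity : 0 < l / 2)).2 h4
  refine h5.trans (le_of_eq ?_)
  field_simp

end Decay

/-! ### Slow variation of the temperature mode -/

section Velocity

variable {ι : Type} [Fintype ι] [Nonempty ι] {γ m M ε : ℝ} {a b : ι → ℝ} {p q r s : ℝ → ι → ℝ}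

/-- The fast components and the local energy control the whole state. -/
theorem meanSq_le_slow (hm : 0 < m) (hab : CoeffBound m M a b) (p q r s : ι → ℝ) :
    meanSq p q r s ≤ (2 + m⁻¹ ^ 2 + (2 + 2 * m⁻¹ ^ 2) / 8) * fastSq a b p q r s
      + (2 + 2 * m⁻¹ ^ 2) / 2 * (avg fun κ => s κ + 1 / 2 * ((a κ + b κ) * p κ)) ^ 2 := by
  have h1 := meanSq_le hm hab p q r s
  set e := avg fun κ => s κ + 1 / 2 * ((a κ + b κ) * p κ) with he
  set g := avg fun κ => (a κ + b κ) * p κ - 2 * avg s with hg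
  -- This says `avg s = e/2 - g/4` with `g` the mean of a fast quantity, so the energy mode `e` can
  -- replace the temperature mode as slow variable.
  have e1 : g = 2 * (e - avg s) - 2 * avg s := by
    rw [hg, he, avg_sub, avg_add, avg_const, avg_const_mul]; ring
  have e2 : g ^ 2 ≤ fastSq a b p q r s :=
    (sq_avg_le _).trans <| avg_mono fun κ => by
      linarith [sq_nonneg (q κ), sq_nonneg (r κ), sq_nonneg (s κ - avg s)]
  have e3 : avg s ^ 2 ≤ 1 / 2 * e ^ 2 + 1 / 8 * fastSq a b p q r s := by
    have : avg s = e / 2 - g / 4 := by rw [e1]; ring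
    rw [this]
    nlinarith [sq_nonneg (e / 2 + g / 4)]
  have e4 := mul_le_mul_of_nonneg_left e3 (by positivity : 0 ≤ 2 + 2 * m⁻¹ ^ 2)
  linarith

theorem meanSq_velocity_le (hm : 0 < m) (hγ : 0 < γ) (hab : CoeffBound m M a b)
    (p q r s : ι → ℝ) :
    meanSq (fun κ => q κ + r κ) (fun κ => s κ - b κ * p κ - γ * q κ)
      (fun κ => s κ - a κ * p κ - γ * r κ)
      (fun κ => -(a κ * q κ) - b κ * r κ - 2 * γ * (s κ - avg s))
      ≤ 60 * (1 + M ^ 2 + γ ^ 2) * meanSq p q r s := by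
  have key : meanSq (fun κ => q κ + r κ) (fun κ => s κ - b κ * p κ - γ * q κ)
      (fun κ => s κ - a κ * p κ - γ * r κ)
      (fun κ => -(a κ * q κ) - b κ * r κ - 2 * γ * (s κ - avg s))
      ≤ avg fun κ => 30 * (1 + M ^ 2 + γ ^ 2) *
        ((p κ ^ 2 + q κ ^ 2 + r κ ^ 2 + s κ ^ 2) + avg s ^ 2) := by
    refine avg_mono fun κ => ?_
    obtain ⟨h1, h2, h3, h4⟩ := hab κ
    have sq3 : ∀ x y z : ℝ, (x - y - z) ^ 2 ≤ 3 * (x ^ 2 + y ^ 2 + z ^ 2) := fun x y z => by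
      nlinarith [sq_nonneg (x + y), sq_nonneg (x + z), sq_nonneg (y - z)]
    have ha2 : a κ ^ 2 ≤ M ^ 2 := pow_le_pow_left₀ (by linarith) h2 2
    have hb2 : b κ ^ 2 ≤ M ^ 2 := pow_le_pow_left₀ (by linarith) h4 2
    have i1 := sq3 (s κ) (b κ * p κ) (γ * q κ)
    have i2 := sq3 (s κ) (a κ * p κ) (γ * r κ)
    have i3 := sq3 (-(a κ * q κ)) (b κ * r κ) (2 * γ * (s κ - avg s))
    have j1 := mul_le_mul_of_nonneg_right hb2 (sq_nonneg (p κ))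
    have j2 := mul_le_mul_of_nonneg_right ha2 (sq_nonneg (p κ))
    have j3 := mul_le_mul_of_nonneg_right ha2 (sq_nonneg (q κ))
    have j4 := mul_le_mul_of_nonneg_right hb2 (sq_nonneg (r κ))
    have j5 : (s κ - avg s) ^ 2 ≤ 2 * s κ ^ 2 + 2 * avg s ^ 2 := by
      nlinarith [sq_nonneg (s κ + avg s)]
    have j6 := mul_le_mul_of_nonneg_left j5 (by positivity : 0 ≤ 12 * γ ^ 2)
    have n1 : ∀ x : ℝ, 0 ≤ M ^ 2 * x ^ 2 := fun x => by positivity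
    have n2 : ∀ x : ℝ, 0 ≤ γ ^ 2 * x ^ 2 := fun x => by positivity
    have n6 := sq_nonneg (q κ - r κ)
    beta_reduce
    linarith [sq_nonneg (p κ), sq_nonneg (q κ), sq_nonneg (r κ), sq_nonneg (s κ),
      sq_nonneg (avg s), n1 (p κ), n1 (q κ), n1 (r κ), n1 (s κ), n1 (avg s), n2 (p κ), n2 (q κ),
      n2 (r κ), n2 (s κ), n2 (avg s)]
  rw [avg_const_mul, avg_add, avg_const] at key
  have h2 := mul_le_mul_of_nonneg_left (avg_sq_le_meanSq p q r s)
    (by positivity : 0 ≤ 30 * (1 + M ^ 2 + γ ^ 2))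
  unfold meanSq at *
  linarith

/-- The difference `u = q - r` satisfies `u' = (a - b)p - γ u`: it is damped and has a source of
relative size `δ`, hence is `O(δ)` after an initial layer. -/
theorem FiberSol.avg_current_sq_le (hγ : 0 < γ) (h : FiberSol γ a b p q r s) {A δ K μ : ℝ}
    (hd : ∀ κ, |a κ - b κ| ≤ A * δ) (hK : 0 ≤ K) (hμγ : 2 * μ ≤ γ)
    (hN : ∀ t, 0 ≤ t → meanSq (p t) (q t) (r t) (s t) ≤ K * Real.exp (-(μ * t)))
    {t : ℝ} (ht : 0 ≤ t) :
    (avg fun κ => (q t κ - r t κ) ^ 2)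
      ≤ 2 * K * Real.exp (-(γ * t)) + 2 * (A * δ) ^ 2 / γ ^ 2 * (K * Real.exp (-(μ * t))) := by
  have hD : ∀ t, 0 ≤ t → HasDerivAt (fun t => avg fun κ => (q t κ - r t κ) ^ 2)
      (avg fun κ => 2 * (q t κ - r t κ) * ((a κ - b κ) * p t κ - γ * (q t κ - r t κ))) t :=
    fun t ht => hasDerivAt_avg fun κ =>
      (((h.dq t ht κ).fun_sub (h.dr t ht κ)).fun_pow 2).congr_deriv (by push_cast; ring)
  have hD' : ∀ t, 0 ≤ t →
      (avg fun κ => 2 * (q t κ - r t κ) * ((a κ - b κ) * p t κ - γ * (q t κ - r t κ)))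
      ≤ -γ * (avg fun κ => (q t κ - r t κ) ^ 2)
        + ((A * δ) ^ 2 / γ * K * Real.exp (-(μ * t)) + 0 * Real.exp (-(0 * t))) := by
    intro t ht
    have h1 : (avg fun κ => 2 * (q t κ - r t κ) * ((a κ - b κ) * p t κ - γ * (q t κ - r t κ)))
        ≤ avg fun κ => -γ * (q t κ - r t κ) ^ 2 + (A * δ) ^ 2 / γ
          * (p t κ ^ 2 + q t κ ^ 2 + r t κ ^ 2 + s t κ ^ 2) := by
      refine avg_mono fun κ => ?_
      have e1 : (a κ - b κ) ^ 2 ≤ (A * δ) ^ 2 :=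
        sq_le_sq' (by linarith [(abs_le.1 (hd κ)).1]) (abs_le.1 (hd κ)).2
      set u := q t κ - r t κ
      set d := a κ - b κ
      have e2 : d ^ 2 * p t κ ^ 2 / γ ≤ (A * δ) ^ 2 / γ
          * (p t κ ^ 2 + q t κ ^ 2 + r t κ ^ 2 + s t κ ^ 2) := by
        rw [div_mul_eq_mul_div]
        refine div_le_div_of_nonneg_right ?_ hγ.le
        refine mul_le_mul e1 ?_ (sq_nonneg _) (sq_nonneg _)
        linarith [sq_nonneg (q t κ), sq_nonneg (r t κ), sq_nonneg (s t κ)]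
      have e3 : 2 * u * (d * p t κ) ≤ γ * u ^ 2 + d ^ 2 * p t κ ^ 2 / γ := by
        have : γ * u ^ 2 + d ^ 2 * p t κ ^ 2 / γ - 2 * u * (d * p t κ)
            = (γ * u - d * p t κ) ^ 2 / γ := by field_simp; ring
        have h3 : 0 ≤ (γ * u - d * p t κ) ^ 2 / γ := by positivity
        linarith
      linarith
    rw [avg_add, avg_const_mul, avg_const_mul] at h1
    have h2 := mul_le_mul_of_nonneg_left (hN t ht) (by positivity : 0 ≤ (A * δ) ^ 2 / γ)
    rw [meanSq] at h2
    linarith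
  have key := le_of_deriv_le_forcing hγ (by positivity) le_rfl hμγ (by linarith) hD hD' ht
  have h0 : (avg fun κ => (q 0 κ - r 0 κ) ^ 2) ≤ 2 * K := by
    have h1 := hN 0 le_rfl
    simp only [mul_zero, neg_zero, Real.exp_zero, mul_one] at h1
    have h2 : (avg fun κ => (q 0 κ - r 0 κ) ^ 2) ≤ 2 * meanSq (p 0) (q 0) (r 0) (s 0) := by
      rw [meanSq, ← avg_const_mul]
      refine avg_mono fun κ => ?_
      linarith [sq_nonneg (q 0 κ + r 0 κ), sq_nonneg (p 0 κ), sq_nonneg (s 0 κ)]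
    linarith
  have h1 := mul_le_mul_of_nonneg_left h0 (Real.exp_pos (-(γ * t))).le
  have h2 : 2 / γ * ((A * δ) ^ 2 / γ * K * Real.exp (-(μ * t)) + 0 * Real.exp (-(0 * t)))
      = 2 * (A * δ) ^ 2 / γ ^ 2 * (K * Real.exp (-(μ * t))) := by field_simp; ring
  rw [h2] at key
  linarith

/-- The state is controlled by the slow variable and the decaying initial data. -/
theorem exists_slow_control (γ m M : ℝ) (hγ : 0 < γ) (hm : 0 < m) (hM : 0 < M) :
    ∃ C > 0, ∃ c > 0, ∀ {ι : Type} [Fintype ι] [Nonempty ι] {a b : ι → ℝ}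
      {p q r s : ℝ → ι → ℝ}, CoeffBound m M a b → FiberSol γ a b p q r s →
      ∀ F₁ F₂ β μ : ℝ, 0 ≤ F₁ → 0 ≤ F₂ → β ≤ c → μ ≤ c →
      (∀ t, 0 ≤ t → (avg fun κ => s t κ + 1 / 2 * ((a κ + b κ) * p t κ)) ^ 2
        ≤ F₁ * Real.exp (-(β * t)) + F₂ * Real.exp (-(μ * t))) →
      ∀ t, 0 ≤ t → meanSq (p t) (q t) (r t) (s t)
        ≤ C * (Real.exp (-(c * t)) * meanSq (p 0) (q 0) (r 0) (s 0)
          + F₁ * Real.exp (-(β * t)) + F₂ * Real.exp (-(μ * t))) := by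
  obtain ⟨ε, hε⟩ := exists_smallParam hγ hm hM
  set A₁ := 2 + m⁻¹ ^ 2 + (2 + 2 * m⁻¹ ^ 2) / 8 with hA₁
  set B₁ := (2 + 2 * m⁻¹ ^ 2) / 2 with hB₁
  set ρ := fastRate γ m ε with hρ'
  have hρ : 0 < ρ := fastRate_pos hγ hm hε.pos
  set U := 2 * (2 * M ^ 2 + M + 1) with hU
  have hU0 : 0 < U := by positivity
  set l := min (m ^ 2 / 2) (min (m / 2) (1 / 2)) with hl
  have hl0 : 0 < l := lt_min (by positivity) (lt_min (by positivity) (by positivity))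
  set c := ρ / A₁ / U with hc
  have hc0 : 0 < c := by positivity
  set G := ρ / A₁ * B₁ with hG
  have hG0 : 0 < G := by positivity
  refine ⟨l⁻¹ * (U + 2 / c * G), by positivity, c / 2, by positivity, ?_⟩
  intro ι _ _ a b p q r s hab h F₁ F₂ β μ hF₁ hF₂ hβ hμ hF t ht
  have key : ∀ t, 0 ≤ t → ∃ D, HasDerivAt (fun t => fiberLyap ε a b (p t) (q t) (r t) (s t)) D t ∧
      D ≤ -c * fiberLyap ε a b (p t) (q t) (r t) (s t)
        + (G * F₁ * Real.exp (-(β * t)) + G * F₂ * Real.exp (-(μ * t))) := by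
    intro t ht
    have h1 := meanSq_le_slow hm hab (p t) (q t) (r t) (s t)
    rw [← hA₁, ← hB₁] at h1
    obtain ⟨D, hD, hD'⟩ := h.fiberLyap_deriv_le hγ hm hε hab (by positivity) ht h1
    rw [← hρ', ← hU, ← hc, ← hG] at hD'
    refine ⟨D, hD, hD'.trans ?_⟩
    have := mul_le_mul_of_nonneg_left (hF t ht) hG0.le
    linarith
  choose! D hD hD' using key
  have h1 := le_of_deriv_le_forcing hc0 (by positivity : 0 ≤ G * F₁)
    (by positivity : 0 ≤ G * F₂) (by linarith) (by linarith) hD hD' ht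
  have h2 := le_fiberLyap hm hε hab (p t) (q t) (r t) (s t)
  have h3 := fiberLyap_le hm hε hab (p 0) (q 0) (r 0) (s 0)
  rw [← hU] at h3
  rw [← hl] at h2
  have hN0 := meanSq_nonneg (p 0) (q 0) (r 0) (s 0)
  set N0 := meanSq (p 0) (q 0) (r 0) (s 0)
  set X := F₁ * Real.exp (-(β * t)) + F₂ * Real.exp (-(μ * t)) with hX
  have hX0 : 0 ≤ X := by positivity
  have e2 : Real.exp (-(c * t)) ≤ Real.exp (-(c / 2 * t)) := exp_neg_mul_le (by linarith) (by assumption)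
  have h4 : Real.exp (-(c * t)) * fiberLyap ε a b (p 0) (q 0) (r 0) (s 0)
      ≤ Real.exp (-(c / 2 * t)) * (U * N0) :=
    (mul_le_mul_of_nonneg_left h3 (Real.exp_pos _).le).trans
      (mul_le_mul_of_nonneg_right e2 (by positivity))
  have h5 : 2 / c * (G * F₁ * Real.exp (-(β * t)) + G * F₂ * Real.exp (-(μ * t)))
      = 2 / c * G * X := by rw [hX]; ring
  rw [h5] at h1
  rw [add_assoc, ← hX, mul_assoc, ← div_eq_inv_mul, le_div_iff₀' hl0]
  have n1 : 0 ≤ U * X := by positivity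
  have n2 : 0 ≤ 2 / c * G * (Real.exp (-(c / 2 * t)) * N0) := by positivity
  linarith

/-- Local energy balance: the mean of `s + (a + b)p/2` changes only through a current with the
factor `a - b`. The noise drops out because `s - avg s` has mean zero. -/
theorem avg_velocity_energy (a b q r s : ι → ℝ) :
    (avg fun κ => -(a κ * q κ) - b κ * r κ - 2 * γ * (s κ - avg s)
        + 1 / 2 * ((a κ + b κ) * (q κ + r κ)))
      = avg fun κ => -(1 / 2) * ((a κ - b κ) * (q κ - r κ)) := by
  have : (fun κ => -(a κ * q κ) - b κ * r κ - 2 * γ * (s κ - avg s)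
      + 1 / 2 * ((a κ + b κ) * (q κ + r κ)))
      = fun κ => -(1 / 2) * ((a κ - b κ) * (q κ - r κ)) - 2 * γ * (s κ - avg s) := by
    ext κ; ring
  rw [this, avg_sub, avg_const_mul (2 * γ), avg_sub, avg_const, sub_self, mul_zero, sub_zero]

/-- By linearity the velocity of a solution is again a solution. Its energy mode is the mean of `-(a
- b)(q - r)/2`, with one factor `δ` from `a - b` and another from `q - r`. The slow control then
bounds the entire velocity, and in particular `avg s'`, by `δ²` times the state, up to an initial
layer. -/
theorem exists_velocity_bound (γ m M A : ℝ) (hγ : 0 < γ) (hm : 0 < m) (hM : 0 < M) (hA : 0 < A) :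
    ∃ C > 0, ∃ c > 0, ∃ μ₀ > 0, ∀ {ι : Type} [Fintype ι] [Nonempty ι] {a b : ι → ℝ}
      {p q r s : ℝ → ι → ℝ}, CoeffBound m M a b → FiberSol γ a b p q r s →
      ∀ δ K μ : ℝ, 0 ≤ δ → δ ≤ 1 → 0 ≤ K → μ ≤ μ₀ → (∀ κ, |a κ - b κ| ≤ A * δ) →
      (∀ t, 0 ≤ t → meanSq (p t) (q t) (r t) (s t) ≤ K * Real.exp (-(μ * t))) →
      ∀ t, 0 ≤ t → (avg fun κ => a κ * q t κ + b κ * r t κ) ^ 2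
        ≤ C * K * (Real.exp (-(c * t)) + δ ^ 4 * Real.exp (-(μ * t))) := by
  obtain ⟨C, hC, c, hc, H⟩ := exists_slow_control γ m M hγ hm hM
  set β := min γ c with hβ
  have hβ0 : 0 < β := lt_min hγ hc
  have hβγ : β ≤ γ := min_le_left _ _
  have hβc : β ≤ c := min_le_right _ _
  set Z := 60 * (1 + M ^ 2 + γ ^ 2) with hZ
  have hZ0 : 0 < Z := by positivity
  set T₁ := A ^ 2 / 2 with hT₁
  set T₂ := A ^ 4 / (2 * γ ^ 2) with hT₂
  refine ⟨C * (Z + T₁ + T₂), by positivity, β, hβ0, min (γ / 2) c,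
    lt_min (by positivity) hc, ?_⟩
  intro ι _ _ a b p q r s hab h δ K μ hδ0 hδ1 hK hμ hd hN t ht
  have hμγ : 2 * μ ≤ γ := by linarith [hμ.trans (min_le_left _ _)]
  have hμc : μ ≤ c := hμ.trans (min_le_right _ _)
  have hδ2 : δ ^ 2 ≤ 1 := pow_le_one₀ hδ0 hδ1
  have slow : ∀ t, 0 ≤ t → (avg fun κ => -(a κ * q t κ) - b κ * r t κ
        - 2 * γ * (s t κ - avg (s t)) + 1 / 2 * ((a κ + b κ) * (q t κ + r t κ))) ^ 2
      ≤ T₁ * K * Real.exp (-(β * t)) + T₂ * K * δ ^ 4 * Real.exp (-(μ * t)) := by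
    intro t ht
    rw [avg_velocity_energy a b]
    have e2 : (avg fun κ => -(1 / 2) * ((a κ - b κ) * (q t κ - r t κ))) ^ 2
        ≤ 1 / 4 * (A * δ) ^ 2 * avg fun κ => (q t κ - r t κ) ^ 2 := by
      rw [← avg_const_mul]
      refine (sq_avg_le _).trans (avg_mono fun κ => ?_)
      have : (a κ - b κ) ^ 2 ≤ (A * δ) ^ 2 :=
        sq_le_sq' (by linarith [(abs_le.1 (hd κ)).1]) (abs_le.1 (hd κ)).2
      have := mul_le_mul_of_nonneg_right this (sq_nonneg (q t κ - r t κ))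
      linarith
    have e3 := h.avg_current_sq_le hγ hd hK hμγ hN ht
    have e4 : Real.exp (-(γ * t)) ≤ Real.exp (-(β * t)) := exp_neg_mul_le (by linarith) (by assumption)
    refine e2.trans ((mul_le_mul_of_nonneg_left e3 (by positivity)).trans ?_)
    have f1 : 1 / 4 * (A * δ) ^ 2 * (2 * K * Real.exp (-(γ * t)))
        ≤ T₁ * K * Real.exp (-(β * t)) := by
      have : 1 / 4 * (A * δ) ^ 2 * (2 * K * Real.exp (-(γ * t)))
        = T₁ * K * (δ ^ 2 * Real.exp (-(γ * t))) := by rw [hT₁]; ring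
      rw [this]
      refine mul_le_mul_of_nonneg_left ?_ (by positivity)
      exact (mul_le_of_le_one_left (Real.exp_pos _).le hδ2).trans e4
    have f2 : 1 / 4 * (A * δ) ^ 2 * (2 * (A * δ) ^ 2 / γ ^ 2 * (K * Real.exp (-(μ * t))))
        = T₂ * K * δ ^ 4 * Real.exp (-(μ * t)) := by rw [hT₂]; field_simp; ring
    linarith
  have h1 := H hab h.velocity (T₁ * K) (T₂ * K * δ ^ 4) β μ (by positivity) (by positivity)
    hβc hμc slow t ht
  have h4 := meanSq_velocity_le hm hγ hab (p 0) (q 0) (r 0) (s 0)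
  have h5 := hN 0 le_rfl
  simp only [mul_zero, neg_zero, Real.exp_zero, mul_one] at h5
  have h6 := avg_sq_le_meanSq (fun κ => q t κ + r t κ)
        (fun κ => s t κ - b κ * p t κ - γ * q t κ) (fun κ => s t κ - a κ * p t κ - γ * r t κ)
        (fun κ => -(a κ * q t κ) - b κ * r t κ - 2 * γ * (s t κ - avg (s t)))
  have e1 : (avg fun κ => -(a κ * q t κ) - b κ * r t κ - 2 * γ * (s t κ - avg (s t)))
      = -avg fun κ => a κ * q t κ + b κ * r t κ := by
    have : (fun κ => -(a κ * q t κ) - b κ * r t κ - 2 * γ * (s t κ - avg (s t)))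
      = fun κ => (-1) * (a κ * q t κ + b κ * r t κ) - (2 * γ) * (s t κ - avg (s t)) := by
      ext κ; ring
    rw [this, avg_sub, avg_const_mul, avg_const_mul, avg_sub, avg_const]
    ring
  rw [e1, neg_sq] at h6
  have h7 := h4.trans (mul_le_mul_of_nonneg_left h5 hZ0.le)
  have e2 : Real.exp (-(c * t)) ≤ Real.exp (-(β * t)) := exp_neg_mul_le (by linarith) (by assumption)
  have h8 := (mul_le_mul_of_nonneg_left h7 (Real.exp_pos (-(c * t))).le).trans
      (mul_le_mul_of_nonneg_right e2 (by positivity))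
  refine h6.trans (h1.trans ?_)
  rw [mul_assoc C, mul_assoc C]
  refine mul_le_mul_of_nonneg_left ?_ hC.le
  have n1 : 0 ≤ (Z + T₁) * K * (δ ^ 4 * Real.exp (-(μ * t))) := by positivity
  have n2 : 0 ≤ T₂ * K * Real.exp (-(β * t)) := by positivity
  linarith

end Velocity

/-! ### Pointwise expansion of the fiber dynamics -/

theorem source_sq_le {a b c w M : ℝ} (hw : w ^ 2 ≤ M ^ 2) (hc : c ^ 2 ≤ M ^ 4)
    (ha : a ^ 2 ≤ M ^ 2) (hb : b ^ 2 ≤ M ^ 2) (σ₁ σ₂ σ₃ σ₄ : ℝ) :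
    (2 * c * σ₁ + w * (σ₂ + σ₃)) ^ 2 + (2 * a * σ₂ + w * σ₁) ^ 2 + (2 * b * σ₃ + w * σ₁) ^ 2
        + (2 * σ₄) ^ 2
      ≤ (12 * M ^ 4 + 16 * M ^ 2 + 4) * (σ₁ ^ 2 + σ₂ ^ 2 + σ₃ ^ 2 + σ₄ ^ 2) := by
  have k1 : (2 * c * σ₁ + w * (σ₂ + σ₃)) ^ 2
      ≤ 3 * (4 * (c ^ 2 * σ₁ ^ 2) + w ^ 2 * σ₂ ^ 2 + w ^ 2 * σ₃ ^ 2) := by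
    linarith [sq_nonneg (2 * c * σ₁ - w * σ₂), sq_nonneg (2 * c * σ₁ - w * σ₃),
      sq_nonneg (w * σ₂ - w * σ₃)]
  have k2 : (2 * a * σ₂ + w * σ₁) ^ 2 ≤ 2 * (4 * (a ^ 2 * σ₂ ^ 2) + w ^ 2 * σ₁ ^ 2) := by
    linarith [sq_nonneg (2 * a * σ₂ - w * σ₁)]
  have k3 : (2 * b * σ₃ + w * σ₁) ^ 2 ≤ 2 * (4 * (b ^ 2 * σ₃ ^ 2) + w ^ 2 * σ₁ ^ 2) := by
    linarith [sq_nonneg (2 * b * σ₃ - w * σ₁)]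
  have n1 : ∀ x : ℝ, 0 ≤ M ^ 2 * x ^ 2 := fun x => by positivity
  have n2 : ∀ x : ℝ, 0 ≤ M ^ 4 * x ^ 2 := fun x => by positivity
  linarith [mul_le_mul_of_nonneg_right hc (sq_nonneg σ₁),
    mul_le_mul_of_nonneg_right hw (sq_nonneg σ₁), mul_le_mul_of_nonneg_right hw (sq_nonneg σ₂),
    mul_le_mul_of_nonneg_right hw (sq_nonneg σ₃), mul_le_mul_of_nonneg_right ha (sq_nonneg σ₂),
    mul_le_mul_of_nonneg_right hb (sq_nonneg σ₃), n1 σ₁, n1 σ₂, n1 σ₃, n1 σ₄, n2 σ₁, n2 σ₂,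
    n2 σ₃, n2 σ₄, sq_nonneg σ₁, sq_nonneg σ₂, sq_nonneg σ₃]

/-- With `f = 0` the dissipation covers all four components, as `(a + b)p` is itself a dissipated
variable. Half of the rate `c` is spent on the sources through Young's inequality. -/
theorem lyapDot_source_le {γ m M ε a b : ℝ} (hm : 0 < m) (hγ : 0 < γ) (hε : SmallParam γ m M ε)
    (ha : m ≤ a) (ha' : a ≤ M) (hb : m ≤ b) (hb' : b ≤ M) {c : ℝ} (hc : 0 < c) (hc1 : c ≤ γ * m)
    (hc2 : c ≤ 2 * γ) (hc3 : c ≤ 2 * ε * m ^ 2) (p q r s σ₁ σ₂ σ₃ σ₄ : ℝ) :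
    lyapDot ε a b p q r s 0 (q + r + σ₁) (s - b * p - γ * q + σ₂) (s - a * p - γ * r + σ₃)
        (-(a * q) - b * r - 2 * γ * s + σ₄) 0
      ≤ -(c / 2) * (p ^ 2 + q ^ 2 + r ^ 2 + s ^ 2)
        + (12 * M ^ 4 + 16 * M ^ 2 + 4) / (2 * c) * (σ₁ ^ 2 + σ₂ ^ 2 + σ₃ ^ 2 + σ₄ ^ 2) := by
  have h0 := hε.pos
  have hM : 0 < M := by linarith
  have h1 := lyapDot_le hm hγ hε ha ha' hb hb' p q r s 0 0
  set g₁ := 2 * (a * b) * σ₁ + ε * (a + b) * (σ₂ + σ₃) with hg₁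
  set g₂ := 2 * a * σ₂ + ε * (a + b) * σ₁ with hg₂
  set g₃ := 2 * b * σ₃ + ε * (a + b) * σ₁ with hg₃
  set g₄ := 2 * σ₄ with hg₄
  have e : lyapDot ε a b p q r s 0 (q + r + σ₁) (s - b * p - γ * q + σ₂) (s - a * p - γ * r + σ₃)
        (-(a * q) - b * r - 2 * γ * s + σ₄) 0
      = lyapDot ε a b p q r s 0 (q + r) (s - b * p - γ * q) (s - a * p - γ * r)
        (-(a * q) - b * r - 2 * γ * (s - 0)) 0 + (p * g₁ + q * g₂ + r * g₃ + s * g₄) := by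
    rw [lyapDot, lyapDot, hg₁, hg₂, hg₃, hg₄]; ring
  have young : ∀ x y : ℝ, x * y ≤ c / 2 * x ^ 2 + y ^ 2 / (2 * c) := fun x y => by
    have : c / 2 * x ^ 2 + y ^ 2 / (2 * c) - x * y = (c * x - y) ^ 2 / (2 * c) := by
      field_simp; ring
    have h2 : 0 ≤ (c * x - y) ^ 2 / (2 * c) := by positivity
    linarith
  have y1 := young p g₁
  have y2 := young q g₂
  have y3 := young r g₃
  have y4 := young s g₄
  have hε1 : ε * (a + b) ≤ M := by
    have h8 : ε ≤ 1 / 8 := by linarith [hε.h5]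
    linarith [mul_le_mul h8 (by linarith : a + b ≤ 2 * M) (by linarith) (by norm_num)]
  have hε0 : 0 ≤ ε * (a + b) := mul_nonneg h0.le (by linarith)
  have hεs : (ε * (a + b)) ^ 2 ≤ M ^ 2 := pow_le_pow_left₀ hε0 hε1 2
  have hab2 : (a * b) ^ 2 ≤ M ^ 4 := by
    rw [show M ^ 4 = (M * M) ^ 2 by ring]
    exact pow_le_pow_left₀ (mul_nonneg (by linarith) (by linarith))
      (mul_le_mul ha' hb' (by linarith) hM.le) 2
  have ha2 : a ^ 2 ≤ M ^ 2 := pow_le_pow_left₀ (by linarith) ha' 2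
  have hb2 : b ^ 2 ≤ M ^ 2 := pow_le_pow_left₀ (by linarith) hb' 2
  have sum : g₁ ^ 2 + g₂ ^ 2 + g₃ ^ 2 + g₄ ^ 2
      ≤ (12 * M ^ 4 + 16 * M ^ 2 + 4) * (σ₁ ^ 2 + σ₂ ^ 2 + σ₃ ^ 2 + σ₄ ^ 2) :=
    source_sq_le hεs hab2 ha2 hb2 σ₁ σ₂ σ₃ σ₄
  have sum' := div_le_div_of_nonneg_right sum (by positivity : 0 ≤ 2 * c)
  rw [mul_div_right_comm, add_div, add_div, add_div] at sum'
  have d1 := mul_le_mul_of_nonneg_right hc1 (by positivity : 0 ≤ q ^ 2 + r ^ 2)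
  have d2 := mul_le_mul_of_nonneg_right hc2 (sq_nonneg s)
  have d3 : c * p ^ 2 ≤ ε / 2 * ((a + b) * p - 2 * 0) ^ 2 := by
    have j1 := mul_le_mul_of_nonneg_right hc3 (sq_nonneg p)
    have j2 : (2 * m) ^ 2 ≤ (a + b) ^ 2 := pow_le_pow_left₀ (by positivity) (by linarith) 2
    have j3 := mul_le_mul_of_nonneg_right j2 (by positivity : 0 ≤ ε / 2 * p ^ 2)
    linarith
  have d4 : 0 ≤ 2 * ε * M ^ 2 * (q ^ 2 + r ^ 2) := by positivity
  rw [e]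
  simp only [sub_zero, zero_mul, mul_zero, add_zero, ne_eq, OfNat.ofNat_ne_zero,
    not_false_eq_true, zero_pow] at h1 d3 ⊢
  linarith

/-- Once the mean of `s` is treated as a source, the points of the fiber decouple into damped
four-dimensional systems. Their decay rate is uniform in the coefficients, also when `a = b`, and
slowly decaying sources pass through with their own rates. -/
theorem exists_local_decay (γ m M : ℝ) (hγ : 0 < γ) (hm : 0 < m) (hM : 0 < M) :
    ∃ C > 0, ∃ c > 0, ∀ (a b : ℝ) (p q r s σ₁ σ₂ σ₃ σ₄ : ℝ → ℝ),
      m ≤ a → a ≤ M → m ≤ b → b ≤ M →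
      (∀ t, 0 ≤ t → HasDerivAt p (q t + r t + σ₁ t) t) →
      (∀ t, 0 ≤ t → HasDerivAt q (s t - b * p t - γ * q t + σ₂ t) t) →
      (∀ t, 0 ≤ t → HasDerivAt r (s t - a * p t - γ * r t + σ₃ t) t) →
      (∀ t, 0 ≤ t → HasDerivAt s (-(a * q t) - b * r t - 2 * γ * s t + σ₄ t) t) →
      ∀ A B α β : ℝ, 0 ≤ A → 0 ≤ B → α ≤ c → β ≤ c →
      (∀ t, 0 ≤ t → σ₁ t ^ 2 + σ₂ t ^ 2 + σ₃ t ^ 2 + σ₄ t ^ 2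
        ≤ A * Real.exp (-(α * t)) + B * Real.exp (-(β * t))) →
      ∀ t, 0 ≤ t → p t ^ 2 + q t ^ 2 + r t ^ 2 + s t ^ 2
        ≤ C * (Real.exp (-(c * t)) * (p 0 ^ 2 + q 0 ^ 2 + r 0 ^ 2 + s 0 ^ 2)
          + A * Real.exp (-(α * t)) + B * Real.exp (-(β * t))) := by
  obtain ⟨ε, hε⟩ := exists_smallParam hγ hm hM
  have hε0 := hε.pos
  set c := min (γ * m) (min (2 * γ) (2 * ε * m ^ 2)) with hc
  have hc0 : 0 < c := lt_min (by positivity) (lt_min (by positivity) (by positivity))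
  have c1 : c ≤ γ * m := min_le_left _ _
  have c2 : c ≤ 2 * γ := (min_le_right _ _).trans (min_le_left _ _)
  have c3 : c ≤ 2 * ε * m ^ 2 := (min_le_right _ _).trans (min_le_right _ _)
  set l := min (m ^ 2 / 2) (min (m / 2) (1 / 2)) with hl
  have hl0 : 0 < l := lt_min (by positivity) (lt_min (by positivity) (by positivity))
  have l1 : l ≤ m ^ 2 / 2 := min_le_left _ _
  have l2 : l ≤ m / 2 := (min_le_right _ _).trans (min_le_left _ _)
  have l3 : l ≤ 1 / 2 := (min_le_right _ _).trans (min_le_right _ _)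
  set U := 2 * M ^ 2 + M + 1 with hU
  have hU0 : 0 < U := by positivity
  set T := (12 * M ^ 4 + 16 * M ^ 2 + 4) / (2 * c) with hT
  have hT0 : 0 < T := by positivity
  set k := c / 2 / U with hk
  have hk0 : 0 < k := by positivity
  refine ⟨l⁻¹ * (U + 2 / k * T), by positivity, k / 2, by positivity, ?_⟩
  intro a b p q r s σ₁ σ₂ σ₃ σ₄ ha ha' hb hb' dp dq dr ds A B α β hA hB hα hβ hσ t ht
  have hup : ∀ t, lyap ε a b (p t) (q t) (r t) (s t) 0
      ≤ U * (p t ^ 2 + q t ^ 2 + r t ^ 2 + s t ^ 2) := fun t => by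
    simpa using lyap_le hm hε ha ha' hb hb' (p t) (q t) (r t) (s t) 0
  have hlow : l * (p t ^ 2 + q t ^ 2 + r t ^ 2 + s t ^ 2)
      ≤ lyap ε a b (p t) (q t) (r t) (s t) 0 := by
    have := le_lyap hm hε ha ha' hb hb' (p t) (q t) (r t) (s t) 0
    refine le_trans ?_ this
    linarith [mul_le_mul_of_nonneg_right l1 (sq_nonneg (p t)),
      mul_le_mul_of_nonneg_right l2 (sq_nonneg (q t)),
      mul_le_mul_of_nonneg_right l2 (sq_nonneg (r t)),
      mul_le_mul_of_nonneg_right l3 (sq_nonneg (s t)), sq_nonneg (s t)]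
  have hD : ∀ t, 0 ≤ t → HasDerivAt (fun t => lyap ε a b (p t) (q t) (r t) (s t) 0) _ t :=
    fun t ht => hasDerivAt_lyap (dp t ht) (dq t ht) (dr t ht) (ds t ht) (hasDerivAt_const t 0)
  have h1 := le_of_deriv_le_forcing (α := α) (β := β) hk0 (by positivity : 0 ≤ T * A) (by positivity : 0 ≤ T * B)
    (by linarith) (by linarith) hD (fun t ht => ?_) ht
  · set X0 := p 0 ^ 2 + q 0 ^ 2 + r 0 ^ 2 + s 0 ^ 2 with hX0
    have hX0' : 0 ≤ X0 := by positivity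
    set E := A * Real.exp (-(α * t)) + B * Real.exp (-(β * t)) with hE
    have hE0 : 0 ≤ E := by positivity
    have e2 : Real.exp (-(k * t)) ≤ Real.exp (-(k / 2 * t)) := exp_neg_mul_le (by linarith) (by assumption)
    have h4 := (mul_le_mul_of_nonneg_left (hup 0) (Real.exp_pos (-(k * t))).le).trans
      (mul_le_mul_of_nonneg_right e2 (by positivity))
    have h5 : 2 / k * (T * A * Real.exp (-(α * t)) + T * B * Real.exp (-(β * t)))
      = 2 / k * T * E := by rw [hE]; ring
    rw [h5] at h1
    rw [add_assoc (_ * X0), ← hE, mul_assoc, ← div_eq_inv_mul, le_div_iff₀' hl0]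
    have n1 : 0 ≤ U * E := by positivity
    have n2 : 0 ≤ 2 / k * T * (Real.exp (-(k / 2 * t)) * X0) := by positivity
    linarith
  · have h2 := lyapDot_source_le hm hγ hε ha ha' hb hb' hc0 c1 c2 c3 (p t) (q t) (r t) (s t)
      (σ₁ t) (σ₂ t) (σ₃ t) (σ₄ t)
    rw [← hT] at h2
    have h3 := mul_le_mul_of_nonneg_left (hσ t ht) hT0.le
    have h4 := mul_le_mul_of_nonneg_left (hup t) hk0.le
    have h5 : k * (U * (p t ^ 2 + q t ^ 2 + r t ^ 2 + s t ^ 2))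
      = c / 2 * (p t ^ 2 + q t ^ 2 + r t ^ 2 + s t ^ 2) := by rw [hk]; field_simp
    linarith

set_option maxHeartbeats 800000 in
/-- At late times every fiber state is close to the multiple `avg s • V` of an approximately
stationary symbol `V`. -/
theorem exists_fiber_expansion (γ m M A cD : ℝ) (hγ : 0 < γ) (hm : 0 < m) (hM : 0 < M)
    (hA : 0 < A) (hcD : 0 < cD) :
    ∃ C > 0, ∃ c > 0, ∀ {ι : Type} [Fintype ι] [Nonempty ι] {a b : ι → ℝ} {p q r s : ℝ → ι → ℝ},
      CoeffBound m M a b → FiberSol γ a b p q r s → ∀ δ K ρ : ℝ, 0 ≤ δ → δ ≤ 1 → 0 ≤ K →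
      (∀ κ, |a κ - b κ| ≤ A * δ) → cD * δ ^ 2 ≤ avg (fun κ => (a κ - b κ) ^ 2) →
      meanSq (p 0) (q 0) (r 0) (s 0) ≤ K → ∀ (κ : ι) (V₁ V₂ V₃ V₄ : ℝ),
      V₁ ^ 2 ≤ A → V₂ ^ 2 ≤ A → V₃ ^ 2 ≤ A → V₄ ^ 2 ≤ A → |V₂ + V₃| ≤ ρ →
      |V₄ - b κ * V₁ - γ * V₂| ≤ ρ → |V₄ - a κ * V₁ - γ * V₃| ≤ ρ →
      |-(a κ * V₂) - b κ * V₃ - 2 * γ * V₄ + 2 * γ| ≤ ρ →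
      ∀ t, 0 ≤ t → avg (s t) ^ 2 ≤ C * (K * Real.exp (-(c * δ ^ 2 * t))) ∧
        (p t κ - avg (s t) * V₁) ^ 2 + (q t κ - avg (s t) * V₂) ^ 2
          + (r t κ - avg (s t) * V₃) ^ 2 + (s t κ - avg (s t) * V₄) ^ 2
        ≤ C * (Real.exp (-(c * t)) * (p 0 κ ^ 2 + q 0 κ ^ 2 + r 0 κ ^ 2 + s 0 κ ^ 2 + K)
          + K * (ρ ^ 2 + δ ^ 4) * Real.exp (-(c * δ ^ 2 * t))) := by
  obtain ⟨C₁, hC₁, c₁, hc₁, H₁⟩ := exists_diffusive_decay γ m M cD hγ hm hM hcD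
  obtain ⟨C₂, hC₂, c₂, hc₂, c₂', hc₂', H₂⟩ := exists_velocity_bound γ m M A hγ hm hM hA
  obtain ⟨C₃, hC₃, c₃, hc₃, H₃⟩ := exists_local_decay γ m M hγ hm hM
  set c := min (min c₁ c₂) (min c₂' c₃) with hc
  have hc0 : 0 < c := lt_min (lt_min hc₁ hc₂) (lt_min hc₂' hc₃)
  have k1 : c ≤ c₁ := (min_le_left _ _).trans (min_le_left _ _)
  have k2 : c ≤ c₂ := (min_le_left _ _).trans (min_le_right _ _)
  have k2' : c ≤ c₂' := (min_le_right _ _).trans (min_le_left _ _)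
  have k3 : c ≤ c₃ := (min_le_right _ _).trans (min_le_right _ _)
  set D := 8 * A * C₂ * C₁ with hD
  have hD0 : 0 < D := by positivity
  set C := C₁ + C₃ * (2 + 8 * A + D + 8 * C₁) with hC
  refine ⟨C, by positivity, c, hc0, ?_⟩
  intro ι _ _ a b p q r s hab h δ K ρ hδ0 hδ1 hK hd hcd hN0 κ V₁ V₂ V₃ V₄ hV₁ hV₂ hV₃ hV₄
    hρ₁ hρ₂ hρ₃ hρ₄ t ht
  have hδ2 : δ ^ 2 ≤ 1 := pow_le_one₀ hδ0 hδ1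
  have hμ : c * δ ^ 2 ≤ c := mul_le_of_le_one_right hc0.le hδ2
  have hN : ∀ t, 0 ≤ t → meanSq (p t) (q t) (r t) (s t)
      ≤ C₁ * K * Real.exp (-(c * δ ^ 2 * t)) := by
    intro t ht
    refine (H₁ hab h δ hδ0 hδ1 hcd t ht).trans ?_
    rw [mul_assoc C₁ K, mul_comm K]
    refine mul_le_mul_of_nonneg_left ?_ hC₁.le
    have : c * δ ^ 2 * t ≤ c₁ * δ ^ 2 * t := by gcongr
    exact mul_le_mul (Real.exp_le_exp.2 (by linarith)) hN0 (meanSq_nonneg _ _ _ _)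
      (Real.exp_pos _).le
  have hf : ∀ t, 0 ≤ t → avg (s t) ^ 2 ≤ C₁ * K * Real.exp (-(c * δ ^ 2 * t)) := fun t ht =>
    (avg_sq_le_meanSq (p t) (q t) (r t) (s t)).trans (hN t ht)
  set X0 := p 0 κ ^ 2 + q 0 κ ^ 2 + r 0 κ ^ 2 + s 0 κ ^ 2 with hX0
  have hX0' : 0 ≤ X0 := by positivity
  constructor
  · refine (hf t ht).trans ?_
    rw [mul_assoc]
    refine mul_le_mul_of_nonneg_right ?_ (by positivity)
    have : 0 ≤ C₃ * (2 + 8 * A + D + 8 * C₁) := by positivity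
    linarith
  set g : ℝ → ℝ := fun t => -avg fun κ => a κ * q t κ + b κ * r t κ with hg
  have hg' : ∀ t, 0 ≤ t → HasDerivAt (fun t => avg (s t)) (g t) t := fun t ht =>
    h.hasDerivAt_avg_s ht
  have hg2 : ∀ t, 0 ≤ t → g t ^ 2
      ≤ C₂ * (C₁ * K) * (Real.exp (-(c * t)) + δ ^ 4 * Real.exp (-(c * δ ^ 2 * t))) := by
    intro t ht
    simp only [hg, neg_sq]
    refine (H₂ hab h δ (C₁ * K) (c * δ ^ 2) hδ0 hδ1 (by positivity) (hμ.trans k2') hd hN t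
      ht).trans ?_
    have : Real.exp (-(c₂ * t)) ≤ Real.exp (-(c * t)) := exp_neg_mul_le (by linarith) (by assumption)
    gcongr
  have hκ := hab κ
  -- The difference to `avg s • V` satisfies the equations without mean coupling. Its sources are
  -- `avg s` times the residual of `V` and `-g V`; the noise term `2γ avg s` is the `+ 2γ` in the
  -- last residual.
  have key := H₃ (a κ) (b κ) (fun t => p t κ - avg (s t) * V₁) (fun t => q t κ - avg (s t) * V₂)
    (fun t => r t κ - avg (s t) * V₃) (fun t => s t κ - avg (s t) * V₄)
    (fun t => avg (s t) * (V₂ + V₃) - g t * V₁)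
    (fun t => avg (s t) * (V₄ - b κ * V₁ - γ * V₂) - g t * V₂)
    (fun t => avg (s t) * (V₄ - a κ * V₁ - γ * V₃) - g t * V₃)
    (fun t => avg (s t) * (-(a κ * V₂) - b κ * V₃ - 2 * γ * V₄ + 2 * γ) - g t * V₄)
    hκ.1 hκ.2.1 hκ.2.2.1 hκ.2.2.2
    (fun t ht => ((h.dp t ht κ).fun_sub ((hg' t ht).mul_const V₁)).congr_deriv (by ring))
    (fun t ht => ((h.dq t ht κ).fun_sub ((hg' t ht).mul_const V₂)).congr_deriv (by ring))
    (fun t ht => ((h.dr t ht κ).fun_sub ((hg' t ht).mul_const V₃)).congr_deriv (by ring))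
    (fun t ht => ((h.ds t ht κ).fun_sub ((hg' t ht).mul_const V₄)).congr_deriv (by ring))
    (D * K) ((8 * C₁ * ρ ^ 2 + D * δ ^ 4) * K) c (c * δ ^ 2) (by positivity) (by positivity)
    k3 (hμ.trans k3) (fun t ht => ?_) t ht
  · refine key.trans ?_
    have e0 : Real.exp (-(c₃ * t)) ≤ Real.exp (-(c * t)) := exp_neg_mul_le (by linarith) (by assumption)
    have f0 : avg (s 0) ^ 2 ≤ K := (avg_sq_le_meanSq (p 0) (q 0) (r 0) (s 0)).trans hN0
    have i1 : ∀ x V : ℝ, V ^ 2 ≤ A → (x - avg (s 0) * V) ^ 2 ≤ 2 * x ^ 2 + 2 * (A * K) := by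
      intro x V hV
      have : avg (s 0) ^ 2 * V ^ 2 ≤ K * A := mul_le_mul f0 hV (sq_nonneg _) hK
      linarith [sq_nonneg (x + avg (s 0) * V)]
    have i2 : (p 0 κ - avg (s 0) * V₁) ^ 2 + (q 0 κ - avg (s 0) * V₂) ^ 2
          + (r 0 κ - avg (s 0) * V₃) ^ 2 + (s 0 κ - avg (s 0) * V₄) ^ 2
          ≤ (2 + 8 * A) * (X0 + K) := by
      have n : 0 ≤ A * X0 := by positivity
      linarith [i1 (p 0 κ) V₁ hV₁, i1 (q 0 κ) V₂ hV₂, i1 (r 0 κ) V₃ hV₃, i1 (s 0 κ) V₄ hV₄]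
    have i3 := mul_le_mul e0 i2 (by positivity) (Real.exp_pos _).le
    set E := Real.exp (-(c * t)) with hE
    set E' := Real.exp (-(c * δ ^ 2 * t)) with hE'
    have hE0 : 0 < E := Real.exp_pos _
    have hE0' : 0 < E' := Real.exp_pos _
    have i4 := mul_le_mul_of_nonneg_left i3 hC₃.le
    have n1 : 0 ≤ C₁ * (E * (X0 + K)) := by positivity
    have n2 : 0 ≤ C₃ * D * (E * X0) := by positivity
    have n3 : 0 ≤ C₃ * (8 * C₁) * (E * (X0 + K)) := by positivity
    have n4 : 0 ≤ C₁ * (K * (ρ ^ 2 + δ ^ 4) * E') := by positivity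
    have n5 : 0 ≤ C₃ * (2 + 8 * A) * (K * (ρ ^ 2 + δ ^ 4) * E') := by positivity
    have n6 : 0 ≤ C₃ * D * (K * ρ ^ 2 * E') := by positivity
    have n7 : 0 ≤ C₃ * (8 * C₁) * (K * δ ^ 4 * E') := by positivity
    rw [hC]
    linarith
  · have f0 := hf t ht
    have g0 := hg2 t ht
    have i1 : ∀ R V : ℝ, |R| ≤ ρ → V ^ 2 ≤ A → (avg (s t) * R - g t * V) ^ 2
        ≤ 2 * (avg (s t) ^ 2 * ρ ^ 2) + 2 * (g t ^ 2 * A) := by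
      intro R V hR hV
      have r2 : R ^ 2 ≤ ρ ^ 2 := sq_le_sq' (by linarith [(abs_le.1 hR).1]) (abs_le.1 hR).2
      have := mul_le_mul_of_nonneg_left r2 (sq_nonneg (avg (s t)))
      have := mul_le_mul_of_nonneg_left hV (sq_nonneg (g t))
      linarith [sq_nonneg (avg (s t) * R + g t * V)]
    have j1 := mul_le_mul_of_nonneg_right f0 (sq_nonneg ρ)
    have j2 := mul_le_mul_of_nonneg_right g0 hA.le
    rw [hD]
    linarith [i1 _ _ hρ₁ hV₁, i1 _ _ hρ₂ hV₂, i1 _ _ hρ₃ hV₃, i1 _ _ hρ₄ hV₄]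

/-! ### Nondegeneracy of the dispersion relation -/

/-- The contribution of the site `n` to `∫₀¹ (Φ̂(κ - k) - Φ̂(κ))² dκ`. -/
def gradTerm (Φ : ℤ → ℝ) (k : ℝ) (n : ℤ) : ℝ :=
  Φ n ^ 2 * (2 - 2 * Real.cos (2 * Real.pi * k * n))

theorem gradTerm_nonneg (Φ : ℤ → ℝ) (k : ℝ) (n : ℤ) : 0 ≤ gradTerm Φ k n :=
  mul_nonneg (sq_nonneg _) (by linarith [Real.cos_le_one (2 * Real.pi * k * n)])

theorem gradTerm_eq (Φ : ℤ → ℝ) (k : ℝ) (n : ℤ) :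
    gradTerm Φ k n = 4 * Φ n ^ 2 * Real.sin (Real.pi * k * n) ^ 2 := by
  rw [gradTerm, Real.sin_sq_eq_half_sub]; ring_nf

theorem continuous_gradTerm (Φ : ℤ → ℝ) (n : ℤ) : Continuous fun k => gradTerm Φ k n := by
  unfold gradTerm; fun_prop

section

variable {Φ : ℤ → ℝ} {γ : ℝ}

/-- Only a qualitative consequence of nondegeneracy is needed. If every term vanished, `Φ̂` would be
invariant under the shift by `k`, hence so would `Â_t`, and the integral would be zero. -/
theorem Admissible.exists_gradTerm_pos (hΦ : Admissible Φ γ) {k : ℝ} (hk : 0 < |k|)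
    (hk' : |k| ≤ 1 / 2) : ∃ n, 0 < gradTerm Φ k n := by
  by_contra! hcon
  have hz : ∀ n, gradTerm Φ k n = 0 := fun n => le_antisymm (hcon n) (gradTerm_nonneg Φ k n)
  have hp : ∀ κ, phiHat Φ (κ + k / 2) = phiHat Φ (κ - k / 2) := by
    intro κ
    refine tsum_congr fun n => ?_
    rcases mul_eq_zero.1 (hz n) with h | h
    · rw [pow_eq_zero_iff two_ne_zero] at h
      simp [h]
    · have hc : Real.cos (2 * Real.pi * k * n) = 1 := by linarith
      have hs : Real.sin (2 * Real.pi * k * n) = 0 := by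
        have := Real.sin_sq_add_cos_sq (2 * Real.pi * k * n)
        rw [hc] at this
        exact pow_eq_zero_iff two_ne_zero |>.1 (by linarith)
      rw [show 2 * Real.pi * (κ + k / 2) * n
        = 2 * Real.pi * (κ - k / 2) * n + 2 * Real.pi * k * n by ring, Real.cos_add, hc, hs]
      ring
  obtain ⟨C, hC, h⟩ := hΦ.nondegenerate |k| hk
  have h1 := h k le_rfl hk'
  have hd : ∀ κ, disp Φ (κ + k / 2) = disp Φ (κ - k / 2) := fun κ => by
    rw [hΦ.disp_eq, hΦ.disp_eq, hp]
  have hA : ∀ t κ, Ahat Φ γ t (κ + k / 2) = Ahat Φ γ t (κ - k / 2) := fun t κ => by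
    simp only [Ahat, bigOmega, hd]
  simp only [hA, sub_self, ne_eq, OfNat.ofNat_ne_zero, not_false_eq_true, zero_pow,
    intervalIntegral.integral_zero, integral_zero] at h1
  linarith

/-- Compactness: away from `k = 0` finitely many sites suffice for positivity. Near `0` a single
site `n₀ ≠ 0` with `Φ n₀ ≠ 0`, found by testing `k = 1/2`, gives a quadratic lower bound. Finiteness
of `F` matters because `F` must fit into `Λ_L` for large `L`. -/
theorem Admissible.exists_gradient_bound (hΦ : Admissible Φ γ) :
    ∃ F : Finset ℤ, ∃ c > 0, ∀ k : ℝ, |k| ≤ 1 / 2 → c * k ^ 2 ≤ ∑ n ∈ F, gradTerm Φ k n := by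
  have hhalf : |(1 / 2 : ℝ)| = 1 / 2 := abs_of_pos (by norm_num)
  obtain ⟨n₀, hn₀⟩ := hΦ.exists_gradTerm_pos (k := 1 / 2) (by norm_num) (by rw [hhalf])
  have hΦn : Φ n₀ ≠ 0 := by
    rintro h; simp [gradTerm, h] at hn₀
  have hn0 : n₀ ≠ 0 := by
    rintro rfl; simp [gradTerm] at hn₀
  have hn1 : (1 : ℝ) ≤ |(n₀ : ℝ)| := by
    rw [← Int.cast_abs]; exact_mod_cast Int.one_le_abs hn0
  -- Below this threshold `π k n₀` stays in `[-π/2, π/2]`, where Jordan's inequality applies.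
  set ε := 1 / (2 * |(n₀ : ℝ)|) with hε
  have hε0 : 0 < ε := by positivity
  have hε1 : ε ≤ 1 / 2 := by
    rw [hε, div_le_div_iff₀ (by positivity) (by norm_num)]; linarith
  set K : Set ℝ := Set.Icc (-(1 / 2)) (1 / 2) ∩ {k | ε ≤ |k|} with hK
  have hKc : IsCompact K := isCompact_Icc.inter_right (isClosed_le continuous_const continuous_abs)
  obtain ⟨F₀, hF₀⟩ := hKc.elim_finite_subcover (fun n : ℤ => {k | 0 < gradTerm Φ k n})
    (fun n => isOpen_lt continuous_const (continuous_gradTerm Φ n)) (fun k hk => by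
      obtain ⟨n, hn⟩ := hΦ.exists_gradTerm_pos (hε0.trans_le hk.2) (abs_le.2 hk.1)
      exact Set.mem_iUnion.2 ⟨n, hn⟩)
  set F := insert n₀ F₀ with hF
  have hcont : ContinuousOn (fun k => ∑ n ∈ F, gradTerm Φ k n) K :=
    (continuous_finsetSum _ fun n _ => continuous_gradTerm Φ n).continuousOn
  obtain ⟨k₁, hk₁, hmin⟩ := hKc.exists_isMinOn (f := fun k => ∑ n ∈ F, gradTerm Φ k n)
    ⟨1 / 2, ⟨by norm_num, le_rfl⟩, by simp only [Set.mem_ofPred_eq, hhalf]; exact hε1⟩ hcont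
  set c₁ := ∑ n ∈ F, gradTerm Φ k₁ n with hc₁
  have hc₁0 : 0 < c₁ := by
    obtain ⟨n, hn⟩ := Set.mem_iUnion.1 (hF₀ hk₁)
    obtain ⟨hnF, hn⟩ := Set.mem_iUnion.1 hn
    exact Finset.sum_pos' (fun n _ => gradTerm_nonneg Φ k₁ n)
      ⟨n, Finset.mem_insert_of_mem hnF, hn⟩
  refine ⟨F, min c₁ (16 * Φ n₀ ^ 2), lt_min hc₁0 (by positivity), fun k hk => ?_⟩
  rcases le_or_gt ε |k| with h | h
  · have h1 : c₁ ≤ ∑ n ∈ F, gradTerm Φ k n := hmin ⟨abs_le.1 hk, h⟩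
    refine le_trans ?_ h1
    have hk2 : k ^ 2 ≤ 1 := by
      rw [← sq_abs]; exact pow_le_one₀ (abs_nonneg _) (by linarith)
    calc min c₁ (16 * Φ n₀ ^ 2) * k ^ 2 ≤ c₁ * 1 :=
          mul_le_mul (min_le_left _ _) hk2 (sq_nonneg _) hc₁0.le
      _ = c₁ := mul_one _
  · have h1 : gradTerm Φ k n₀ ≤ ∑ n ∈ F, gradTerm Φ k n :=
      Finset.single_le_sum (fun n _ => gradTerm_nonneg Φ k n) (Finset.mem_insert_self _ _)
    refine le_trans ?_ h1
    have hπ := Real.pi_pos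
    have hx : |Real.pi * k * n₀| ≤ Real.pi / 2 := by
      rw [abs_mul, abs_mul, abs_of_pos hπ]
      have : |k| * |(n₀ : ℝ)| ≤ 1 / 2 := by
        have := mul_le_mul_of_nonneg_right h.le (abs_nonneg (n₀ : ℝ))
        rw [hε] at this
        refine this.trans (le_of_eq ?_)
        field_simp
      rw [mul_assoc]
      nlinarith
    have h2 := Real.mul_abs_le_abs_sin hx
    have h3 := pow_le_pow_left₀ (by positivity) h2 2
    rw [mul_pow, sq_abs, sq_abs] at h3
    have h4 : (2 / Real.pi) ^ 2 * (Real.pi * k * n₀) ^ 2 = 4 * k ^ 2 * (n₀ : ℝ) ^ 2 := by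
      field_simp; ring
    have h5 : (1 : ℝ) ≤ (n₀ : ℝ) ^ 2 := by rw [← sq_abs]; exact one_le_pow₀ hn1
    rw [h4] at h3
    have h6 : 4 * k ^ 2 ≤ Real.sin (Real.pi * k * n₀) ^ 2 :=
      (le_mul_of_one_le_right (by positivity) h5).trans h3
    rw [gradTerm_eq]
    calc min c₁ (16 * Φ n₀ ^ 2) * k ^ 2 ≤ 16 * Φ n₀ ^ 2 * k ^ 2 :=
          mul_le_mul_of_nonneg_right (min_le_right _ _) (sq_nonneg _)
      _ = 4 * Φ n₀ ^ 2 * (4 * k ^ 2) := by ring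
      _ ≤ _ := mul_le_mul_of_nonneg_left h6 (by positivity)

end

/-! ### Fourier analysis on the periodic lattice -/

section Lattice

variable {L : ℕ} [NeZero L]

/-- The character `z ↦ exp(2πi a z / L)`. -/
def chi (z : ZMod L) : ℂ := ZMod.stdAddChar z

theorem chi_zero : chi (0 : ZMod L) = 1 := AddChar.map_zero_eq_one _

theorem chi_add (x y : ZMod L) : chi (x + y) = chi x * chi y := AddChar.map_add_eq_mul _ _ _

theorem chi_neg (x : ZMod L) : chi (-x) = (starRingEnd ℂ) (chi x) := AddChar.map_neg_eq_conj _ _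

theorem norm_chi (x : ZMod L) : ‖chi x‖ = 1 := AddChar.norm_apply _ _

theorem chi_intCast (j : ℤ) :
    chi (j : ZMod L) = Complex.exp (((2 * Real.pi * j / L : ℝ) : ℂ) * Complex.I) := by
  rw [chi, ZMod.stdAddChar_coe]
  congr 1
  push_cast
  ring

theorem chi_mul (a z : ZMod L) :
    chi (a * z)
      = Complex.exp (((2 * Real.pi * dualPoint L a * z.valMinAbs : ℝ) : ℂ) * Complex.I) := by
  have : a * z = ((a.valMinAbs * z.valMinAbs : ℤ) : ZMod L) := by
    push_cast
    rfl
  rw [this, chi_intCast, dualPoint]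
  congr 3
  push_cast
  ring

theorem chi_mul_re (a z : ZMod L) :
    (chi (a * z)).re = Real.cos (2 * Real.pi * dualPoint L a * z.valMinAbs) := by
  rw [chi_mul, Complex.exp_ofReal_mul_I_re]

theorem sum_chi_mul (z : ZMod L) : ∑ a : ZMod L, chi (a * z) = if z = 0 then (L : ℂ) else 0 := by
  have := AddChar.sum_mulShift (R' := ℂ) z (ZMod.isPrimitive_stdAddChar L)
  rw [ZMod.card] at this
  simp only [chi]
  rw [this]
  split_ifs <;> simp

theorem sum_fourier_mul_fourier (g h : ZMod L → ℂ) :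
    ∑ a : ZMod L, (∑ z, g z * chi (a * z)) * ∑ w, h w * chi (-(a * w)) = L * ∑ z, g z * h z := by
  simp only [Finset.sum_mul_sum]
  rw [Finset.sum_comm, Finset.mul_sum]
  refine Finset.sum_congr rfl fun z _ => ?_
  rw [Finset.sum_comm]
  have e : ∀ w : ZMod L, ∑ a : ZMod L, g z * chi (a * z) * (h w * chi (-(a * w)))
      = g z * h w * if z - w = 0 then (L : ℂ) else 0 := by
    intro w
    rw [← sum_chi_mul, Finset.mul_sum]
    refine Finset.sum_congr rfl fun a _ => ?_
    rw [mul_sub, sub_eq_add_neg, chi_add]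
    ring
  simp only [e, sub_eq_zero]
  rw [Finset.sum_eq_single z (fun w _ hw => by rw [if_neg (Ne.symm hw), mul_zero])
    (fun h => absurd (Finset.mem_univ z) h), if_pos rfl]
  ring

theorem ofReal_norm_sq (w : ℂ) : ((‖w‖ ^ 2 : ℝ) : ℂ) = w * (starRingEnd ℂ) w := by
  rw [Complex.mul_conj, Complex.normSq_eq_norm_sq]

theorem conj_fourier (g : ZMod L → ℂ) (a : ZMod L) : (starRingEnd ℂ) (∑ z, g z * chi (a * z))
    = ∑ z, (starRingEnd ℂ) (g z) * chi (-(a * z)) := by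
  simp only [map_sum, map_mul, chi_neg]

theorem parseval (g : ZMod L → ℂ) :
    ∑ a : ZMod L, ‖∑ z, g z * chi (a * z)‖ ^ 2 = L * ∑ z, ‖g z‖ ^ 2 := by
  have h := sum_fourier_mul_fourier g fun z => (starRingEnd ℂ) (g z)
  simp only [← conj_fourier, ← ofReal_norm_sq] at h
  exact_mod_cast h

/-- The periodic interaction as a function on the lattice. -/
def phiL (Φ : ℤ → ℝ) (z : ZMod L) : ℝ := Φ z.valMinAbs

/-- The Fourier transform of the periodic interaction. -/
def phiHatL (Φ : ℤ → ℝ) (a : ZMod L) : ℝ :=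
  ∑ z : ZMod L, phiL Φ z * Real.cos (2 * Real.pi * dualPoint L a * z.valMinAbs)

/-- At the antipodal site `2z = L` the representative is not odd under negation, but there `-z = z`;
elsewhere evenness of `Φ` applies. -/
theorem phiL_neg {Φ : ℤ → ℝ} (hs : ∀ x, Φ (-x) = Φ x) (z : ZMod L) : phiL Φ (-z) = phiL Φ z := by
  unfold phiL
  by_cases h : 2 * z.val = L
  · rw [(ZMod.neg_eq_self_iff z).2 (Or.inr h)]
  · rw [ZMod.valMinAbs_neg_of_ne_half h, hs]

theorem sum_phiL_chi {Φ : ℤ → ℝ} (hs : ∀ x, Φ (-x) = Φ x) (a : ZMod L) :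
    ∑ z, (phiL Φ z : ℂ) * chi (a * z) = phiHatL Φ a := by
  have hc : (starRingEnd ℂ) (∑ z, (phiL Φ z : ℂ) * chi (a * z))
      = ∑ z, (phiL Φ z : ℂ) * chi (a * z) := by
    rw [map_sum, ← Equiv.sum_comp (Equiv.neg (ZMod L))]
    refine Finset.sum_congr rfl fun z _ => ?_
    rw [map_mul, Complex.conj_ofReal, ← chi_neg, Equiv.neg_apply, phiL_neg hs, mul_neg, neg_neg]
  rw [← Complex.conj_eq_iff_re.1 hc]
  norm_cast
  rw [Complex.re_sum]
  refine Finset.sum_congr rfl fun z _ => ?_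
  rw [Complex.re_ofReal_mul, chi_mul_re]

theorem phiHatL_neg {Φ : ℤ → ℝ} (hs : ∀ x, Φ (-x) = Φ x) (a : ZMod L) :
    phiHatL Φ (-a) = phiHatL Φ a := by
  have : (phiHatL Φ (-a) : ℂ) = phiHatL Φ a := by
    rw [← sum_phiL_chi hs, ← sum_phiL_chi hs, ← Equiv.sum_comp (Equiv.neg (ZMod L))]
    refine Finset.sum_congr rfl fun z _ => ?_
    rw [Equiv.neg_apply, phiL_neg hs, neg_mul_neg]
  exact_mod_cast this

theorem sum_chi_convolution {Φ : ℤ → ℝ} (hs : ∀ x, Φ (-x) = Φ x) (a : ZMod L) (g : ZMod L → ℂ) :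
    ∑ x, chi (-(a * x)) * ∑ z, (phiL Φ (x - z) : ℂ) * g z
      = phiHatL Φ a * ∑ z, chi (-(a * z)) * g z := by
  simp only [Finset.mul_sum]
  rw [Finset.sum_comm]
  refine Finset.sum_congr rfl fun z _ => ?_
  rw [← phiHatL_neg hs, ← sum_phiL_chi hs, Finset.sum_mul, ← Equiv.sum_comp (Equiv.addRight z)]
  refine Finset.sum_congr rfl fun x _ => ?_
  rw [Equiv.coe_addRight, add_sub_cancel_right, mul_add, neg_add, chi_add, neg_mul]
  ring

end Lattice

/-! ### Estimates on the periodic dispersion relation -/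

section LatticeEstimates

variable {L : ℕ} [NeZero L] {Φ : ℤ → ℝ} {γ : ℝ}

/-- The lattice sites `Λ_L` as a set of integers. -/
def sites (L : ℕ) [NeZero L] : Finset ℤ := Finset.univ.image (ZMod.valMinAbs : ZMod L → ℤ)

theorem sum_valMinAbs {E : Type*} [AddCommMonoid E] (f : ℤ → E) :
    ∑ z : ZMod L, f z.valMinAbs = ∑ n ∈ sites L, f n := by
  rw [sites, Finset.sum_image ZMod.injective_valMinAbs.injOn]

theorem mem_sites {n : ℤ} : n ∈ sites L ↔ -(L : ℤ) < 2 * n ∧ 2 * n ≤ L := by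
  rw [← mem_range_valMinAbs_iff, sites, ← Finset.mem_coe]
  simp

theorem sq_le_of_notMem_sites {n : ℤ} (h : n ∉ sites L) : (L : ℝ) ^ 2 ≤ 4 * |(n : ℝ)| ^ 2 := by
  have h1 : (L : ℝ) ≤ 2 * |(n : ℝ)| := by
    rw [← Int.cast_abs]
    have : (L : ℤ) ≤ 2 * |n| := by
      by_contra! hlt
      refine h (mem_sites.2 ⟨?_, ?_⟩) <;> cases abs_cases n <;> omega
    exact_mod_cast this
  have := pow_le_pow_left₀ (by positivity) h1 2
  linarith

theorem sum_moment_le (hΦ : Admissible Φ γ) (n : ℕ) :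
    ∑ z : ZMod L, |(z.valMinAbs : ℝ)| ^ n * |phiL Φ z| ≤ absMoment Φ n := by
  have := sum_valMinAbs (L := L) fun x => |(x : ℝ)| ^ n * |Φ x|
  simp only [phiL]
  rw [this]
  exact (hΦ.summable_moment n).sum_le_tsum _ fun x _ => by positivity

theorem sum_abs_phiL_le (hΦ : Admissible Φ γ) : ∑ z : ZMod L, |phiL Φ z| ≤ absMoment Φ 0 := by
  simpa using sum_moment_le (L := L) hΦ 0

/-- The finite cosine sum over `Λ_L` at an arbitrary momentum. -/
def phiSum (L : ℕ) [NeZero L] (Φ : ℤ → ℝ) (k : ℝ) : ℝ :=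
  ∑ z : ZMod L, phiL Φ z * Real.cos (2 * Real.pi * k * z.valMinAbs)

/-- Every integer outside `Λ_L` satisfies `1 ≤ 4n²/L²`, so the tail is bounded by the second moment.
The exponential decay would give more, but `L⁻²` is the accuracy of the expansion. -/
theorem abs_phiSum_sub_phiHat_le (hΦ : Admissible Φ γ) (k : ℝ) :
    |phiSum L Φ k - phiHat Φ k| ≤ 4 * absMoment Φ 2 / (L : ℝ) ^ 2 := by
  have hL : (0 : ℝ) < L := Nat.cast_pos.2 (NeZero.pos L)
  have h1 : phiSum L Φ k = ∑' n : ℤ, if n ∈ sites L then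
      Φ n * Real.cos (2 * Real.pi * k * n) else 0 := by
    rw [tsum_eq_sum (s := sites L) (fun n hn => if_neg hn)]
    have := sum_valMinAbs (L := L) fun n => Φ n * Real.cos (2 * Real.pi * k * n)
    simp only [phiSum, phiL, this]
    exact Finset.sum_congr rfl fun n hn => (if_pos hn).symm
  have hs : Summable fun n : ℤ => if n ∈ sites L then
      Φ n * Real.cos (2 * Real.pi * k * n) else 0 :=
    summable_of_ne_finset_zero (s := sites L) fun n hn => if_neg hn
  rw [h1, phiHat, ← hs.tsum_sub (hΦ.summable_phiHat k), absMoment, ← tsum_mul_left,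
    ← tsum_div_const]
  refine abs_tsum_le_of_abs_le (((hΦ.summable_moment 2).mul_left 4).div_const _) fun n => ?_
  split_ifs with h
  · rw [sub_self, abs_zero]; positivity
  · rw [zero_sub, abs_neg, abs_mul, le_div_iff₀ (by positivity)]
    have h2 := sq_le_of_notMem_sites h
    calc |Φ n| * |Real.cos (2 * Real.pi * k * n)| * (L : ℝ) ^ 2
        ≤ |Φ n| * 1 * (4 * |(n : ℝ)| ^ 2) := by
          gcongr
          exact Real.abs_cos_le_one _
      _ = _ := by ring

theorem phiHatL_eq (a : ZMod L) : phiHatL Φ a = phiSum L Φ (dualPoint L a) := rfl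

/-- The representative of `κ - ξ` can differ from the difference of the two momenta by an integer,
which the periodicity of the characters makes invisible. -/
theorem phiHatL_sub (κ ξ : ZMod L) :
    phiHatL Φ (κ - ξ) = phiSum L Φ (dualPoint L κ - dualPoint L ξ) := by
  refine Finset.sum_congr rfl fun z _ => ?_
  rw [← chi_mul_re, sub_mul, sub_eq_add_neg, chi_add, ← neg_mul, neg_mul, chi_neg, chi_mul,
    chi_mul, ← Complex.exp_conj, ← Complex.exp_add, map_mul, Complex.conj_ofReal, Complex.conj_I,
    mul_neg, ← sub_eq_add_neg, ← sub_mul, ← Complex.ofReal_sub, Complex.exp_ofReal_mul_I_re]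
  congr 2
  ring

theorem abs_phiHatL_le (hΦ : Admissible Φ γ) (a : ZMod L) : |phiHatL Φ a| ≤ absMoment Φ 0 := by
  refine (Finset.abs_sum_le_sum_abs _ _).trans (le_trans (Finset.sum_le_sum fun z _ => ?_)
    (sum_abs_phiL_le (L := L) hΦ))
  rw [abs_mul]
  exact mul_le_of_le_one_right (abs_nonneg _) (Real.abs_cos_le_one _)

theorem abs_cos_sub_cos_le (x y : ℝ) : |Real.cos x - Real.cos y| ≤ |x - y| := by
  have := Real.lipschitzWith_cos.dist_le_mul x y
  simpa [Real.dist_eq] using this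

theorem abs_phiHatL_sub_le (hΦ : Admissible Φ γ) (κ ξ : ZMod L) :
    |phiHatL Φ (κ - ξ) - phiHatL Φ κ| ≤ 2 * Real.pi * absMoment Φ 1 * |dualPoint L ξ| := by
  have hπ := Real.pi_pos
  rw [phiHatL_sub, phiHatL_eq, phiSum, phiSum, ← Finset.sum_sub_distrib]
  calc _ ≤ ∑ z : ZMod L, 2 * Real.pi * |dualPoint L ξ|
        * (|(z.valMinAbs : ℝ)| ^ 1 * |phiL Φ z|) := by
        refine (Finset.abs_sum_le_sum_abs _ _).trans (Finset.sum_le_sum fun z _ => ?_)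
        rw [← mul_sub, abs_mul]
        refine (mul_le_mul_of_nonneg_left (abs_cos_sub_cos_le _ _) (abs_nonneg _)).trans
          (le_of_eq ?_)
        rw [show 2 * Real.pi * (dualPoint L κ - dualPoint L ξ) * (z.valMinAbs : ℝ)
          - 2 * Real.pi * dualPoint L κ * z.valMinAbs
          = -(2 * Real.pi * (dualPoint L ξ * z.valMinAbs)) by ring, abs_neg,
          abs_mul (2 * Real.pi), abs_mul (dualPoint L ξ), abs_of_pos Real.two_pi_pos]
        ring
    _ ≤ 2 * Real.pi * |dualPoint L ξ| * absMoment Φ 1 := by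
        rw [← Finset.mul_sum]
        exact mul_le_mul_of_nonneg_left (sum_moment_le hΦ 1) (by positivity)
    _ = _ := by ring

theorem abs_dualPoint_le (a : ZMod L) : |dualPoint L a| ≤ 1 / 2 := by
  have hL : (0 : ℝ) < L := Nat.cast_pos.2 (NeZero.pos L)
  have h := a.valMinAbs_mem_Ioc
  have h1 : (-(L : ℝ)) < a.valMinAbs * 2 := by exact_mod_cast h.1
  have h2 : (a.valMinAbs : ℝ) * 2 ≤ L := by exact_mod_cast h.2
  rw [dualPoint, abs_div, abs_of_pos hL, div_le_iff₀ hL, abs_le]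
  constructor <;> linarith

/-- Parseval in `κ`: the shift by `ξ` multiplies the coefficient at `z` by `χ(-ξz) - 1`, of squared
modulus `2 - 2 cos`. The identity is exact, so no finite-size error spoils the lower bound at small
`ξ`. -/
theorem avg_sq_phiHatL_sub (hs : ∀ x, Φ (-x) = Φ x) (ξ : ZMod L) :
    avg (fun κ : ZMod L => (phiHatL Φ (κ - ξ) - phiHatL Φ κ) ^ 2)
      = ∑ n ∈ sites L, gradTerm Φ (dualPoint L ξ) n := by
  have hL : (L : ℝ) ≠ 0 := Nat.cast_ne_zero.2 (NeZero.ne L)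
  have h1 : ∀ κ : ZMod L, (phiHatL Φ (κ - ξ) - phiHatL Φ κ) ^ 2
      = ‖∑ z : ZMod L, (phiL Φ z : ℂ) * (chi (-(ξ * z)) - 1) * chi (κ * z)‖ ^ 2 := by
    intro κ
    have : ∑ z : ZMod L, (phiL Φ z : ℂ) * (chi (-(ξ * z)) - 1) * chi (κ * z)
        = ((phiHatL Φ (κ - ξ) - phiHatL Φ κ : ℝ) : ℂ) := by
      push_cast
      rw [← sum_phiL_chi hs, ← sum_phiL_chi hs, ← Finset.sum_sub_distrib]
      refine Finset.sum_congr rfl fun z _ => ?_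
      rw [sub_mul, sub_eq_add_neg (κ * z), chi_add]
      ring
    rw [this, Complex.norm_real, Real.norm_eq_abs, sq_abs]
  rw [avg, ZMod.card]
  simp only [h1]
  rw [parseval, inv_mul_cancel_left₀ hL, ← sum_valMinAbs]
  refine Finset.sum_congr rfl fun z _ => ?_
  rw [norm_mul, mul_pow, Complex.norm_real, Real.norm_eq_abs, sq_abs, gradTerm]
  congr 1
  rw [← chi_mul_re, ← Complex.normSq_eq_norm_sq, Complex.normSq_sub, Complex.normSq_eq_norm_sq,
    norm_chi, chi_neg]
  simp
  ring

theorem Admissible.exists_lattice_bounds (hΦ : Admissible Φ γ) :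
    ∃ L₀ : ℕ, 0 < L₀ ∧ ∃ m > 0, ∃ cD > 0, ∀ (L : ℕ) [NeZero L], L₀ ≤ L →
      (∀ a : ZMod L, m ≤ phiHatL Φ a) ∧
      ∀ ξ : ZMod L, cD * |dualPoint L ξ| ^ 2
        ≤ avg (fun κ : ZMod L => (phiHatL Φ (κ - ξ) - phiHatL Φ κ) ^ 2) := by
  obtain ⟨m, hm, h⟩ := hΦ.exists_le_phiHat
  obtain ⟨F, cD, hcD, hF⟩ := hΦ.exists_gradient_bound
  -- `N` makes the truncation error at most `m/2`; `R` exceeds `2|n|` for all `n ∈ F`, so that `F`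
  -- lies in `Λ_L`.
  obtain ⟨N, hN⟩ := exists_nat_gt (8 * absMoment Φ 2 / m)
  set R := ∑ n ∈ F, (2 * n.natAbs + 1) with hR
  refine ⟨N + R + 1, by omega, m / 2, by positivity, cD, hcD, fun L _ hL => ⟨fun a => ?_, fun ξ => ?_⟩⟩
  · have h1 := (abs_le.1 (abs_phiSum_sub_phiHat_le (L := L) hΦ (dualPoint L a))).1
    have h2 := h (dualPoint L a)
    have hL1 : (N : ℝ) ≤ L := by exact_mod_cast (by omega : N ≤ L)
    have hL2 : (1 : ℝ) ≤ L := by exact_mod_cast (by omega : 1 ≤ L)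
    have h3 : 4 * absMoment Φ 2 / (L : ℝ) ^ 2 ≤ m / 2 := by
      rw [div_le_iff₀ (by positivity)]
      rw [div_lt_iff₀ hm] at hN
      have : (N : ℝ) * m ≤ (L : ℝ) ^ 2 * m := by
        refine mul_le_mul_of_nonneg_right ?_ hm.le
        nlinarith
      linarith
    rw [phiHatL_eq]
    linarith
  · rw [avg_sq_phiHatL_sub hΦ.symm, sq_abs]
    refine (hF _ (abs_dualPoint_le ξ)).trans ?_
    refine Finset.sum_le_sum_of_subset_of_nonneg (fun n hn => ?_) fun n _ _ =>
      gradTerm_nonneg _ _ _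
    have : 2 * n.natAbs + 1 ≤ R := Finset.single_le_sum (f := fun n : ℤ => 2 * n.natAbs + 1)
      (fun _ _ => by omega) hn
    rw [mem_sites]
    omega

/-- Coercivity of the potential energy. -/
theorem le_potential (hs : ∀ x, Φ (-x) = Φ x) {m : ℝ} (hm : ∀ a : ZMod L, m ≤ phiHatL Φ a)
    (q : ZMod L → ℝ) :
    m * ∑ x, q x ^ 2 ≤ ∑ x', ∑ x, q x' * q x * PhiL Φ L x' x := by
  have hL : (0 : ℝ) < L := Nat.cast_pos.2 (NeZero.pos L)
  set g : ZMod L → ℂ := fun z => (q z : ℂ) with hg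
  have h1 := sum_fourier_mul_fourier g fun x => ∑ z, (phiL Φ (x - z) : ℂ) * g z
  have h2 : ∀ a : ZMod L, ∑ x, (∑ z, (phiL Φ (x - z) : ℂ) * g z) * chi (-(a * x))
      = phiHatL Φ a * (starRingEnd ℂ) (∑ z, g z * chi (a * z)) := by
    intro a
    rw [conj_fourier]
    simp only [hg, Complex.conj_ofReal]
    have := sum_chi_convolution hs a g
    simp only [hg, mul_comm (chi _)] at this
    exact this
  have h3 : (∑ a : ZMod L, phiHatL Φ a * ‖∑ z, g z * chi (a * z)‖ ^ 2)
      = L * ∑ x', ∑ x, q x' * q x * PhiL Φ L x' x := by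
    have e : ((∑ a : ZMod L, phiHatL Φ a * ‖∑ z, g z * chi (a * z)‖ ^ 2 : ℝ) : ℂ)
        = ((L * ∑ x', ∑ x, q x' * q x * PhiL Φ L x' x : ℝ) : ℂ) := by
      rw [Complex.ofReal_sum]
      simp only [Complex.ofReal_mul, ofReal_norm_sq]
      simp only [h2] at h1
      refine (Finset.sum_congr rfl fun a _ => ?_).trans (h1.trans ?_)
      · ring
      · push_cast
        congr 1
        refine Finset.sum_congr rfl fun x _ => ?_
        rw [Finset.mul_sum]
        refine Finset.sum_congr rfl fun z _ => ?_
        simp only [hg, PhiL, phiL, Matrix.of_apply]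
        ring
    exact_mod_cast e
  have h4 := parseval g
  have h5 : m * ∑ a : ZMod L, ‖∑ z, g z * chi (a * z)‖ ^ 2
      ≤ ∑ a : ZMod L, phiHatL Φ a * ‖∑ z, g z * chi (a * z)‖ ^ 2 := by
    rw [Finset.mul_sum]
    exact Finset.sum_le_sum fun a _ => mul_le_mul_of_nonneg_right (hm a) (sq_nonneg _)
  rw [h3, h4] at h5
  simp only [hg, Complex.norm_real, Real.norm_eq_abs, sq_abs] at h5
  nlinarith

end LatticeEstimates

/-! ### The generator on truncated observables -/

section Generator

variable {Φ : ℤ → ℝ} {γ : ℝ} {L : ℕ} [NeZero L]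

/-- The vector field of the Hamiltonian flow. -/
def drift (Φ : ℤ → ℝ) (L : ℕ) [NeZero L] (X : Phase L) : Phase L :=
  ![X 1, -(PhiL Φ L).mulVec (X 0)]

theorem generator_eq (F : Phase L → ℝ) (X : Phase L) :
    generator Φ γ L F X = fderiv ℝ F X (drift Φ L X)
      + γ / 2 * ∑ x₀, (F (flip x₀ X) - F X) := by
  have h : drift Φ L X = ∑ x, (X 1 x • (Pi.single 0 (Pi.single x 1) : Phase L)
      - (PhiL Φ L).mulVec (X 0) x • (Pi.single 1 (Pi.single x 1) : Phase L)) := by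
    ext i y
    fin_cases i <;>
      simp [drift, Finset.sum_apply, Pi.single_apply, Finset.sum_ite_eq]
  rw [generator, h, map_sum]
  simp only [map_sub, map_smul, smul_eq_mul, partialDeriv]

theorem hamiltonian_flip (x₀ : ZMod L) (X : Phase L) :
    hamiltonian Φ L (flip x₀ X) = hamiltonian Φ L X := by
  unfold hamiltonian flip
  congr 1
  refine Finset.sum_congr rfl fun x _ => ?_
  split_ifs <;> simp

theorem contDiff_coord (i : Fin 2) (x : ZMod L) : ContDiff ℝ ∞ fun X : Phase L => X i x := by
  fun_prop

theorem contDiff_hamiltonian : ContDiff ℝ ∞ (hamiltonian Φ L) := by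
  unfold hamiltonian
  fun_prop

theorem continuous_flip (x₀ : ZMod L) : Continuous (flip x₀ : Phase L → Phase L) := by
  refine continuous_pi fun i => continuous_pi fun x => ?_
  unfold flip
  split_ifs <;> fun_prop

theorem hasFDerivAt_coord (i : Fin 2) (x : ZMod L) (X : Phase L) :
    HasFDerivAt (fun X : Phase L => X i x)
      ((ContinuousLinearMap.proj x : (ZMod L → ℝ) →L[ℝ] ℝ).comp
        (ContinuousLinearMap.proj i : Phase L →L[ℝ] (ZMod L → ℝ))) X :=
  ((ContinuousLinearMap.proj x : (ZMod L → ℝ) →L[ℝ] ℝ).comp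
        (ContinuousLinearMap.proj i : Phase L →L[ℝ] (ZMod L → ℝ))).hasFDerivAt

theorem fderiv_coord_mul (i j : Fin 2) (x y : ZMod L) (X v : Phase L) :
    fderiv ℝ (fun X : Phase L => X i x * X j y) X v = X i x * v j y + v i x * X j y := by
  rw [((hasFDerivAt_coord i x X).fun_mul (hasFDerivAt_coord j y X)).fderiv]
  simp [mul_comm]

theorem fderiv_hamiltonian (X v : Phase L) :
    fderiv ℝ (hamiltonian Φ L) X v = ∑ x, X 1 x * v 1 x
      + ∑ x', ∑ x, 1 / 2 * ((X 0 x' * v 0 x + v 0 x' * X 0 x) * PhiL Φ L x' x) := by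
  have h : HasFDerivAt (hamiltonian Φ L) _ X :=
    (HasFDerivAt.fun_sum (u := Finset.univ) fun x _ =>
      ((hasFDerivAt_coord 1 x X).pow 2).const_mul (1 / 2)).add
    (HasFDerivAt.fun_sum (u := Finset.univ) fun x' _ =>
      HasFDerivAt.fun_sum (u := Finset.univ) fun x _ =>
      (((hasFDerivAt_coord 0 x' X).mul (hasFDerivAt_coord 0 x X)).mul_const
        (PhiL Φ L x' x)).const_mul (1 / 2))
  rw [h.fderiv]
  simp only [add_apply, sum_apply,
    smul_apply, ContinuousLinearMap.comp_apply, ContinuousLinearMap.proj_apply,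
    smul_eq_mul]
  congr 1
  · refine Finset.sum_congr rfl fun x _ => ?_
    simp
    try ring
  · refine Finset.sum_congr rfl fun x' _ => Finset.sum_congr rfl fun x _ => ?_
    ring

theorem PhiL_comm (hs : ∀ x, Φ (-x) = Φ x) (x y : ZMod L) : PhiL Φ L x y = PhiL Φ L y x := by
  have := phiL_neg hs (x - y)
  rw [neg_sub] at this
  exact this.symm

theorem fderiv_hamiltonian_drift (hs : ∀ x, Φ (-x) = Φ x) (X : Phase L) :
    fderiv ℝ (hamiltonian Φ L) X (drift Φ L X) = 0 := by
  rw [fderiv_hamiltonian]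
  simp only [drift, Matrix.cons_val_zero, Matrix.cons_val_one, Pi.neg_apply, Matrix.mulVec,
    dotProduct]
  have h1 : ∑ x', ∑ x, 1 / 2 * ((X 0 x' * X 1 x + X 1 x' * X 0 x) * PhiL Φ L x' x)
      = ∑ x', ∑ x, 1 / 2 * (X 0 x' * X 1 x * PhiL Φ L x' x)
        + ∑ x', ∑ x, 1 / 2 * (X 1 x' * X 0 x * PhiL Φ L x' x) := by
    simp only [← Finset.sum_add_distrib]
    exact Finset.sum_congr rfl fun x' _ => Finset.sum_congr rfl fun x _ => by ring
  rw [h1, Finset.sum_comm, ← Finset.sum_add_distrib, ← Finset.sum_add_distrib]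
  refine Finset.sum_eq_zero fun x _ => ?_
  rw [← Finset.sum_add_distrib, mul_neg, Finset.mul_sum, neg_add_eq_zero]
  refine Finset.sum_congr rfl fun y _ => ?_
  rw [PhiL_comm hs y x]
  ring

/-- The flow conserves the energy and the flips leave it unchanged, so functions of the energy pass
through the generator as multipliers. A cutoff in the energy therefore produces no error terms. -/
theorem generator_mul_comp_hamiltonian (hs : ∀ x, Φ (-x) = Φ x) {G : Phase L → ℝ} {ψ : ℝ → ℝ}
    (hG : ContDiff ℝ ∞ G) (hψ : ContDiff ℝ ∞ ψ) (X : Phase L) :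
    generator Φ γ L (fun X => G X * ψ (hamiltonian Φ L X)) X
      = ψ (hamiltonian Φ L X) * generator Φ γ L G X := by
  have hH := (contDiff_hamiltonian (Φ := Φ) (L := L)).differentiable (by simp) X
  have h : HasFDerivAt (fun X => G X * ψ (hamiltonian Φ L X)) _ X :=
    (hG.differentiable (by simp) X).hasFDerivAt.mul
      ((hψ.differentiable (by simp) (hamiltonian Φ L X)).hasDerivAt.comp_hasFDerivAt X
        hH.hasFDerivAt)
  rw [generator_eq, generator_eq, h.fderiv]
  simp only [add_apply, smul_apply,
    fderiv_hamiltonian_drift hs, smul_eq_mul, hamiltonian_flip, mul_zero, zero_add]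
  have : ∑ x₀, (G (flip x₀ X) * ψ (hamiltonian Φ L X) - G X * ψ (hamiltonian Φ L X))
      = ψ (hamiltonian Φ L X) * ∑ x₀, (G (flip x₀ X) - G X) := by
    rw [Finset.mul_sum]
    exact Finset.sum_congr rfl fun x _ => by ring
  rw [this]
  ring

theorem generator_hamiltonian (hs : ∀ x, Φ (-x) = Φ x) (X : Phase L) :
    generator Φ γ L (hamiltonian Φ L) X = 0 := by
  rw [generator_eq, fderiv_hamiltonian_drift hs]
  simp [hamiltonian_flip]

theorem continuous_drift : Continuous (drift Φ L) := by
  refine continuous_pi fun i => ?_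
  fin_cases i
  · exact continuous_apply 1
  · refine continuous_pi fun x => ?_
    simp only [drift, Fin.mk_one, Matrix.cons_val_one]
    fun_prop

theorem continuous_generator {F : Phase L → ℝ} (hF : ContDiff ℝ ∞ F) :
    Continuous (generator Φ γ L F) := by
  have h1 : Continuous fun X => fderiv ℝ F X (drift Φ L X) :=
    (hF.continuous_fderiv (by simp)).clm_apply continuous_drift
  have h2 : ∀ x₀, Continuous fun X => F (flip x₀ X) := fun x₀ =>
    hF.continuous.comp (continuous_flip x₀)
  rw [show generator Φ γ L F = fun X => _ from funext (generator_eq F)]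
  exact h1.add (continuous_const.mul (continuous_finsetSum _ fun x₀ _ =>
    (h2 x₀).sub hF.continuous))

theorem exists_generator_bound {F : Phase L → ℝ} (hF : ContDiff ℝ ∞ F) (hc : HasCompactSupport F) :
    ∃ B, ∀ X, |generator Φ γ L F X| ≤ B := by
  have h1 : Continuous fun X => fderiv ℝ F X (drift Φ L X) :=
    (hF.continuous_fderiv (by simp)).clm_apply continuous_drift
  have h2 : HasCompactSupport fun X => fderiv ℝ F X (drift Φ L X) := by
    refine HasCompactSupport.mono' (hc.fderiv ℝ) ?_
    intro X hX
    refine subset_tsupport _ fun h => hX ?_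
    simp only [h, zero_apply]
  obtain ⟨B₁, hB₁⟩ := h2.exists_bound_of_continuous h1
  obtain ⟨B₂, hB₂⟩ := hc.exists_bound_of_continuous hF.continuous
  refine ⟨B₁ + |γ / 2| * ∑ _x₀ : ZMod L, (B₂ + B₂), fun X => ?_⟩
  rw [generator_eq]
  refine (abs_add_le _ _).trans (add_le_add (hB₁ X) ?_)
  rw [abs_mul]
  refine mul_le_mul_of_nonneg_left ?_ (abs_nonneg _)
  exact (Finset.abs_sum_le_sum_abs _ _).trans (Finset.sum_le_sum fun x₀ _ =>
    (abs_sub _ _).trans (add_le_add (hB₂ _) (hB₂ _)))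

/-- A smooth cutoff: `1` on `(-∞, 1]` and `0` on `[2, ∞)`. -/
def cutoff (r : ℝ) : ℝ := Real.smoothTransition (2 - r)

theorem cutoff_nonneg (r : ℝ) : 0 ≤ cutoff r := Real.smoothTransition.nonneg _

theorem cutoff_le_one (r : ℝ) : cutoff r ≤ 1 := Real.smoothTransition.le_one _

theorem cutoff_eq_one {r : ℝ} (h : r ≤ 1) : cutoff r = 1 :=
  Real.smoothTransition.one_of_one_le (by linarith)

theorem cutoff_eq_zero {r : ℝ} (h : 2 ≤ r) : cutoff r = 0 :=
  Real.smoothTransition.zero_of_nonpos (by linarith)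

theorem contDiff_cutoff : ContDiff ℝ ∞ cutoff :=
  Real.smoothTransition.contDiff.comp (contDiff_const.sub contDiff_id)

theorem hasCompactSupport_mul_cutoff {μ : ℝ} (hμ : 0 < μ)
    (hH : ∀ (X : Phase L) i x, μ * X i x ^ 2 ≤ hamiltonian Φ L X) (G : Phase L → ℝ) {R : ℝ}
    (hR : 0 < R) : HasCompactSupport fun X => G X * cutoff (hamiltonian Φ L X / R) := by
  refine HasCompactSupport.intro (isCompact_closedBall (0 : Phase L) (√(2 * R / μ))) fun X hX => ?_
  rw [cutoff_eq_zero, mul_zero]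
  by_contra! h
  apply hX
  rw [mem_closedBall_zero_iff, pi_norm_le_iff_of_nonneg (Real.sqrt_nonneg _)]
  intro i
  rw [pi_norm_le_iff_of_nonneg (Real.sqrt_nonneg _)]
  intro x
  rw [Real.norm_eq_abs]
  refine Real.abs_le_sqrt ?_
  rw [le_div_iff₀ hμ]
  rw [div_lt_iff₀ hR] at h
  linarith [hH X i x]

end Generator

/-! ### Dynkin's formula -/

section Dynkin

variable {Φ : ℤ → ℝ} {γ : ℝ} {L : ℕ} [NeZero L] {S : Type*} [MeasurableSpace S]
  {P : Measure S} {X : ℝ≥0 → S → Phase L}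

theorem IsVelocityFlipProcess.measurable (h : IsVelocityFlipProcess Φ γ L P X) (t : ℝ≥0) :
    Measurable (X t) := by
  obtain ⟨ℱ, h1, -⟩ := h.martingale
  exact ((h1 t).mono (ℱ.le t)).measurable

theorem IsVelocityFlipProcess.measurable_comp_nat (h : IsVelocityFlipProcess Φ γ L P X)
    (σ : ℕ → ℝ≥0) {g : ℝ≥0 → ℕ} (hg : Measurable g) :
    Measurable fun p : ℝ≥0 × S => X (σ (g p.1)) p.2 := by
  have h1 : ∀ k, Measurable fun s => X (σ k) s := fun k => h.measurable (σ k)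
  have h2 : Measurable fun p : ℕ × S => X (σ p.1) p.2 := measurable_from_prod_countable_right h1
  exact h2.comp ((hg.comp measurable_fst).prodMk measurable_snd)

/-- By right continuity `X u` is the limit of `X` at the grid points `(⌊u(n+1)⌋ + 1)/(n+1)`, which
approach `u` from the right. -/
theorem IsVelocityFlipProcess.measurable_uncurry (h : IsVelocityFlipProcess Φ γ L P X) :
    Measurable fun p : ℝ≥0 × S => X p.1 p.2 := by
  have hg : ∀ n : ℕ, Measurable fun u : ℝ≥0 => ⌊u * (n + 1)⌋₊ := fun n =>
    (Nat.measurable_floor (R := ℝ≥0)).comp (measurable_id.mul_const ((n : ℝ≥0) + 1))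
  obtain ⟨σ, hσ⟩ : ∃ σ : ℕ → ℕ → ℝ≥0, ∀ n k, σ n k = ((k : ℝ≥0) + 1) / (n + 1) :=
    ⟨_, fun _ _ => rfl⟩
  have hσ1 : ∀ (n : ℕ) (u : ℝ≥0), u ≤ σ n ⌊u * (n + 1)⌋₊ := fun n u => by
    rw [hσ, le_div_iff₀ (by positivity)]
    exact (Nat.lt_floor_add_one _).le
  have hσ2 : ∀ (n : ℕ) (u : ℝ≥0), σ n ⌊u * (n + 1)⌋₊ ≤ u + 1 / (n + 1) := fun n u => by
    rw [hσ, div_le_iff₀ (by positivity), add_mul, div_mul_cancel₀ _ (by positivity)]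
    gcongr
    exact Nat.floor_le (by positivity)
  refine measurable_of_tendsto_metrizable
    (fun n => h.measurable_comp_nat (σ n) (hg n)) (tendsto_pi_nhds.2 ?_)
  rintro ⟨u, s⟩
  refine (h.right_cont s u).tendsto.comp (tendsto_nhdsWithin_iff.2 ⟨?_, ?_⟩)
  · refine tendsto_of_tendsto_of_tendsto_of_le_of_le tendsto_const_nhds ?_
      (fun n => hσ1 n u) (fun n => hσ2 n u)
    have : Tendsto (fun n : ℕ => (1 : ℝ≥0) / (n + 1)) atTop (𝓝 0) :=
      tendsto_one_div_add_atTop_nhds_zero_nat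
    simpa using this.const_add u
  · exact Eventually.of_forall fun n => hσ1 n u

variable [IsProbabilityMeasure P]

/-- The martingale starts at zero, so its mean vanishes. The generator of a compactly supported
function is bounded, which permits Fubini. -/
theorem IsVelocityFlipProcess.integral_eq (h : IsVelocityFlipProcess Φ γ L P X)
    {F : Phase L → ℝ} (hF : ContDiff ℝ ∞ F) (hc : HasCompactSupport F) (t : ℝ≥0) :
    ∫ s, F (X t s) ∂P = ∫ s, F (X 0 s) ∂P
      + ∫ u in (0 : ℝ)..t, ∫ s, generator Φ γ L F (X u.toNNReal s) ∂P := by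
  obtain ⟨B, hB⟩ := exists_generator_bound (Φ := Φ) (γ := γ) hF hc
  obtain ⟨B', hB'⟩ := hc.exists_bound_of_continuous hF.continuous
  obtain ⟨ℱ, -, hM⟩ := h.martingale
  specialize hM F hF hc
  have hFi : ∀ t, Integrable (fun s => F (X t s)) P := fun t =>
    Integrable.of_bound (hF.continuous.measurable.comp (h.measurable t)).aestronglyMeasurable B'
      (ae_of_all _ fun s => hB' _)
  have hm : Measurable fun p : ℝ × S => generator Φ γ L F (X p.1.toNNReal p.2) :=
    (continuous_generator hF).measurable.comp (h.measurable_uncurry.comp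
      ((measurable_real_toNNReal.comp measurable_fst).prodMk measurable_snd))
  have hint : Integrable (Function.uncurry fun (u : ℝ) (s : S) =>
      generator Φ γ L F (X u.toNNReal s)) ((volume.restrict (Set.uIoc 0 (t : ℝ))).prod P) := by
    have : IsFiniteMeasure ((volume : Measure ℝ).restrict (Set.uIoc 0 (t : ℝ))) := by
      rw [Set.uIoc_of_le t.coe_nonneg]; infer_instance
    exact Integrable.of_bound hm.aestronglyMeasurable B (ae_of_all _ fun p => hB _)
  have h0 := hM.setIntegral_eq (zero_le (a := t)) (s := Set.univ) MeasurableSet.univ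
  have hswap := intervalIntegral_integral_swap hint
  have hGi : Integrable (fun s => ∫ u in (0 : ℝ)..t, generator Φ γ L F (X u.toNNReal s)) P := by
    have := hint.swap.integral_prod_left
    simp only [intervalIntegral.integral_of_le t.coe_nonneg]
    rw [Set.uIoc_of_le t.coe_nonneg] at this
    exact this
  have h1 : ∫ s, (F (X t s) - F (X 0 s)
      - ∫ u in (0 : ℝ)..t, generator Φ γ L F (X u.toNNReal s)) ∂P
      = ∫ s, F (X t s) ∂P - ∫ s, F (X 0 s) ∂P
        - ∫ s, (∫ u in (0 : ℝ)..t, generator Φ γ L F (X u.toNNReal s)) ∂P := by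
    rw [← integral_sub (hFi t) (hFi 0)]
    exact integral_sub ((hFi t).sub (hFi 0)) hGi
  rw [setIntegral_univ, setIntegral_univ, h1] at h0
  simp at h0
  rw [hswap]
  linarith

end Dynkin

/-! ### The evolution of the second moments -/

section MomentRate

variable {Φ : ℤ → ℝ} {γ : ℝ} {L : ℕ} [NeZero L]

/-- The action of the generator on products of two coordinates. -/
def momentRate (Φ : ℤ → ℝ) (γ : ℝ) (L : ℕ) [NeZero L] (c : Fin 2 → Fin 2 → ZMod L → ZMod L → ℝ) :
    Fin 2 → Fin 2 → ZMod L → ZMod L → ℝ :=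
  ![![fun x y => c 1 0 x y + c 0 1 x y,
      fun x y => c 1 1 x y - ∑ z, PhiL Φ L y z * c 0 0 x z - γ * c 0 1 x y],
    ![fun x y => c 1 1 x y - ∑ z, PhiL Φ L x z * c 0 0 z y - γ * c 1 0 x y,
      fun x y => -(∑ z, PhiL Φ L x z * c 0 1 z y) - ∑ z, PhiL Φ L y z * c 1 0 x z
        - 2 * γ * (c 1 1 x y - if x = y then c 1 1 x x else 0)]]

theorem sum_flip_zero_one (X : Phase L) (x y : ZMod L) :
    ∑ x₀, (flip x₀ X 0 x * flip x₀ X 1 y - X 0 x * X 1 y) = -2 * (X 0 x * X 1 y) := by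
  have : ∀ x₀, flip x₀ X 0 x * flip x₀ X 1 y - X 0 x * X 1 y
      = if x₀ = y then -2 * (X 0 x * X 1 y) else 0 := by
    intro x₀
    by_cases h : x₀ = y
    · subst h; simp [flip]; ring
    · simp [flip, h, Ne.symm h]
  simp [this]

/-- Off the diagonal exactly two flips change the sign, each contributing `-2`; with the prefactor
`γ/2` this is damping at rate `2γ`. The diagonal `p_x²` is invariant, which is the origin of the
mean coupling in the fibers. -/
theorem sum_flip_one_one (X : Phase L) (x y : ZMod L) :
    ∑ x₀, (flip x₀ X 1 x * flip x₀ X 1 y - X 1 x * X 1 y)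
      = -4 * (X 1 x * X 1 y - if x = y then X 1 x * X 1 x else 0) := by
  by_cases hxy : x = y
  · subst hxy
    rw [if_pos rfl, sub_self, mul_zero]
    refine Finset.sum_eq_zero fun x₀ _ => ?_
    by_cases h : x = x₀ <;> simp [flip, h]
  · have : ∀ x₀, flip x₀ X 1 x * flip x₀ X 1 y - X 1 x * X 1 y
      = (if x₀ = x then -2 * (X 1 x * X 1 y) else 0)
        + (if x₀ = y then -2 * (X 1 x * X 1 y) else 0) := by
      intro x₀
      by_cases h : x₀ = x
      · subst h; simp [flip, Ne.symm hxy, hxy]; ring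
      · by_cases h' : x₀ = y
        · subst h'; simp [flip, hxy, h]; ring
        · simp [flip, h, h', Ne.symm h, Ne.symm h']
    simp [this, Finset.sum_add_distrib, hxy]
    ring

theorem generator_coord_mul (X : Phase L) (i j : Fin 2) (x y : ZMod L) :
    generator Φ γ L (fun X => X i x * X j y) X
      = momentRate Φ γ L (fun i j x y => X i x * X j y) i j x y := by
  rw [generator_eq, fderiv_coord_mul]
  have h0 : ∀ x, drift Φ L X 0 x = X 1 x := fun x => rfl
  have h1 : ∀ x, drift Φ L X 1 x = -∑ z, PhiL Φ L x z * X 0 z := fun x => rfl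
  have h2 := sum_flip_zero_one X y x
  fin_cases i <;> fin_cases j
  · simp [momentRate, h0, flip]
    ring
  · simp only [Fin.zero_eta, Fin.mk_one, sum_flip_zero_one, h0, h1, momentRate,
      Matrix.cons_val_zero, Matrix.cons_val_one]
    rw [mul_neg, Finset.mul_sum]
    simp only [mul_left_comm (X 0 x)]
    ring
  · simp only [Fin.zero_eta, Fin.mk_one, mul_comm (X 1 x), mul_comm (flip _ X 1 x), h2, h0, h1,
      momentRate, Matrix.cons_val_zero, Matrix.cons_val_one]
    rw [neg_mul, Finset.sum_mul]
    simp only [mul_assoc]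
    ring
  · simp only [Fin.mk_one, sum_flip_one_one, h1, momentRate, Matrix.cons_val_zero,
      Matrix.cons_val_one]
    rw [neg_mul, Finset.sum_mul, mul_neg, Finset.mul_sum]
    simp only [mul_assoc, mul_left_comm (X 1 x)]
    ring

/-- This serves only for domination and integrability, so the dependence of `K` on `L` is harmless.
-/
theorem exists_momentRate_bound (Φ : ℤ → ℝ) (γ : ℝ) (L : ℕ) [NeZero L] :
    ∃ K, 0 ≤ K ∧ ∀ (c : Fin 2 → Fin 2 → ZMod L → ZMod L → ℝ) (B : ℝ),
      (∀ i j x y, |c i j x y| ≤ B) → ∀ i j x y, |momentRate Φ γ L c i j x y| ≤ K * B := by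
  set A := ∑ x, ∑ z, |PhiL Φ L x z|
  have hA : 0 ≤ A := by positivity
  refine ⟨2 + 2 * A + 4 * |γ|, by positivity, fun c B hB i j x y => ?_⟩
  have hB0 : 0 ≤ B := (abs_nonneg _).trans (hB 0 0 0 0)
  have hsum : ∀ (x : ZMod L) (g : ZMod L → ℝ), (∀ z, |g z| ≤ B) →
      |∑ z, PhiL Φ L x z * g z| ≤ A * B := by
    intro x g hg
    have h1 : ∑ z, |PhiL Φ L x z| ≤ A := Finset.single_le_sum
      (f := fun x => ∑ z, |PhiL Φ L x z|) (fun _ _ => by positivity) (Finset.mem_univ x)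
    calc |∑ z, PhiL Φ L x z * g z| ≤ ∑ z, |PhiL Φ L x z| * B := by
          refine (Finset.abs_sum_le_sum_abs _ _).trans (Finset.sum_le_sum fun z _ => ?_)
          rw [abs_mul]
          exact mul_le_mul_of_nonneg_left (hg z) (abs_nonneg _)
      _ ≤ A * B := by
          rw [← Finset.sum_mul]
          exact mul_le_mul_of_nonneg_right h1 hB0
  have hγ : 0 ≤ |γ| * B := by positivity
  have hAB : 0 ≤ A * B := by positivity
  have hg : ∀ i j x y, |γ * c i j x y| ≤ |γ| * B := fun i j x y => by
    rw [abs_mul]; exact mul_le_mul_of_nonneg_left (hB i j x y) (abs_nonneg _)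
  have hd : |2 * γ * (c 1 1 x y - if x = y then c 1 1 x x else 0)| ≤ 4 * (|γ| * B) := by
    rw [abs_mul, abs_mul, abs_two]
    have : |c 1 1 x y - if x = y then c 1 1 x x else 0| ≤ 2 * B := by
      refine (abs_sub _ _).trans ?_
      split_ifs
      · linarith [hB 1 1 x y, hB 1 1 x x]
      · rw [abs_zero]; linarith [hB 1 1 x y]
    nlinarith [mul_le_mul_of_nonneg_left this (abs_nonneg γ)]
  fin_cases i <;> fin_cases j
  · show |c 1 0 x y + c 0 1 x y| ≤ _
    refine (abs_add_le _ _).trans ?_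
    nlinarith [hB 1 0 x y, hB 0 1 x y]
  · show |c 1 1 x y - ∑ z, PhiL Φ L y z * c 0 0 x z - γ * c 0 1 x y| ≤ _
    refine (abs_sub _ _).trans ((add_le_add_left (abs_sub _ _) _).trans ?_)
    nlinarith [hB 1 1 x y, hsum y (fun z => c 0 0 x z) fun z => hB 0 0 x z, hg 0 1 x y]
  · show |c 1 1 x y - ∑ z, PhiL Φ L x z * c 0 0 z y - γ * c 1 0 x y| ≤ _
    refine (abs_sub _ _).trans ((add_le_add_left (abs_sub _ _) _).trans ?_)
    nlinarith [hB 1 1 x y, hsum x (fun z => c 0 0 z y) fun z => hB 0 0 z y, hg 1 0 x y]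
  · show |-(∑ z, PhiL Φ L x z * c 0 1 z y) - ∑ z, PhiL Φ L y z * c 1 0 x z
        - 2 * γ * (c 1 1 x y - if x = y then c 1 1 x x else 0)| ≤ _
    refine (abs_sub _ _).trans ((add_le_add_left (abs_sub _ _) _).trans ?_)
    rw [abs_neg]
    nlinarith [hsum x (fun z => c 0 1 z y) fun z => hB 0 1 z y,
      hsum y (fun z => c 1 0 x z) fun z => hB 1 0 x z]

end MomentRate

section Moments

variable {Φ : ℤ → ℝ} {γ : ℝ} {L : ℕ} [NeZero L] {S : Type*} [MeasurableSpace S]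
  {P : Measure S} {X : ℝ≥0 → S → Phase L} {μ : ℝ}

theorem integral_momentRate {c : S → Fin 2 → Fin 2 → ZMod L → ZMod L → ℝ}
    (hc : ∀ i j x y, Integrable (fun s => c s i j x y) P) (i j : Fin 2) (x y : ZMod L) :
    ∫ s, momentRate Φ γ L (c s) i j x y ∂P
      = momentRate Φ γ L (fun i j x y => ∫ s, c s i j x y ∂P) i j x y := by
  have hsum : ∀ (x : ZMod L) (g : S → ZMod L → ℝ), (∀ z, Integrable (fun s => g s z) P) →
      Integrable (fun s => ∑ z, PhiL Φ L x z * g s z) P ∧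
      ∫ s, ∑ z, PhiL Φ L x z * g s z ∂P = ∑ z, PhiL Φ L x z * ∫ s, g s z ∂P := fun x g hg =>
    ⟨integrable_finsetSum _ fun z _ => (hg z).const_mul _, by
      rw [integral_finsetSum _ fun z _ => (hg z).const_mul _]
      simp only [integral_const_mul]⟩
  have hsub : ∀ {f g : S → ℝ}, Integrable f P → Integrable g P →
      Integrable (fun s => f s - g s) P := fun hf hg => hf.sub hg
  have h0 := fun y x => hsum y (fun s z => c s 0 0 x z) fun z => hc 0 0 x z
  have h1 := fun x y => hsum x (fun s z => c s 0 0 z y) fun z => hc 0 0 z y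
  have h2 := fun x y => hsum x (fun s z => c s 0 1 z y) fun z => hc 0 1 z y
  have h3 := fun y x => hsum y (fun s z => c s 1 0 x z) fun z => hc 1 0 x z
  fin_cases i <;> fin_cases j
  · exact integral_add (hc 1 0 x y) (hc 0 1 x y)
  · show ∫ s, (c s 1 1 x y - ∑ z, PhiL Φ L y z * c s 0 0 x z - γ * c s 0 1 x y) ∂P = _
    rw [integral_sub (hsub (hc 1 1 x y) (h0 y x).1) ((hc 0 1 x y).const_mul γ),
      integral_sub (hc 1 1 x y) (h0 y x).1, (h0 y x).2, integral_const_mul]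
    rfl
  · show ∫ s, (c s 1 1 x y - ∑ z, PhiL Φ L x z * c s 0 0 z y - γ * c s 1 0 x y) ∂P = _
    rw [integral_sub (hsub (hc 1 1 x y) (h1 x y).1) ((hc 1 0 x y).const_mul γ),
      integral_sub (hc 1 1 x y) (h1 x y).1, (h1 x y).2, integral_const_mul]
    rfl
  · show ∫ s, (-(∑ z, PhiL Φ L x z * c s 0 1 z y) - ∑ z, PhiL Φ L y z * c s 1 0 x z
        - 2 * γ * (c s 1 1 x y - if x = y then c s 1 1 x x else 0)) ∂P = _
    have h4 : Integrable (fun s => if x = y then c s 1 1 x x else 0) P := by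
      split_ifs
      · exact hc 1 1 x x
      · exact integrable_zero _ _ _
    have h5 : ∫ s, (if x = y then c s 1 1 x x else 0) ∂P
        = if x = y then ∫ s, c s 1 1 x x ∂P else 0 := by
      split_ifs <;> simp
    have hn : Integrable (fun s => -(∑ z, PhiL Φ L x z * c s 0 1 z y)) P := (h2 x y).1.neg
    rw [integral_sub (hsub hn (h3 y x).1) ((hsub (hc 1 1 x y) h4).const_mul _),
      integral_sub hn (h3 y x).1, integral_neg, integral_const_mul,
      integral_sub (hc 1 1 x y) h4, (h2 x y).2, (h3 y x).2, h5]
    rfl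

end Moments

/-! ### Energy bound and the moment equations -/

section Evolution

variable {Φ : ℤ → ℝ} {γ : ℝ} {L : ℕ} [NeZero L] {S : Type*} [MeasurableSpace S]
  {P : Measure S} [IsProbabilityMeasure P] {X : ℝ≥0 → S → Phase L} {μ : ℝ}

theorem IsVelocityFlipProcess.integral_truncated_eq (h : IsVelocityFlipProcess Φ γ L P X)
    (hs : ∀ x, Φ (-x) = Φ x) (hμ : 0 < μ)
    (hH : ∀ (X : Phase L) i x, μ * X i x ^ 2 ≤ hamiltonian Φ L X) {G : Phase L → ℝ}
    (hG : ContDiff ℝ ∞ G) {R : ℝ} (hR : 0 < R) (t : ℝ≥0) :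
    ∫ s, G (X t s) * cutoff (hamiltonian Φ L (X t s) / R) ∂P
      = ∫ s, G (X 0 s) * cutoff (hamiltonian Φ L (X 0 s) / R) ∂P
        + ∫ u in (0 : ℝ)..t, ∫ s, cutoff (hamiltonian Φ L (X u.toNNReal s) / R)
          * generator Φ γ L G (X u.toNNReal s) ∂P := by
  have hψ : ContDiff ℝ ∞ fun r => cutoff (r / R) := contDiff_cutoff.comp (contDiff_id.div_const R)
  have := h.integral_eq (F := fun X => G X * cutoff (hamiltonian Φ L X / R))
    (hG.mul (hψ.comp contDiff_hamiltonian)) (hasCompactSupport_mul_cutoff hμ hH G hR) t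
  simp only [generator_mul_comp_hamiltonian hs hG hψ] at this
  exact this

theorem hamiltonian_nonneg (hμ : 0 < μ)
    (hH : ∀ (X : Phase L) i x, μ * X i x ^ 2 ≤ hamiltonian Φ L X) (X : Phase L) :
    0 ≤ hamiltonian Φ L X :=
  le_trans (by positivity) (hH X 0 0)

theorem abs_coord_mul_le (hμ : 0 < μ)
    (hH : ∀ (X : Phase L) i x, μ * X i x ^ 2 ≤ hamiltonian Φ L X) (X : Phase L) (i j : Fin 2)
    (x y : ZMod L) : |X i x * X j y| ≤ μ⁻¹ * hamiltonian Φ L X := by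
  rw [le_inv_mul_iff₀ hμ, abs_mul]
  have h1 := hH X i x
  have h2 := hH X j y
  rw [← sq_abs] at h1 h2
  nlinarith [mul_nonneg hμ.le (sq_nonneg (|X i x| - |X j y|))]

theorem tendsto_cutoff (r : ℝ) :
    Tendsto (fun n : ℕ => cutoff (r / (n + 1))) atTop (𝓝 1) := by
  refine tendsto_const_nhds.congr' ?_
  filter_upwards [eventually_ge_atTop ⌈r⌉₊] with n hn
  refine (cutoff_eq_one ?_).symm
  rw [div_le_one (by positivity)]
  exact (Nat.ceil_le.1 hn).trans (by linarith)

/-- The truncated energy has constant expectation, bounded by the initial energy. Fatou's lemma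
removes the truncation without prior integrability at positive times. -/
theorem IsVelocityFlipProcess.energy_bound (h : IsVelocityFlipProcess Φ γ L P X)
    (hs : ∀ x, Φ (-x) = Φ x) (hμ : 0 < μ)
    (hH : ∀ (X : Phase L) i x, μ * X i x ^ 2 ≤ hamiltonian Φ L X)
    (hI : Integrable (fun s => hamiltonian Φ L (X 0 s)) P) (t : ℝ≥0) :
    Integrable (fun s => hamiltonian Φ L (X t s)) P ∧
      ∫ s, hamiltonian Φ L (X t s) ∂P ≤ ∫ s, hamiltonian Φ L (X 0 s) ∂P := by
  set E := ∫ s, hamiltonian Φ L (X 0 s) ∂P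
  have hE : 0 ≤ E := integral_nonneg fun s => hamiltonian_nonneg hμ hH _
  have hn : ∀ n : ℕ, (0 : ℝ) < n + 1 := fun n => by positivity
  set f : ℕ → Phase L → ℝ := fun n Y => hamiltonian Φ L Y * cutoff (hamiltonian Φ L Y / (n + 1))
  have hf0 : ∀ n Y, 0 ≤ f n Y := fun n Y =>
    mul_nonneg (hamiltonian_nonneg hμ hH _) (cutoff_nonneg _)
  have hfc : ∀ n, Continuous (f n) := fun n =>
    contDiff_hamiltonian.continuous.mul (contDiff_cutoff.continuous.comp
      (contDiff_hamiltonian.continuous.div_const _))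
  have hfm : ∀ n t, Measurable fun s => f n (X t s) := fun n t =>
    (hfc n).measurable.comp (h.measurable t)
  have hfi : ∀ n t, Integrable (fun s => f n (X t s)) P := fun n t => by
    obtain ⟨B, hB⟩ := (hasCompactSupport_mul_cutoff hμ hH (hamiltonian Φ L)
      (hn n)).exists_bound_of_continuous (hfc n)
    exact Integrable.of_bound (hfm n t).aestronglyMeasurable B (ae_of_all _ fun s => hB _)
  have h1 : ∀ n, ∫ s, f n (X t s) ∂P ≤ E := fun n => by
    have := h.integral_truncated_eq hs hμ hH (contDiff_hamiltonian (Φ := Φ)) (hn n) t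
    simp only [generator_hamiltonian hs, mul_zero, integral_zero,
      intervalIntegral.integral_zero, add_zero] at this
    refine this.le.trans (integral_mono (hfi n 0) hI fun s => ?_)
    exact mul_le_of_le_one_right (hamiltonian_nonneg hμ hH _) (cutoff_le_one _)
  have hHm : Measurable fun s => hamiltonian Φ L (X t s) :=
    contDiff_hamiltonian.continuous.measurable.comp (h.measurable t)
  have h2 : ∫⁻ s, ENNReal.ofReal (hamiltonian Φ L (X t s)) ∂P ≤ ENNReal.ofReal E := by
    have h3 : ∀ s, ENNReal.ofReal (hamiltonian Φ L (X t s))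
        = liminf (fun n => ENNReal.ofReal (f n (X t s))) atTop := fun s => by
      refine (Tendsto.liminf_eq ?_).symm
      refine (ENNReal.continuous_ofReal.tendsto _).comp ?_
      simpa using (tendsto_cutoff (hamiltonian Φ L (X t s))).const_mul (hamiltonian Φ L (X t s))
    simp only [h3]
    refine (lintegral_liminf_le fun n => (hfm n t).ennreal_ofReal).trans ?_
    refine liminf_le_of_le (by isBoundedDefault) fun b hb => ?_
    obtain ⟨n, hn⟩ := hb.exists
    refine hn.trans ?_
    rw [← ofReal_integral_eq_lintegral_ofReal (hfi n t) (ae_of_all _ fun s => hf0 _ _)]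
    exact ENNReal.ofReal_le_ofReal (h1 n)
  have h0 : 0 ≤ᵐ[P] fun s => hamiltonian Φ L (X t s) :=
    ae_of_all _ fun s => hamiltonian_nonneg hμ hH _
  refine ⟨⟨hHm.aestronglyMeasurable, ?_⟩, ?_⟩
  · rw [hasFiniteIntegral_iff_ofReal h0]
    exact h2.trans_lt ENNReal.ofReal_lt_top
  · rw [integral_eq_lintegral_of_nonneg_ae h0 hHm.aestronglyMeasurable]
    exact ENNReal.toReal_le_of_le_ofReal hE h2

theorem IsVelocityFlipProcess.integrable_coord_mul (h : IsVelocityFlipProcess Φ γ L P X)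
    (hs : ∀ x, Φ (-x) = Φ x) (hμ : 0 < μ)
    (hH : ∀ (X : Phase L) i x, μ * X i x ^ 2 ≤ hamiltonian Φ L X)
    (hI : Integrable (fun s => hamiltonian Φ L (X 0 s)) P) (t : ℝ≥0) (i j : Fin 2)
    (x y : ZMod L) : Integrable (fun s => X t s i x * X t s j y) P := by
  refine ((h.energy_bound hs hμ hH hI t).1.const_mul μ⁻¹).mono' ?_
    (ae_of_all _ fun s => abs_coord_mul_le hμ hH _ i j x y)
  exact (((contDiff_coord i x).mul (contDiff_coord j y)).continuous.measurable.comp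
    (h.measurable t)).aestronglyMeasurable

theorem IsVelocityFlipProcess.abs_corr_le (h : IsVelocityFlipProcess Φ γ L P X)
    (hs : ∀ x, Φ (-x) = Φ x) (hμ : 0 < μ)
    (hH : ∀ (X : Phase L) i x, μ * X i x ^ 2 ≤ hamiltonian Φ L X)
    (hI : Integrable (fun s => hamiltonian Φ L (X 0 s)) P) (t : ℝ≥0) (i j : Fin 2)
    (x y : ZMod L) : |corr P X t i j x y| ≤ μ⁻¹ * ∫ s, hamiltonian Φ L (X 0 s) ∂P := by
  have h1 := h.energy_bound hs hμ hH hI t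
  calc |corr P X t i j x y| ≤ ∫ s, |X t s i x * X t s j y| ∂P := abs_integral_le_integral_abs
    _ ≤ ∫ s, μ⁻¹ * hamiltonian Φ L (X t s) ∂P :=
        integral_mono (h.integrable_coord_mul hs hμ hH hI t i j x y).abs (h1.1.const_mul _)
          fun s => abs_coord_mul_le hμ hH _ i j x y
    _ ≤ _ := by
        rw [integral_const_mul]
        exact mul_le_mul_of_nonneg_left h1.2 (by positivity)

theorem IsVelocityFlipProcess.measurable_momentRate_corr (h : IsVelocityFlipProcess Φ γ L P X)
    (hs : ∀ x, Φ (-x) = Φ x) (hμ : 0 < μ)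
    (hH : ∀ (X : Phase L) i x, μ * X i x ^ 2 ≤ hamiltonian Φ L X)
    (hI : Integrable (fun s => hamiltonian Φ L (X 0 s)) P) (i j : Fin 2) (x y : ZMod L) :
    (∀ u : ℝ, ∫ s, generator Φ γ L (fun X => X i x * X j y) (X u.toNNReal s) ∂P
      = momentRate Φ γ L (corr P X u.toNNReal) i j x y) ∧
    StronglyMeasurable fun u : ℝ => momentRate Φ γ L (corr P X u.toNNReal) i j x y := by
  have h1 : ∀ u : ℝ, ∫ s, generator Φ γ L (fun X => X i x * X j y) (X u.toNNReal s) ∂P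
      = momentRate Φ γ L (corr P X u.toNNReal) i j x y := fun u => by
    simp only [generator_coord_mul]
    exact integral_momentRate (fun i j x y => h.integrable_coord_mul hs hμ hH hI _ i j x y) i j x y
  refine ⟨h1, ?_⟩
  simp only [← h1]
  have hm : Measurable fun p : ℝ × S =>
      generator Φ γ L (fun X => X i x * X j y) (X p.1.toNNReal p.2) :=
    (continuous_generator ((contDiff_coord i x).mul (contDiff_coord j y))).measurable.comp
      (h.measurable_uncurry.comp
        ((measurable_real_toNNReal.comp measurable_fst).prodMk measurable_snd))
  exact hm.stronglyMeasurable.integral_prod_right'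

/-- With a cutoff in the energy this is Dynkin's formula. The products of coordinates and their
generator are dominated by multiples of the energy, whose mean is bounded in time, so dominated
convergence removes the cutoff. -/
theorem IsVelocityFlipProcess.corr_eq (h : IsVelocityFlipProcess Φ γ L P X)
    (hs : ∀ x, Φ (-x) = Φ x) (hμ : 0 < μ)
    (hH : ∀ (X : Phase L) i x, μ * X i x ^ 2 ≤ hamiltonian Φ L X)
    (hI : Integrable (fun s => hamiltonian Φ L (X 0 s)) P) (t : ℝ≥0) (i j : Fin 2)
    (x y : ZMod L) : corr P X t i j x y = corr P X 0 i j x y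
      + ∫ u in (0 : ℝ)..t, momentRate Φ γ L (corr P X u.toNNReal) i j x y := by
  set G : Phase L → ℝ := fun X => X i x * X j y
  have hG : ContDiff ℝ ∞ G := (contDiff_coord i x).mul (contDiff_coord j y)
  have hcut : ∀ (n : ℕ), Continuous fun Y : Phase L => cutoff (hamiltonian Φ L Y / (n + 1)) :=
    fun n => contDiff_cutoff.continuous.comp (contDiff_hamiltonian.continuous.div_const _)
  have habs : ∀ r, |cutoff r| ≤ 1 := fun r => by
    rw [abs_of_nonneg (cutoff_nonneg r)]; exact cutoff_le_one r
  have h1 : ∀ t, Tendsto (fun n : ℕ => ∫ s, G (X t s)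
      * cutoff (hamiltonian Φ L (X t s) / (n + 1)) ∂P) atTop (𝓝 (corr P X t i j x y)) := by
    intro t
    refine tendsto_integral_of_dominated_convergence (fun s => |X t s i x * X t s j y|) ?_
      (h.integrable_coord_mul hs hμ hH hI t i j x y).abs ?_ ?_
    · exact fun n => ((hG.continuous.mul (hcut n)).measurable.comp
        (h.measurable t)).aestronglyMeasurable
    · refine fun n => ae_of_all _ fun s => ?_
      rw [Real.norm_eq_abs, abs_mul]
      exact mul_le_of_le_one_right (abs_nonneg _) (habs _)
    · refine ae_of_all _ fun s => ?_
      simpa using (tendsto_cutoff (hamiltonian Φ L (X t s))).const_mul (G (X t s))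
  obtain ⟨K, hK, hKb⟩ := exists_momentRate_bound Φ γ L
  set E := ∫ s, hamiltonian Φ L (X 0 s) ∂P
  have hb : ∀ Y : Phase L, |generator Φ γ L G Y| ≤ K * (μ⁻¹ * hamiltonian Φ L Y) := fun Y => by
    rw [generator_coord_mul]
    exact hKb _ _ (fun i j x y => abs_coord_mul_le hμ hH Y i j x y) i j x y
  have hint : ∀ t, Integrable (fun s => K * (μ⁻¹ * hamiltonian Φ L (X t s))) P := fun t =>
    ((h.energy_bound hs hμ hH hI t).1.const_mul _).const_mul _
  have hbn : ∀ (n : ℕ) (Y : Phase L), ‖cutoff (hamiltonian Φ L Y / (n + 1))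
      * generator Φ γ L G Y‖ ≤ K * (μ⁻¹ * hamiltonian Φ L Y) := fun n Y => by
    rw [Real.norm_eq_abs, abs_mul]
    exact (mul_le_of_le_one_left (abs_nonneg _) (habs _)).trans (hb Y)
  obtain ⟨hrate, -⟩ := h.measurable_momentRate_corr hs hμ hH hI i j x y
  have h2 : ∀ u : ℝ, Tendsto (fun n : ℕ => ∫ s, cutoff (hamiltonian Φ L (X u.toNNReal s) / (n + 1))
      * generator Φ γ L G (X u.toNNReal s) ∂P) atTop
      (𝓝 (momentRate Φ γ L (corr P X u.toNNReal) i j x y)) := by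
    intro u
    rw [← hrate u]
    refine tendsto_integral_of_dominated_convergence
      (fun s => K * (μ⁻¹ * hamiltonian Φ L (X u.toNNReal s))) ?_ (hint _) ?_ ?_
    · exact fun n => (((hcut n).mul (continuous_generator hG)).measurable.comp
        (h.measurable _)).aestronglyMeasurable
    · exact fun n => ae_of_all _ fun s => hbn n _
    · refine ae_of_all _ fun s => ?_
      simpa using (tendsto_cutoff (hamiltonian Φ L (X u.toNNReal s))).mul_const
        (generator Φ γ L G (X u.toNNReal s))
  have h3 : Tendsto (fun n : ℕ => ∫ u in (0 : ℝ)..t, ∫ s,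
      cutoff (hamiltonian Φ L (X u.toNNReal s) / (n + 1)) * generator Φ γ L G (X u.toNNReal s) ∂P)
      atTop (𝓝 (∫ u in (0 : ℝ)..t, momentRate Φ γ L (corr P X u.toNNReal) i j x y)) := by
    refine intervalIntegral.tendsto_integral_filter_of_dominated_convergence
      (fun _ => K * (μ⁻¹ * E)) ?_ ?_ intervalIntegrable_const ?_
    · refine Eventually.of_forall fun n => ?_
      have hm : Measurable fun p : ℝ × S =>
          cutoff (hamiltonian Φ L (X p.1.toNNReal p.2) / (n + 1))
            * generator Φ γ L G (X p.1.toNNReal p.2) :=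
        ((hcut n).mul (continuous_generator hG)).measurable.comp
          (h.measurable_uncurry.comp
            ((measurable_real_toNNReal.comp measurable_fst).prodMk measurable_snd))
      exact hm.stronglyMeasurable.integral_prod_right'.aestronglyMeasurable
    · refine Eventually.of_forall fun n => ae_of_all _ fun u _ => ?_
      refine (norm_integral_le_of_norm_le (hint _) (ae_of_all _ fun s => hbn n _)).trans ?_
      rw [integral_const_mul, integral_const_mul]
      have := (h.energy_bound hs hμ hH hI u.toNNReal).2
      gcongr
    · exact ae_of_all _ fun u _ => h2 u
  refine tendsto_nhds_unique (h1 t) (((h1 0).add h3).congr fun n => ?_)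
  exact (h.integral_truncated_eq hs hμ hH hG (by positivity) t).symm

/-- The second moments as differentiable functions of `t : ℝ`; the values at negative times are
irrelevant. -/
def corrExt (Φ : ℤ → ℝ) (γ : ℝ) (P : Measure S) (X : ℝ≥0 → S → Phase L) (t : ℝ) (i j : Fin 2)
    (x y : ZMod L) : ℝ :=
  corr P X 0 i j x y + ∫ u in (0 : ℝ)..t, momentRate Φ γ L (corr P X u.toNNReal) i j x y

theorem IsVelocityFlipProcess.corrExt_eq (h : IsVelocityFlipProcess Φ γ L P X)
    (hs : ∀ x, Φ (-x) = Φ x) (hμ : 0 < μ)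
    (hH : ∀ (X : Phase L) i x, μ * X i x ^ 2 ≤ hamiltonian Φ L X)
    (hI : Integrable (fun s => hamiltonian Φ L (X 0 s)) P) (t : ℝ≥0) :
    corrExt Φ γ P X t = corr P X t := by
  ext i j x y
  rw [h.corr_eq hs hμ hH hI t, corrExt]

theorem continuous_momentRate {c : ℝ → Fin 2 → Fin 2 → ZMod L → ZMod L → ℝ}
    (hc : ∀ i j x y, Continuous fun t => c t i j x y) (i j : Fin 2) (x y : ZMod L) :
    Continuous fun t => momentRate Φ γ L (c t) i j x y := by
  fin_cases i <;> fin_cases j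
  · exact (hc 1 0 x y).add (hc 0 1 x y)
  · exact ((hc 1 1 x y).sub (continuous_finsetSum _ fun z _ => continuous_const.mul
      (hc 0 0 x z))).sub (continuous_const.mul (hc 0 1 x y))
  · exact ((hc 1 1 x y).sub (continuous_finsetSum _ fun z _ => continuous_const.mul
      (hc 0 0 z y))).sub (continuous_const.mul (hc 1 0 x y))
  · refine ((continuous_finsetSum _ fun z _ => continuous_const.mul (hc 0 1 z y)).neg.sub
      (continuous_finsetSum _ fun z _ => continuous_const.mul (hc 1 0 x z))).sub
      (continuous_const.mul ((hc 1 1 x y).sub ?_))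
    split_ifs
    · exact hc 1 1 x x
    · exact continuous_const

/-- Bootstrap: bounded measurable rates make the moments continuous, so the rates are continuous, so
the moments are differentiable. At negative times `toNNReal` freezes the rate at its initial value,
hence the derivative at `0` is two-sided. -/
theorem IsVelocityFlipProcess.hasDerivAt_corrExt (h : IsVelocityFlipProcess Φ γ L P X)
    (hs : ∀ x, Φ (-x) = Φ x) (hμ : 0 < μ)
    (hH : ∀ (X : Phase L) i x, μ * X i x ^ 2 ≤ hamiltonian Φ L X)
    (hI : Integrable (fun s => hamiltonian Φ L (X 0 s)) P) {t : ℝ} (ht : 0 ≤ t) (i j : Fin 2)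
    (x y : ZMod L) : HasDerivAt (fun t => corrExt Φ γ P X t i j x y)
      (momentRate Φ γ L (corrExt Φ γ P X t) i j x y) t := by
  obtain ⟨K, hK, hKb⟩ := exists_momentRate_bound Φ γ L
  have hint : ∀ i j x y a b, IntervalIntegrable
      (fun u : ℝ => momentRate Φ γ L (corr P X u.toNNReal) i j x y) volume a b := by
    intro i j x y a b
    refine (intervalIntegrable_const (c := K * (μ⁻¹ * ∫ s, hamiltonian Φ L (X 0 s) ∂P))).mono_fun'
      (h.measurable_momentRate_corr hs hμ hH hI i j x y).2.aestronglyMeasurable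
      (ae_of_all _ fun u => ?_)
    exact hKb _ _ (fun i j x y => h.abs_corr_le hs hμ hH hI _ i j x y) i j x y
  have hcont : ∀ i j x y, Continuous fun t => corrExt Φ γ P X t i j x y := fun i j x y =>
    continuous_const.add (intervalIntegral.continuous_primitive (hint i j x y) 0)
  have hcorr : ∀ u : ℝ, corr P X u.toNNReal = corrExt Φ γ P X (u.toNNReal : ℝ) := fun u =>
    (h.corrExt_eq hs hμ hH hI _).symm
  have hc : Continuous fun u : ℝ => momentRate Φ γ L (corr P X u.toNNReal) i j x y := by
    simp only [hcorr]
    exact continuous_momentRate (fun i j x y => (hcont i j x y).comp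
      (NNReal.continuous_coe.comp continuous_real_toNNReal)) i j x y
  have h1 := (hc.integral_hasStrictDerivAt 0 t).hasDerivAt.const_add (corr P X 0 i j x y)
  rw [hcorr t, Real.coe_toNNReal t ht] at h1
  exact h1

end Evolution

/-! ### Fourier fibers of the second moments -/

section FourierFibers

variable {Φ : ℤ → ℝ} {γ : ℝ} {L : ℕ} [NeZero L]

/-- The Fourier transform of a real kernel in both variables. -/
def fourierKer (g : ZMod L → ZMod L → ℝ) (a b : ZMod L) : ℂ :=
  ∑ x, chi (-(a * x)) * ∑ y, chi (-(b * y)) * (g x y : ℂ)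

/-- The Fourier transform of a real function. -/
def fourierFun (g : ZMod L → ℝ) (a : ZMod L) : ℂ := ∑ x, chi (-(a * x)) * (g x : ℂ)

theorem fourierKer_add (g h : ZMod L → ZMod L → ℝ) (a b : ZMod L) :
    fourierKer (fun x y => g x y + h x y) a b = fourierKer g a b + fourierKer h a b := by
  simp only [fourierKer, Complex.ofReal_add, mul_add, Finset.sum_add_distrib]

theorem fourierKer_const_mul (r : ℝ) (g : ZMod L → ZMod L → ℝ) (a b : ZMod L) :
    fourierKer (fun x y => r * g x y) a b = r * fourierKer g a b := by
  simp only [fourierKer, Complex.ofReal_mul, Finset.mul_sum]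
  exact Finset.sum_congr rfl fun x _ => Finset.sum_congr rfl fun y _ => by ring

theorem fourierKer_neg (g : ZMod L → ZMod L → ℝ) (a b : ZMod L) :
    fourierKer (fun x y => -g x y) a b = -fourierKer g a b := by
  simp only [fourierKer, Complex.ofReal_neg, mul_neg, Finset.sum_neg_distrib]

theorem fourierKer_sub (g h : ZMod L → ZMod L → ℝ) (a b : ZMod L) :
    fourierKer (fun x y => g x y - h x y) a b = fourierKer g a b - fourierKer h a b := by
  simp only [fourierKer, Complex.ofReal_sub, mul_sub, Finset.sum_sub_distrib]

theorem fourierKer_swap (g : ZMod L → ZMod L → ℝ) (a b : ZMod L) :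
    fourierKer g a b = fourierKer (fun y x => g x y) b a := by
  simp only [fourierKer, Finset.mul_sum]
  rw [Finset.sum_comm]
  exact Finset.sum_congr rfl fun y _ => Finset.sum_congr rfl fun x _ => by ring

theorem fourierKer_conv_right (hs : ∀ x, Φ (-x) = Φ x) (g : ZMod L → ZMod L → ℝ) (a b : ZMod L) :
    fourierKer (fun x y => ∑ z, PhiL Φ L y z * g x z) a b = phiHatL Φ b * fourierKer g a b := by
  rw [fourierKer, fourierKer, Finset.mul_sum]
  refine Finset.sum_congr rfl fun x _ => ?_
  have := sum_chi_convolution hs b fun z => (g x z : ℂ)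
  rw [mul_left_comm, ← this]
  simp only [Complex.ofReal_sum, Complex.ofReal_mul]
  rfl

theorem fourierKer_conv_left (hs : ∀ x, Φ (-x) = Φ x) (g : ZMod L → ZMod L → ℝ) (a b : ZMod L) :
    fourierKer (fun x y => ∑ z, PhiL Φ L x z * g z y) a b = phiHatL Φ a * fourierKer g a b := by
  rw [fourierKer_swap, fourierKer_conv_right hs fun y z => g z y, fourierKer_swap g]

/-- The transform of a diagonal kernel depends only on `a + b`, so the noise does not mix total
frequencies. -/
theorem fourierKer_diag (g : ZMod L → ℝ) (a b : ZMod L) :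
    fourierKer (fun x y => if x = y then g x else 0) a b = fourierFun g (a + b) := by
  refine Finset.sum_congr rfl fun x _ => ?_
  rw [Finset.sum_eq_single x]
  · dsimp only
    rw [if_pos rfl, ← mul_assoc, ← chi_add]
    congr 2
    ring
  · intro y _ hy
    dsimp only
    rw [if_neg hy.symm, Complex.ofReal_zero, mul_zero]
  · exact fun h => absurd (Finset.mem_univ x) h

/-- Restriction to the diagonal becomes averaging over the fiber; this identifies `avg s` with the
temperature mode. -/
theorem sum_fourierKer (g : ZMod L → ZMod L → ℝ) (ξ : ZMod L) :
    ∑ κ, fourierKer g (ξ - κ) κ = L * fourierFun (fun x => g x x) ξ := by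
  simp only [fourierKer, Finset.mul_sum]
  rw [Finset.sum_comm, fourierFun, Finset.mul_sum]
  refine Finset.sum_congr rfl fun x _ => ?_
  rw [Finset.sum_comm]
  have h1 : ∀ y, ∑ κ, chi (-((ξ - κ) * x)) * (chi (-(κ * y)) * (g x y : ℂ))
      = chi (-(ξ * x)) * (g x y : ℂ) * if x - y = 0 then (L : ℂ) else 0 := by
    intro y
    rw [← sum_chi_mul, Finset.mul_sum]
    refine Finset.sum_congr rfl fun κ _ => ?_
    have : chi (-((ξ - κ) * x)) * chi (-(κ * y)) = chi (-(ξ * x)) * chi (κ * (x - y)) := by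
      rw [← chi_add, ← chi_add]
      congr 1
      ring
    linear_combination (g x y : ℂ) * this
  simp only [h1]
  rw [Finset.sum_eq_single x]
  · rw [sub_self, if_pos rfl]
    ring
  · intro y _ hy
    rw [if_neg (sub_ne_zero.2 hy.symm), mul_zero]
  · exact fun h => absurd (Finset.mem_univ x) h

theorem norm_fourierKer_le {g : ZMod L → ZMod L → ℝ} {B : ℝ} (hB : ∀ x y, |g x y| ≤ B)
    (a b : ZMod L) : ‖fourierKer g a b‖ ≤ (L : ℝ) ^ 2 * B := by
  have h1 : ∀ x, ‖chi (-(a * x)) * ∑ y, chi (-(b * y)) * (g x y : ℂ)‖ ≤ L * B := by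
    intro x
    rw [norm_mul, norm_chi, one_mul]
    refine (norm_sum_le _ _).trans ((Finset.sum_le_card_nsmul _ _ B fun y _ => ?_).trans ?_)
    · rw [norm_mul, norm_chi, one_mul, Complex.norm_real]
      exact hB x y
    · rw [Finset.card_univ, ZMod.card, nsmul_eq_mul]
  refine (norm_sum_le _ _).trans ((Finset.sum_le_card_nsmul _ _ _ fun x _ => h1 x).trans ?_)
  rw [Finset.card_univ, ZMod.card, nsmul_eq_mul]
  exact le_of_eq (by ring)

theorem norm_fourierFun_le (g : ZMod L → ℝ) (a : ZMod L) : ‖fourierFun g a‖ ≤ ∑ x, |g x| := by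
  refine (norm_sum_le _ _).trans (Finset.sum_le_sum fun x _ => ?_)
  rw [norm_mul, norm_chi, one_mul, Complex.norm_real, Real.norm_eq_abs]

theorem hasDerivAt_fourierKer {g : ℝ → ZMod L → ZMod L → ℝ} {g' : ZMod L → ZMod L → ℝ} {t : ℝ}
    (h : ∀ x y, HasDerivAt (fun t => g t x y) (g' x y) t) (a b : ZMod L) :
    HasDerivAt (fun t => fourierKer (g t) a b) (fourierKer g' a b) t :=
  HasDerivAt.fun_sum fun x _ => (HasDerivAt.fun_sum fun y _ =>
    ((h x y).ofReal_comp).const_mul (chi (-(b * y)))).const_mul (chi (-(a * x)))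

/-- Real-linear functionals of the Fourier fibers of a solution of the moment equations solve the
fiber dynamics. -/
theorem fiberSol_fourierKer (hs : ∀ x, Φ (-x) = Φ x)
    {c : ℝ → Fin 2 → Fin 2 → ZMod L → ZMod L → ℝ}
    (hc : ∀ t, 0 ≤ t → ∀ i j x y,
      HasDerivAt (fun t => c t i j x y) (momentRate Φ γ L (c t) i j x y) t)
    (l : ℂ →L[ℝ] ℝ) (ξ : ZMod L) :
    FiberSol γ (fun κ => phiHatL Φ (κ - ξ)) (fun κ => phiHatL Φ κ)
      (fun t κ => l (fourierKer (c t 0 0) (ξ - κ) κ)) (fun t κ => l (fourierKer (c t 0 1) (ξ - κ) κ))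
      (fun t κ => l (fourierKer (c t 1 0) (ξ - κ) κ))
      (fun t κ => l (fourierKer (c t 1 1) (ξ - κ) κ)) ∧
    ∀ t, avg (fun κ => l (fourierKer (c t 1 1) (ξ - κ) κ))
      = l (fourierFun (fun x => c t 1 1 x x) ξ) := by
  have hl : ∀ (r : ℝ) (z : ℂ), l (r * z) = r * l z := fun r z => by
    rw [← Complex.real_smul, map_smul, smul_eq_mul]
  have havg : ∀ t, avg (fun κ => l (fourierKer (c t 1 1) (ξ - κ) κ))
      = l (fourierFun (fun x => c t 1 1 x x) ξ) := by
    intro t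
    have hL : (L : ℝ) ≠ 0 := Nat.cast_ne_zero.2 (NeZero.ne L)
    rw [avg, ZMod.card, ← map_sum, sum_fourierKer]
    have := hl L (fourierFun (fun x => c t 1 1 x x) ξ)
    rw [Complex.ofReal_natCast] at this
    rw [this, inv_mul_cancel_left₀ hL]
  have hd : ∀ t, 0 ≤ t → ∀ i j κ, HasDerivAt (fun t => l (fourierKer (c t i j) (ξ - κ) κ))
      (l (fourierKer (momentRate Φ γ L (c t) i j) (ξ - κ) κ)) t := fun t ht i j κ =>
    l.hasFDerivAt.comp_hasDerivAt t (hasDerivAt_fourierKer (hc t ht i j) (ξ - κ) κ)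
  have hneg : ∀ κ, phiHatL Φ (ξ - κ) = phiHatL Φ (κ - ξ) := fun κ => by
    rw [← phiHatL_neg hs, neg_sub]
  refine ⟨⟨fun t ht κ => (hd t ht 0 0 κ).congr_deriv ?_,
    fun t ht κ => (hd t ht 0 1 κ).congr_deriv ?_, fun t ht κ => (hd t ht 1 0 κ).congr_deriv ?_,
    fun t ht κ => (hd t ht 1 1 κ).congr_deriv ?_⟩, havg⟩
  · rw [show momentRate Φ γ L (c t) 0 0 = fun x y => c t 1 0 x y + c t 0 1 x y from rfl,
      fourierKer_add, map_add, add_comm]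
  · rw [show momentRate Φ γ L (c t) 0 1 = fun x y => c t 1 1 x y
        - ∑ z, PhiL Φ L y z * c t 0 0 x z - γ * c t 0 1 x y from rfl,
      fourierKer_sub, fourierKer_sub, fourierKer_conv_right hs, fourierKer_const_mul, map_sub,
      map_sub, hl, hl]
  · rw [show momentRate Φ γ L (c t) 1 0 = fun x y => c t 1 1 x y
        - ∑ z, PhiL Φ L x z * c t 0 0 z y - γ * c t 1 0 x y from rfl,
      fourierKer_sub, fourierKer_sub, fourierKer_conv_left hs, fourierKer_const_mul, map_sub,
      map_sub, hl, hl, hneg]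
  · rw [havg, show momentRate Φ γ L (c t) 1 1 = fun x y => -(∑ z, PhiL Φ L x z * c t 0 1 z y)
        - ∑ z, PhiL Φ L y z * c t 1 0 x z
        - 2 * γ * (c t 1 1 x y - if x = y then c t 1 1 x x else 0) from rfl,
      fourierKer_sub, fourierKer_sub, fourierKer_neg, fourierKer_conv_left hs,
      fourierKer_conv_right hs, fourierKer_const_mul, fourierKer_sub,
      fourierKer_diag fun x => c t 1 1 x x, sub_add_cancel, map_sub, map_sub, map_neg, hl, hl, hl,
      map_sub, hneg]

theorem FiberSol.shift {ι : Type} [Fintype ι] {a b : ι → ℝ} {p q r s : ℝ → ι → ℝ}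
    (h : FiberSol γ a b p q r s) {t₀ : ℝ} (ht₀ : 0 ≤ t₀) :
    FiberSol γ a b (fun t => p (t + t₀)) (fun t => q (t + t₀)) (fun t => r (t + t₀))
      (fun t => s (t + t₀)) where
  dp t ht κ := (h.dp (t + t₀) (by linarith) κ).comp_add_const t t₀
  dq t ht κ := (h.dq (t + t₀) (by linarith) κ).comp_add_const t t₀
  dr t ht κ := (h.dr (t + t₀) (by linarith) κ).comp_add_const t t₀
  ds t ht κ := (h.ds (t + t₀) (by linarith) κ).comp_add_const t t₀

/-! ### Fourier inversion of the observables -/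

theorem fourierFun_inv (g : ZMod L → ℝ) (x : ZMod L) :
    (L : ℂ)⁻¹ * ∑ ξ, chi (ξ * x) * fourierFun g ξ = g x := by
  have hL : (L : ℂ) ≠ 0 := Nat.cast_ne_zero.2 (NeZero.ne L)
  rw [inv_mul_eq_iff_eq_mul₀ hL]
  simp only [fourierFun, Finset.mul_sum]
  rw [Finset.sum_comm, Finset.sum_eq_single x]
  · have : ∀ ξ : ZMod L, chi (ξ * x) * (chi (-(ξ * x)) * (g x : ℂ)) = g x := fun ξ => by
      rw [← mul_assoc, ← chi_add, add_neg_cancel, chi_zero, one_mul]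
    simp [this, ZMod.card]
  · intro y _ hy
    have : ∀ ξ : ZMod L, chi (ξ * x) * (chi (-(ξ * y)) * (g y : ℂ))
        = g y * chi (ξ * (x - y)) := fun ξ => by
      rw [← mul_assoc, ← chi_add, mul_comm (chi _)]
      congr 2
      ring
    simp only [this]
    rw [← Finset.mul_sum, sum_chi_mul, if_neg (sub_ne_zero.2 hy.symm), mul_zero]
  · exact fun h => absurd (Finset.mem_univ x) h

theorem fourierKer_inv (g : ZMod L → ZMod L → ℝ) (x κ : ZMod L) :
    (L : ℂ)⁻¹ * ∑ ξ, chi (ξ * x) * fourierKer g (ξ - κ) κ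
      = ∑ y, chi (-(κ * y)) * (g x (x + y) : ℂ) := by
  have hL : (L : ℂ) ≠ 0 := Nat.cast_ne_zero.2 (NeZero.ne L)
  rw [inv_mul_eq_iff_eq_mul₀ hL]
  have h0 : ∀ ξ, chi (ξ * x) * fourierKer g (ξ - κ) κ = ∑ z, chi (ξ * x)
      * (chi (-((ξ - κ) * z)) * ∑ y, chi (-(κ * y)) * (g z y : ℂ)) := fun ξ => Finset.mul_sum ..
  simp only [h0]
  rw [Finset.sum_comm, Finset.sum_eq_single x]
  · have h1 : ∀ ξ : ZMod L, chi (ξ * x) * (chi (-((ξ - κ) * x)) * ∑ y, chi (-(κ * y)) * (g x y : ℂ))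
        = ∑ y, chi (-(κ * y)) * (g x (x + y) : ℂ) := fun ξ => by
      rw [← mul_assoc, ← chi_add, ← Equiv.sum_comp (Equiv.addLeft x), Finset.mul_sum]
      refine Finset.sum_congr rfl fun y _ => ?_
      rw [← mul_assoc, ← chi_add, Equiv.coe_addLeft]
      congr 2
      ring
    simp only [h1, Finset.sum_const, Finset.card_univ, ZMod.card, nsmul_eq_mul]
  · intro z _ hz
    have h1 : ∀ ξ : ZMod L, chi (ξ * x) * (chi (-((ξ - κ) * z)) * ∑ y, chi (-(κ * y)) * (g z y : ℂ))
        = chi (κ * z) * (∑ y, chi (-(κ * y)) * (g z y : ℂ)) * chi (ξ * (x - z)) := fun ξ => by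
      rw [mul_right_comm, ← mul_assoc, ← chi_add, ← chi_add]
      congr 2
      ring
    simp only [h1]
    rw [← Finset.mul_sum, sum_chi_mul, if_neg (sub_ne_zero.2 hz.symm), mul_zero]
  · exact fun h => absurd (Finset.mem_univ x) h

theorem exp_eq_chi (κ y : ZMod L) :
    Complex.exp (-(Complex.I * ((2 * Real.pi * dualPoint L κ * (y.valMinAbs : ℝ) : ℝ) : ℂ)))
      = chi (-(κ * y)) := by
  rw [chi_neg, chi_mul, ← Complex.exp_conj, map_mul, Complex.conj_ofReal, Complex.conj_I]
  congr 1
  ring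

variable {S : Type*} [MeasurableSpace S] {P : Measure S} {X : ℝ≥0 → S → Phase L}

theorem wigner_eq (t : ℝ≥0) (x κ : ZMod L) (i j : Fin 2) :
    wigner P X t x (dualPoint L κ) i j
      = (L : ℂ)⁻¹ * ∑ ξ, chi (ξ * x) * fourierKer (corr P X t i j) (ξ - κ) κ := by
  rw [fourierKer_inv]
  simp only [wigner, Matrix.of_apply, exp_eq_chi]

theorem temp_eq_corr (t : ℝ≥0) (x : ZMod L) : temp P X t x = corr P X t 1 1 x x := by
  simp only [temp, corr, sq]

theorem temp_eq (t : ℝ≥0) (x : ZMod L) :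
    (temp P X t x : ℂ) = (L : ℂ)⁻¹ * ∑ ξ, chi (ξ * x) * fourierFun (temp P X t) ξ :=
  (fourierFun_inv _ _).symm

theorem gradTemp_eq (t : ℝ≥0) (x : ZMod L) : (gradTemp P X t x : ℂ)
    = (L : ℂ)⁻¹ * ∑ ξ, chi (ξ * x) * ((chi ξ - 1) * fourierFun (temp P X t) ξ) := by
  rw [gradTemp, Complex.ofReal_sub, temp_eq, temp_eq, ← mul_sub, ← Finset.sum_sub_distrib]
  congr 1
  refine Finset.sum_congr rfl fun ξ _ => ?_
  rw [mul_add, mul_one, chi_add]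
  ring

end FourierFibers

/-! ### The first order symbol solves the stationary fiber equations approximately -/

section Symbol

variable {Φ : ℤ → ℝ} {γ : ℝ}

theorem Admissible.abs_phiHatDeriv_le (hΦ : Admissible Φ γ) (k : ℝ) :
    |phiHatDeriv Φ k| ≤ 2 * Real.pi * absMoment Φ 1 := by
  have hπ := Real.pi_pos
  rw [absMoment, ← tsum_mul_left]
  refine abs_tsum_le_of_abs_le ((hΦ.summable_moment 1).mul_left _) fun x => ?_
  rw [abs_mul, abs_mul, abs_neg, abs_mul, abs_of_pos Real.two_pi_pos]
  calc |Φ x| * (2 * Real.pi * |(x : ℝ)| * |Real.sin (2 * Real.pi * k * x)|)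
      ≤ |Φ x| * (2 * Real.pi * |(x : ℝ)| * 1) := by
        gcongr
        exact Real.abs_sin_le_one _
    _ = _ := by ring

/-- The first order correction `h Φ̂'(k) / (2 Φ̂(k))` to the local equilibrium symbol. -/
def symbolCorr (Φ : ℤ → ℝ) (k h : ℝ) : ℝ := h * phiHatDeriv Φ k / (2 * phiHat Φ k)

/-- The local equilibrium symbol at momentum `k` with the gradient correction at frequency `h`. -/
def localSymbol (Φ : ℤ → ℝ) (γ k h : ℝ) (i j : Fin 2) : ℝ :=
  U0 Φ γ k i j - 2 * Real.pi * h * U1 Φ γ k i j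

theorem Admissible.localSymbol_eq (hΦ : Admissible Φ γ) (k h : ℝ) :
    localSymbol Φ γ k h 0 0 = (1 + symbolCorr Φ k h) / phiHat Φ k ∧
    localSymbol Φ γ k h 0 1 = -(symbolCorr Φ k h / γ) ∧
    localSymbol Φ γ k h 1 0 = symbolCorr Φ k h / γ ∧ localSymbol Φ γ k h 1 1 = 1 := by
  have hγ := hΦ.gamma_pos.ne'
  have hp := (hΦ.phiHat_pos k).ne'
  have hπ := Real.pi_ne_zero
  simp only [localSymbol, hΦ.U0_eq, hΦ.U1_eq, hΦ.velocity_div_disp, hΦ.disp_sq, symbolCorr]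
  refine ⟨?_, ?_, ?_, ?_⟩ <;> simp <;> field_simp <;> ring

/-- At `h = 0` the vector `(1/Φ̂, 0, 0, 1)` is stationary for `a = b = Φ̂`. The correction `g =
hΦ̂'/(2Φ̂)` compensates the first-order change `-2gΦ̂` of `Φ̂_L(κ - ξ)`. What remains are terms of
order `h²`, the Taylor remainder among them, and the lattice truncation error `L⁻²`. -/
theorem Admissible.exists_symbol_residual (hΦ : Admissible Φ γ) :
    ∃ A > 0, ∃ D > 0, ∀ (L : ℕ) [NeZero L] (ξ κ : ZMod L),
      |phiHatL Φ (κ - ξ) - phiHatL Φ κ| ≤ A * |dualPoint L ξ| ∧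
      (∀ i j, localSymbol Φ γ (dualPoint L κ) (dualPoint L ξ) i j ^ 2 ≤ A) ∧
      |localSymbol Φ γ (dualPoint L κ) (dualPoint L ξ) 0 1
        + localSymbol Φ γ (dualPoint L κ) (dualPoint L ξ) 1 0|
        ≤ D * (dualPoint L ξ ^ 2 + ((L : ℝ) ^ 2)⁻¹) ∧
      |localSymbol Φ γ (dualPoint L κ) (dualPoint L ξ) 1 1
        - phiHatL Φ κ * localSymbol Φ γ (dualPoint L κ) (dualPoint L ξ) 0 0
        - γ * localSymbol Φ γ (dualPoint L κ) (dualPoint L ξ) 0 1|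
        ≤ D * (dualPoint L ξ ^ 2 + ((L : ℝ) ^ 2)⁻¹) ∧
      |localSymbol Φ γ (dualPoint L κ) (dualPoint L ξ) 1 1
        - phiHatL Φ (κ - ξ) * localSymbol Φ γ (dualPoint L κ) (dualPoint L ξ) 0 0
        - γ * localSymbol Φ γ (dualPoint L κ) (dualPoint L ξ) 1 0|
        ≤ D * (dualPoint L ξ ^ 2 + ((L : ℝ) ^ 2)⁻¹) ∧
      |-(phiHatL Φ (κ - ξ) * localSymbol Φ γ (dualPoint L κ) (dualPoint L ξ) 0 1)
        - phiHatL Φ κ * localSymbol Φ γ (dualPoint L κ) (dualPoint L ξ) 1 0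
        - 2 * γ * localSymbol Φ γ (dualPoint L κ) (dualPoint L ξ) 1 1 + 2 * γ|
        ≤ D * (dualPoint L ξ ^ 2 + ((L : ℝ) ^ 2)⁻¹) := by
  obtain ⟨m, hm, hφm⟩ := hΦ.exists_le_phiHat
  have hγ := hΦ.gamma_pos
  have hπ := Real.pi_pos
  set B := 2 * Real.pi * absMoment Φ 1 with hB
  have hB0 : 0 ≤ B := mul_nonneg (by positivity) (absMoment_nonneg _ _)
  set M := 4 * absMoment Φ 2 with hM
  have hM0 : 0 ≤ M := mul_nonneg (by positivity) (absMoment_nonneg _ _)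
  set T := 8 * Real.pi ^ 2 * absMoment Φ 2 with hT
  have hT0 : 0 ≤ T := mul_nonneg (by positivity) (absMoment_nonneg _ _)
  set G := B / (2 * m) with hG
  have hG0 : 0 ≤ G := by positivity
  refine ⟨B + ((1 + G) / m) ^ 2 + (G / γ) ^ 2 + 1, by positivity,
    M * ((1 + G) / m) + 2 * G ^ 2 + T * ((1 + G) / m) + B * G / γ + 1, by positivity, ?_⟩
  intro L _ ξ κ
  obtain ⟨e00, e01, e10, e11⟩ := hΦ.localSymbol_eq (dualPoint L κ) (dualPoint L ξ)
  have hdiff := abs_phiHatL_sub_le hΦ κ ξ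
  have hh := abs_dualPoint_le ξ
  have hβ := abs_phiSum_sub_phiHat_le (L := L) hΦ (dualPoint L κ)
  have hα := abs_phiSum_sub_phiHat_le (L := L) hΦ (dualPoint L κ - dualPoint L ξ)
  have hα' := hΦ.phiHat_taylor (dualPoint L κ) (-dualPoint L ξ)
  rw [← phiHatL_sub] at hα
  rw [← phiHatL_eq] at hβ
  rw [← sub_eq_add_neg, neg_sq, ← hT] at hα'
  rw [div_eq_mul_inv, ← hM] at hα hβ
  rw [← hB] at hdiff
  set k := dualPoint L κ
  set h := dualPoint L ξ
  set φ := phiHat Φ k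
  set g := symbolCorr Φ k h with hg
  set α := phiHatL Φ (κ - ξ)
  set β := phiHatL Φ κ
  set l := ((L : ℝ) ^ 2)⁻¹
  have hl0 : 0 ≤ l := by positivity
  have hφ : m ≤ φ := hφm k
  have hφ0 : 0 < φ := hm.trans_le hφ
  have hg1 : |g| ≤ G * |h| := by
    rw [hg, symbolCorr, abs_div, abs_mul, abs_of_pos (by positivity : 0 < 2 * phiHat Φ k), hG,
      div_mul_eq_mul_div, mul_comm B]
    have := hΦ.abs_phiHatDeriv_le k
    gcongr
  have hg2 : |g| ≤ G := hg1.trans (by nlinarith [abs_nonneg h])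
  have hgφ : h * phiHatDeriv Φ k = 2 * g * φ := by
    change _ = 2 * (h * phiHatDeriv Φ k / (2 * φ)) * φ
    field_simp
  have hV : |(1 + g) / φ| ≤ (1 + G) / m := by
    rw [abs_div, abs_of_pos hφ0]
    gcongr
    exact (abs_add_le _ _).trans (by rw [abs_one]; linarith)
  have hV0 : 0 ≤ (1 + G) / m := by positivity
  have hα2 : |α - φ + 2 * g * φ| ≤ M * l + T * h ^ 2 := by
    have : α - φ + 2 * g * φ = (α - phiHat Φ (k - h))
        + (phiHat Φ (k - h) - phiHat Φ k - -h * phiHatDeriv Φ k) := by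
      rw [← hgφ]; ring
    rw [this]
    exact (abs_add_le _ _).trans (add_le_add hα hα')
  clear_value B M T G l α β
  have hgγ : |g / γ| ≤ G / γ := by rw [abs_div, abs_of_pos hγ]; gcongr
  have hl1 : 0 ≤ M * ((1 + G) / m) := by positivity
  have hl2 : 0 ≤ T * ((1 + G) / m) := by positivity
  have hl3 : 0 ≤ B * G / γ := by positivity
  have hh2 : 0 ≤ h ^ 2 := sq_nonneg h
  have hG2 : 0 ≤ 2 * G ^ 2 := by positivity
  have hD : ∃ D, D = M * ((1 + G) / m) + 2 * G ^ 2 + T * ((1 + G) / m) + B * G / γ + 1 := ⟨_, rfl⟩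
  obtain ⟨D, hD⟩ := hD
  rw [← hD]
  have hD0 : 0 ≤ D := by rw [hD]; positivity
  have hD1 : M * ((1 + G) / m) ≤ D := by rw [hD]; linarith
  have hD2 : 2 * G ^ 2 + T * ((1 + G) / m) ≤ D := by rw [hD]; linarith
  have hD3 : B * G / γ ≤ D := by rw [hD]; linarith
  have hsum : 0 ≤ h ^ 2 + l := by positivity
  have hle : ∀ {x y : ℝ}, 0 ≤ y → |x| ≤ y → x ^ 2 ≤ y ^ 2 := fun hy hx =>
    sq_le_sq.2 (by rwa [abs_of_nonneg hy])
  refine ⟨hdiff.trans ?_, ?_, ?_, ?_, ?_, ?_⟩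
  · exact mul_le_mul_of_nonneg_right (by nlinarith [sq_nonneg ((1 + G) / m), sq_nonneg (G / γ)])
      (abs_nonneg _)
  · have h1 := hle hV0 hV
    have h2 := hle (by positivity) hgγ
    have h3 := sq_nonneg ((1 + G) / m)
    have h4 := sq_nonneg (G / γ)
    intro i j
    fin_cases i <;> fin_cases j
    · show localSymbol Φ γ k h 0 0 ^ 2 ≤ _
      rw [e00]; linarith
    · show localSymbol Φ γ k h 0 1 ^ 2 ≤ _
      rw [e01, neg_sq]; linarith
    · show localSymbol Φ γ k h 1 0 ^ 2 ≤ _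
      rw [e10]; linarith
    · show localSymbol Φ γ k h 1 1 ^ 2 ≤ _
      rw [e11]; linarith
  · rw [e01, e10, neg_add_cancel, abs_zero]
    positivity
  · rw [e11, e00, e01]
    have : 1 - β * ((1 + g) / φ) - γ * -(g / γ) = -((β - φ) * ((1 + g) / φ)) := by
      have h1 : φ * ((1 + g) / φ) = 1 + g := mul_div_cancel₀ _ hφ0.ne'
      have h2 : γ * (g / γ) = g := mul_div_cancel₀ _ hγ.ne'
      linear_combination h2 - h1
    rw [this, abs_neg, abs_mul]
    calc |β - φ| * |(1 + g) / φ| ≤ M * l * ((1 + G) / m) := by gcongr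
      _ = M * ((1 + G) / m) * l := by ring
      _ ≤ _ := by
        exact mul_le_mul hD1 (by linarith) hl0 hD0
  · rw [e11, e00, e10]
    have : 1 - α * ((1 + g) / φ) - γ * (g / γ)
        = 2 * g ^ 2 - (α - φ + 2 * g * φ) * ((1 + g) / φ) := by
      have h1 : φ * ((1 + g) / φ) = 1 + g := mul_div_cancel₀ _ hφ0.ne'
      have h2 : γ * (g / γ) = g := mul_div_cancel₀ _ hγ.ne'
      linear_combination (2 * g - 1) * h1 - h2
    rw [this]
    have h1 : |2 * g ^ 2| ≤ 2 * G ^ 2 * h ^ 2 := by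
      rw [abs_of_nonneg (by positivity)]
      have := hle (by positivity) hg1
      rw [mul_pow, sq_abs] at this
      linarith
    calc _ ≤ 2 * G ^ 2 * h ^ 2 + (M * l + T * h ^ 2) * ((1 + G) / m) := by
          refine (abs_sub _ _).trans (add_le_add h1 ?_)
          rw [abs_mul]
          gcongr
      _ = (2 * G ^ 2 + T * ((1 + G) / m)) * h ^ 2 + M * ((1 + G) / m) * l := by ring
      _ ≤ _ := by
          rw [mul_add]
          exact add_le_add (mul_le_mul_of_nonneg_right hD2 hh2)
            (mul_le_mul_of_nonneg_right hD1 hl0)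
  · rw [e11, e10, e01]
    have : -(α * -(g / γ)) - β * (g / γ) - 2 * γ * 1 + 2 * γ = (α - β) * g / γ := by
      ring
    rw [this, abs_div, abs_mul, abs_of_pos hγ]
    calc |α - β| * |g| / γ ≤ B * |h| * (G * |h|) / γ := by gcongr
      _ = B * G / γ * h ^ 2 := by rw [← sq_abs h]; ring
      _ ≤ _ := by
        exact mul_le_mul hD3 (by linarith) hh2 hD0

end Symbol

/-! ### Elementary exponential estimates -/

theorem exists_pow_mul_exp_le (k : ℕ) {c : ℝ} (hc : 0 < c) :
    ∃ C > 0, ∀ y : ℝ, 0 ≤ y → y ^ k * Real.exp (-(c * y)) ≤ C := by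
  refine ⟨k.factorial / c ^ k, by positivity, fun y hy => ?_⟩
  have h := Real.pow_div_factorial_le_exp (c * y) (by positivity) k
  rw [Real.exp_neg, ← div_eq_mul_inv, div_le_div_iff₀ (Real.exp_pos _) (by positivity)]
  rw [div_le_iff₀ (by positivity), mul_pow] at h
  linarith

/-! ### The expansion of the Fourier fibers at diffusive times -/

section Expansion

variable {Φ : ℤ → ℝ} {γ : ℝ}

/-- A priori bounded solutions of the moment equations. -/
structure MomentSol (Φ : ℤ → ℝ) (γ : ℝ) (L : ℕ) [NeZero L] (E : ℝ)
    (w : ℝ → Fin 2 → Fin 2 → ZMod L → ZMod L → ℝ) : Prop where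
  hasDerivAt : ∀ t, 0 ≤ t → ∀ i j x y,
    HasDerivAt (fun t => w t i j x y) (momentRate Φ γ L (w t) i j x y) t
  abs_le : ∀ t, 0 ≤ t → ∀ i j x y, |w t i j x y| ≤ E * L
  sum_le : ∀ t, 0 ≤ t → ∑ x, |w t 1 1 x x| ≤ E * L

/-- Bookkeeping of powers of `L`: `F` is the initial-layer factor, `S` the crude `O(L⁶)` size of the
data, `G` the diffusive factor and `e²` its Gaussian bound. Beating `L⁸` makes the initial layer as
small as the main error at `n = 0`. -/
theorem expansion_bound {C K Q B D L n e F G S : ℝ} (hC : 0 < C) (hK : 0 ≤ K) (hQ : 0 ≤ Q)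
    (hB : 0 ≤ B) (hL : 0 < L) (he : 0 ≤ e) (hF0 : 0 ≤ F) (hG0 : 0 ≤ G) (hG : G ≤ e ^ 2)
    (hF : F * L ^ 8 ≤ B * e ^ 2) (hS : S ≤ Q * L ^ 6) :
    C * (F * S + K * L ^ 2 * (D ^ 2 * (n ^ 2 + 1) ^ 2 / L ^ 4 + n ^ 4 / L ^ 4) * G)
      ≤ C * (Q * B + K * (2 * D ^ 2 + 1) + K) * ((n ^ 2 + 1) / L * e) ^ 2 := by
  have hmain : D ^ 2 * (n ^ 2 + 1) ^ 2 / L ^ 4 + n ^ 4 / L ^ 4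
      ≤ (2 * D ^ 2 + 1) * ((n ^ 2 + 1) ^ 2 / L ^ 4) := by
    rw [← add_div, ← mul_div_assoc]
    gcongr
    nlinarith [sq_nonneg n, mul_nonneg (sq_nonneg D) (sq_nonneg (n ^ 2 + 1))]
  have h1 : 1 / L * e ≤ (n ^ 2 + 1) / L * e := by
    gcongr
    linarith [sq_nonneg n]
  have h2 := pow_le_pow_left₀ (by positivity) h1 2
  calc _ ≤ C * (F * (Q * L ^ 6)
          + K * L ^ 2 * ((2 * D ^ 2 + 1) * ((n ^ 2 + 1) ^ 2 / L ^ 4)) * e ^ 2) := by gcongr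
    _ = C * (Q * (F * L ^ 8) / L ^ 2 + K * (2 * D ^ 2 + 1) * ((n ^ 2 + 1) / L * e) ^ 2) := by
        field_simp
    _ ≤ C * (Q * (B * e ^ 2) / L ^ 2 + K * (2 * D ^ 2 + 1) * ((n ^ 2 + 1) / L * e) ^ 2) := by
        gcongr
    _ = C * (Q * B * (1 / L * e) ^ 2 + K * (2 * D ^ 2 + 1) * ((n ^ 2 + 1) / L * e) ^ 2) := by
        field_simp
    _ ≤ C * (Q * B * ((n ^ 2 + 1) / L * e) ^ 2
          + K * (2 * D ^ 2 + 1) * ((n ^ 2 + 1) / L * e) ^ 2) := by gcongr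
    _ ≤ _ := by
        have : 0 ≤ C * K * ((n ^ 2 + 1) / L * e) ^ 2 := by positivity
        linarith

set_option maxHeartbeats 400000 in
-- The first half of the time interval is used for relaxation, from mean square `L⁶` to `L²`; the
-- second half for the fiber expansion. The functional `l` turns complex fibers into real solutions.
theorem Admissible.exists_functional_expansion (hΦ : Admissible Φ γ) {m cD E c₀ : ℝ} (hm : 0 < m)
    (hcD : 0 < cD) (hE : 0 < E) (hc₀ : 0 < c₀) :
    ∃ C > 0, ∃ c > 0, ∀ (L : ℕ) [NeZero L], (∀ a : ZMod L, m ≤ phiHatL Φ a) →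
      (∀ ξ : ZMod L, cD * |dualPoint L ξ| ^ 2
        ≤ avg (fun κ : ZMod L => (phiHatL Φ (κ - ξ) - phiHatL Φ κ) ^ 2)) →
      ∀ w, MomentSol Φ γ L E w → ∀ l : ℂ →L[ℝ] ℝ, (∀ z, |l z| ≤ ‖z‖) →
      ∀ t, c₀ * (L : ℝ) ^ 2 ≤ t → ∀ (ξ κ : ZMod L) (i j : Fin 2),
        l (fourierFun (fun x => w t 1 1 x x) ξ) ^ 2
          ≤ C * (L * Real.exp (-(c * (ξ.valMinAbs : ℝ) ^ 2))) ^ 2 ∧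
        l (fourierKer (w t i j) (ξ - κ) κ - localSymbol Φ γ (dualPoint L κ) (dualPoint L ξ) i j
            * fourierFun (fun x => w t 1 1 x x) ξ) ^ 2
          ≤ C * (((ξ.valMinAbs : ℝ) ^ 2 + 1) / L
            * Real.exp (-(c * (ξ.valMinAbs : ℝ) ^ 2))) ^ 2 := by
  obtain ⟨A, hA, D, hD, hsym⟩ := hΦ.exists_symbol_residual
  have hM : 0 < absMoment Φ 0 + 1 := by linarith [absMoment_nonneg Φ 0]
  obtain ⟨C₁, hC₁, c₁, hc₁, H₁⟩ := exists_relaxation γ m _ hΦ.gamma_pos hm hM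
  obtain ⟨C₂, hC₂, c₂, hc₂, H₂⟩ := exists_fiber_expansion γ m _ A cD hΦ.gamma_pos hm hM hA hcD
  obtain ⟨B₁, hB₁, hexp₁⟩ := exists_pow_mul_exp_le 2 (show 0 < c₁ * c₀ / 2 by positivity)
  obtain ⟨B₂, hB₂, hexp₂⟩ := exists_pow_mul_exp_le 4 (show 0 < c₂ * c₀ / 4 by positivity)
  obtain ⟨K, hK⟩ : ∃ K, K = C₁ * E ^ 2 * (4 * B₁ + 1) := ⟨_, rfl⟩
  have hK0 : 0 < K := by rw [hK]; positivity
  refine ⟨C₂ * ((4 * (4 * E ^ 2) + K) * B₂ + K * (2 * D ^ 2 + 1) + K), by positivity, c₂ * c₀ / 8,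
    by positivity, ?_⟩
  intro L _ hmL hcDL w hw l hl t ht ξ κ i j
  have hL : (1 : ℝ) ≤ L := by exact_mod_cast NeZero.one_le
  have hL0 : (0 : ℝ) < L := by linarith
  obtain ⟨hsol, havg⟩ := fiberSol_fourierKer hΦ.symm hw.hasDerivAt l ξ
  obtain ⟨r1, r2, r3, r4, r5, r6⟩ := hsym L ξ κ
  have hcoef : CoeffBound m (absMoment Φ 0 + 1) (fun κ => phiHatL Φ (κ - ξ))
      (fun κ => phiHatL Φ κ) := fun κ =>
    ⟨hmL _, by linarith [le_abs_self (phiHatL Φ (κ - ξ)), abs_phiHatL_le hΦ (κ - ξ)], hmL _,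
      by linarith [le_abs_self (phiHatL Φ κ), abs_phiHatL_le hΦ κ]⟩
  have ht0 : 0 ≤ t := le_trans (by positivity) ht
  have ht2 : 0 ≤ t / 2 := by positivity
  have hbd : ∀ u, 0 ≤ u → ∀ i j κ, l (fourierKer (w u i j) (ξ - κ) κ) ^ 2
      ≤ E ^ 2 * (L : ℝ) ^ 6 := by
    intro u hu i j κ
    have := (hl _).trans (norm_fourierKer_le (hw.abs_le u hu i j) (ξ - κ) κ)
    rw [← sq_abs]
    refine (pow_le_pow_left₀ (abs_nonneg _) this 2).trans (le_of_eq ?_)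
    ring
  have hF : ∀ u, 0 ≤ u → |avg (fun κ => l (fourierKer (w u 1 1) (ξ - κ) κ))| ≤ E * L := by
    intro u hu
    rw [havg]
    exact (hl _).trans ((norm_fourierFun_le _ _).trans (hw.sum_le u hu))
  have hN0 : ∀ u, 0 ≤ u → meanSq (fun κ => l (fourierKer (w u 0 0) (ξ - κ) κ))
      (fun κ => l (fourierKer (w u 0 1) (ξ - κ) κ)) (fun κ => l (fourierKer (w u 1 0) (ξ - κ) κ))
      (fun κ => l (fourierKer (w u 1 1) (ξ - κ) κ)) ≤ 4 * (E ^ 2 * (L : ℝ) ^ 6) := by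
    intro u hu
    refine (avg_mono (h := fun _ => 4 * (E ^ 2 * (L : ℝ) ^ 6)) fun κ => ?_).trans
      (avg_const _).le
    linarith [hbd u hu 0 0 κ, hbd u hu 0 1 κ, hbd u hu 1 0 κ, hbd u hu 1 1 κ]
  -- The factor `e^{-cL²}` gained up to time `t/2` beats the crude `L⁶`; the temperature mode,
  -- bounded by `E L`, contributes the `L²`.
  have hN : meanSq (fun κ => l (fourierKer (w (t / 2) 0 0) (ξ - κ) κ))
      (fun κ => l (fourierKer (w (t / 2) 0 1) (ξ - κ) κ))
      (fun κ => l (fourierKer (w (t / 2) 1 0) (ξ - κ) κ))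
      (fun κ => l (fourierKer (w (t / 2) 1 1) (ξ - κ) κ)) ≤ K * (L : ℝ) ^ 2 := by
    refine (H₁ hcoef hsol (E * L) hF (t / 2) ht2).trans ?_
    have h1 : Real.exp (-(c₁ * (t / 2))) ≤ Real.exp (-(c₁ * c₀ / 2 * (L : ℝ) ^ 2)) := by
      refine Real.exp_le_exp.2 (neg_le_neg ?_)
      nlinarith
    have h2 := hexp₁ ((L : ℝ) ^ 2) (by positivity)
    calc _ ≤ C₁ * (Real.exp (-(c₁ * c₀ / 2 * (L : ℝ) ^ 2)) * (4 * (E ^ 2 * (L : ℝ) ^ 6))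
          + (E * L) ^ 2) := by
          gcongr
          exacts [meanSq_nonneg _ _ _ _, hN0 0 le_rfl]
      _ = C₁ * E ^ 2 * (L : ℝ) ^ 2 * (4 * (((L : ℝ) ^ 2) ^ 2
          * Real.exp (-(c₁ * c₀ / 2 * (L : ℝ) ^ 2))) + 1) := by ring
      _ ≤ C₁ * E ^ 2 * (L : ℝ) ^ 2 * (4 * B₁ + 1) := by gcongr
      _ = _ := by rw [hK]; ring
  have key := H₂ hcoef (hsol.shift ht2) |dualPoint L ξ| (K * (L : ℝ) ^ 2)
    (D * (dualPoint L ξ ^ 2 + ((L : ℝ) ^ 2)⁻¹)) (abs_nonneg _)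
    ((abs_dualPoint_le ξ).trans (by norm_num)) (by positivity)
    (fun κ => (hsym L ξ κ).1) (hcDL ξ) (by simpa only [zero_add] using hN) κ _ _ _ _
    (r2 0 0) (r2 0 1) (r2 1 0) (r2 1 1) r3 r4 r5 r6 (t / 2) ht2
  simp only [add_halves, zero_add, havg] at key
  obtain ⟨key1, key2⟩ := key
  have hδ : dualPoint L ξ = (ξ.valMinAbs : ℝ) / L := rfl
  -- Diffusive scaling: `δ = n/L` and `t ≥ c₀L²` make `e^{-cδ²t}` Gaussian in the integer `n`,
  -- uniformly in `L`.
  have hδt : c₀ * (ξ.valMinAbs : ℝ) ^ 2 ≤ |dualPoint L ξ| ^ 2 * t := by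
    rw [sq_abs, hδ, div_pow, div_mul_eq_mul_div, le_div_iff₀ (by positivity)]
    nlinarith [sq_nonneg (ξ.valMinAbs : ℝ)]
  have hnL : (ξ.valMinAbs : ℝ) ^ 2 ≤ (L : ℝ) ^ 2 := by
    have := abs_dualPoint_le ξ
    rw [hδ, abs_div, abs_of_pos hL0, div_le_iff₀ hL0] at this
    rw [← sq_abs]
    exact pow_le_pow_left₀ (abs_nonneg _) (by linarith) 2
  have hδ2 : |dualPoint L ξ| ^ 4 = (ξ.valMinAbs : ℝ) ^ 4 / (L : ℝ) ^ 4 := by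
    rw [hδ, abs_div, div_pow, abs_of_pos hL0, Even.pow_abs (by decide)]
  have hρ : (D * (dualPoint L ξ ^ 2 + ((L : ℝ) ^ 2)⁻¹)) ^ 2
      = D ^ 2 * ((ξ.valMinAbs : ℝ) ^ 2 + 1) ^ 2 / (L : ℝ) ^ 4 := by
    rw [hδ]; field_simp
  rw [hρ, hδ2] at key2
  clear r1 r2 r3 r4 r5 r6 hρ hδ2 hδ hN hN0 hF hexp₁ H₁ H₂ hsym hcoef hsol hcDL hmL
  generalize (ξ.valMinAbs : ℝ) = n at hδt hnL key2 ⊢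
  obtain ⟨e, he⟩ : ∃ e, e = Real.exp (-(c₂ * c₀ / 8 * n ^ 2)) := ⟨_, rfl⟩
  rw [← he]
  have he0 : 0 < e := he ▸ Real.exp_pos _
  have he1 : Real.exp (-(c₂ * |dualPoint L ξ| ^ 2 * (t / 2))) ≤ e ^ 2 := by
    rw [he, ← Real.exp_nat_mul]
    refine Real.exp_le_exp.2 ?_
    push_cast
    have h1 := mul_nonneg (mul_pos hc₂ hc₀).le (sq_nonneg n)
    have h2 := mul_le_mul_of_nonneg_left hδt hc₂.le
    linarith
  -- The exponent is split in two: one half becomes the Gaussian weight through `n² ≤ L²`, the other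
  -- absorbs `L⁸`.
  have he2 : Real.exp (-(c₂ * (t / 2))) * (L : ℝ) ^ 8 ≤ B₂ * e ^ 2 := by
    have h1 : Real.exp (-(c₂ * (t / 2))) ≤ Real.exp (-(c₂ * c₀ / 4 * (L : ℝ) ^ 2)) * e ^ 2 := by
      rw [he, ← Real.exp_nat_mul, ← Real.exp_add]
      refine Real.exp_le_exp.2 ?_
      push_cast
      have h1 := mul_le_mul_of_nonneg_left ht hc₂.le
      have h2 := mul_le_mul_of_nonneg_left hnL (mul_pos hc₂ hc₀).le
      linarith
    calc _ ≤ Real.exp (-(c₂ * c₀ / 4 * (L : ℝ) ^ 2)) * e ^ 2 * (L : ℝ) ^ 8 := by gcongr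
      _ = ((L : ℝ) ^ 2) ^ 4 * Real.exp (-(c₂ * c₀ / 4 * (L : ℝ) ^ 2)) * e ^ 2 := by ring
      _ ≤ _ := by
        have := hexp₂ ((L : ℝ) ^ 2) (by positivity)
        gcongr
  constructor
  · refine key1.trans ?_
    calc C₂ * (K * (L : ℝ) ^ 2 * Real.exp (-(c₂ * |dualPoint L ξ| ^ 2 * (t / 2))))
        ≤ C₂ * (K * (L : ℝ) ^ 2 * e ^ 2) := by gcongr
      _ = C₂ * K * (L * e) ^ 2 := by ring
      _ ≤ _ := by
        gcongr
        exact le_add_of_nonneg_left (by positivity)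
  · have hlin : ∀ (v : ℝ) (z y : ℂ), l (z - v * y) = l z - l y * v := fun v z y => by
      rw [map_sub, ← Complex.real_smul, map_smul, smul_eq_mul, mul_comm]
    have hb4 : l (fourierKer (w (t / 2) 0 0) (ξ - κ) κ) ^ 2
        + l (fourierKer (w (t / 2) 0 1) (ξ - κ) κ) ^ 2
        + l (fourierKer (w (t / 2) 1 0) (ξ - κ) κ) ^ 2
        + l (fourierKer (w (t / 2) 1 1) (ξ - κ) κ) ^ 2 + K * (L : ℝ) ^ 2
        ≤ (4 * (4 * E ^ 2) + K) * (L : ℝ) ^ 6 := by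
      have h1 : (L : ℝ) ^ 2 ≤ (L : ℝ) ^ 6 := pow_le_pow_right₀ hL (by norm_num)
      have h2 := mul_le_mul_of_nonneg_left h1 hK0.le
      have h3 : 0 ≤ E ^ 2 * (L : ℝ) ^ 6 := by positivity
      linarith [hbd (t / 2) ht2 0 0 κ, hbd (t / 2) ht2 0 1 κ, hbd (t / 2) ht2 1 0 κ,
        hbd (t / 2) ht2 1 1 κ]
    rw [hlin]
    refine le_trans ?_ (key2.trans (expansion_bound hC₂ hK0.le (by positivity) hB₂.le hL0 he0.le
      (Real.exp_pos _).le (Real.exp_pos _).le he1 he2 hb4))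
    fin_cases i <;> fin_cases j
    · exact le_add_of_le_of_nonneg (le_add_of_le_of_nonneg (le_add_of_nonneg_right (sq_nonneg _))
        (sq_nonneg _)) (sq_nonneg _)
    · exact le_add_of_le_of_nonneg (le_add_of_le_of_nonneg (le_add_of_nonneg_left (sq_nonneg _))
        (sq_nonneg _)) (sq_nonneg _)
    · exact le_add_of_le_of_nonneg (le_add_of_nonneg_left (by positivity)) (sq_nonneg _)
    · exact le_add_of_nonneg_left (by positivity)

end Expansion

/-! ### The expansion of the Wigner-type transform -/

section Wigner

variable {Φ : ℤ → ℝ} {γ : ℝ}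

/-- Real and imaginary parts are two admissible functionals, and together they control the norm. -/
theorem Admissible.exists_kernel_expansion (hΦ : Admissible Φ γ) {m cD E c₀ : ℝ} (hm : 0 < m)
    (hcD : 0 < cD) (hE : 0 < E) (hc₀ : 0 < c₀) :
    ∃ C > 0, ∃ c > 0, ∀ (L : ℕ) [NeZero L], (∀ a : ZMod L, m ≤ phiHatL Φ a) →
      (∀ ξ : ZMod L, cD * |dualPoint L ξ| ^ 2
        ≤ avg (fun κ : ZMod L => (phiHatL Φ (κ - ξ) - phiHatL Φ κ) ^ 2)) →
      ∀ w, MomentSol Φ γ L E w → ∀ t, c₀ * (L : ℝ) ^ 2 ≤ t → ∀ (ξ κ : ZMod L) (i j : Fin 2),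
        ‖fourierFun (fun x => w t 1 1 x x) ξ‖
          ≤ C * (L * Real.exp (-(c * (ξ.valMinAbs : ℝ) ^ 2))) ∧
        ‖fourierKer (w t i j) (ξ - κ) κ - localSymbol Φ γ (dualPoint L κ) (dualPoint L ξ) i j
            * fourierFun (fun x => w t 1 1 x x) ξ‖
          ≤ C * (((ξ.valMinAbs : ℝ) ^ 2 + 1) / L
            * Real.exp (-(c * (ξ.valMinAbs : ℝ) ^ 2))) := by
  obtain ⟨C, hC, c, hc, H⟩ := hΦ.exists_functional_expansion hm hcD hE hc₀
  refine ⟨2 * √C, by positivity, c, hc, ?_⟩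
  intro L _ hmL hcDL w hw t ht ξ κ i j
  have h1 := H L hmL hcDL w hw Complex.reCLM (fun z => Complex.abs_re_le_norm z) t ht ξ κ i j
  have h2 := H L hmL hcDL w hw Complex.imCLM (fun z => Complex.abs_im_le_norm z) t ht ξ κ i j
  have key : ∀ (z : ℂ) (Y : ℝ), 0 ≤ Y → z.re ^ 2 ≤ C * Y ^ 2 → z.im ^ 2 ≤ C * Y ^ 2 →
      ‖z‖ ≤ 2 * √C * Y := by
    intro z Y hY hr hi
    have e : √(C * Y ^ 2) = √C * Y := by rw [Real.sqrt_mul hC.le, Real.sqrt_sq hY]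
    have hr' := Real.abs_le_sqrt hr
    have hi' := Real.abs_le_sqrt hi
    rw [e] at hr' hi'
    linarith [Complex.norm_le_abs_re_add_abs_im z]
  exact ⟨key _ _ (by positivity) h1.1 h2.1, key _ _ (by positivity) h1.2 h2.2⟩

theorem Admissible.exists_U1_bound (hΦ : Admissible Φ γ) :
    ∃ B > 0, ∀ k i j, |U1 Φ γ k i j| ≤ B := by
  obtain ⟨m, hm, hφm⟩ := hΦ.exists_le_phiHat
  have hγ := hΦ.gamma_pos
  have hπ := Real.pi_pos
  have hM := absMoment_nonneg Φ 1
  refine ⟨2 * Real.pi * absMoment Φ 1 / (4 * Real.pi * m) * (m⁻¹ + γ⁻¹) + 1, by positivity,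
    fun k i j => ?_⟩
  have h1 : |velocity Φ k / disp Φ k| ≤ 2 * Real.pi * absMoment Φ 1 / (4 * Real.pi * m) := by
    have hφ := hΦ.phiHat_pos k
    rw [hΦ.velocity_div_disp, abs_div, abs_of_pos (by positivity : 0 < 4 * Real.pi * phiHat Φ k)]
    have := hΦ.abs_phiHatDeriv_le k
    have := hφm k
    gcongr
  have h2 : |(!![(disp Φ k ^ 2)⁻¹, -γ⁻¹; γ⁻¹, 0] : Matrix (Fin 2) (Fin 2) ℝ) i j|
      ≤ m⁻¹ + γ⁻¹ := by
    have h3 : |(phiHat Φ k)⁻¹| ≤ m⁻¹ := by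
      rw [abs_of_pos (inv_pos.2 (hΦ.phiHat_pos k))]
      exact inv_anti₀ hm (hφm k)
    have h4 : 0 < m⁻¹ := inv_pos.2 hm
    have h5 : 0 < γ⁻¹ := inv_pos.2 hγ
    rw [hΦ.disp_sq]
    fin_cases i <;> fin_cases j <;> simp <;> simp only [abs_inv, abs_of_pos hγ] at h3 ⊢ <;>
      linarith
  rw [hΦ.U1_eq, Matrix.smul_apply, smul_eq_mul, abs_mul, abs_neg]
  refine (mul_le_mul h1 h2 (abs_nonneg _) (by positivity)).trans (by linarith)

theorem norm_exp_mul_I_sub_le (θ : ℝ) :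
    ‖Complex.exp (θ * Complex.I) - 1 - θ * Complex.I‖ ≤ 3 * θ ^ 2 := by
  have hn : ‖(θ : ℂ) * Complex.I‖ = |θ| := by simp
  rcases le_or_gt |θ| 1 with h | h
  · have := Complex.norm_exp_sub_one_sub_id_le (x := θ * Complex.I) (by rw [hn]; exact h)
    rw [hn, sq_abs] at this
    linarith [sq_nonneg θ]
  · have h1 : ‖Complex.exp (θ * Complex.I) - 1 - θ * Complex.I‖ ≤ 1 + 1 + |θ| := by
      refine (norm_sub_le _ _).trans (add_le_add ((norm_sub_le _ _).trans ?_) hn.le)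
      rw [Complex.norm_exp_ofReal_mul_I, norm_one]
    rw [← sq_abs]
    nlinarith

variable {L : ℕ} [NeZero L]

theorem chi_eq_exp (ξ : ZMod L) :
    chi ξ = Complex.exp ((2 * Real.pi * dualPoint L ξ : ℝ) * Complex.I) := by
  rw [← ZMod.coe_valMinAbs ξ, chi_intCast, ZMod.coe_valMinAbs, dualPoint]
  congr 1
  push_cast
  ring

/-- The multiplier of the discrete gradient is `χ(ξ) - 1 = 2πih + O(h²)`, and `i` times it is `-2πh`
to this order; so the symbol of the fiber expansion and that of the theorem agree up to `O(h²)`. -/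
theorem norm_localSymbol_sub_le (ξ : ZMod L) (k : ℝ) (i j : Fin 2) :
    ‖(localSymbol Φ γ k (dualPoint L ξ) i j : ℂ)
      - (U0 Φ γ k i j + Complex.I * (chi ξ - 1) * U1 Φ γ k i j)‖
      ≤ 3 * (2 * Real.pi * dualPoint L ξ) ^ 2 * |U1 Φ γ k i j| := by
  have h := norm_exp_mul_I_sub_le (2 * Real.pi * dualPoint L ξ)
  rw [← chi_eq_exp] at h
  have e : (localSymbol Φ γ k (dualPoint L ξ) i j : ℂ)
      - (U0 Φ γ k i j + Complex.I * (chi ξ - 1) * U1 Φ γ k i j)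
      = -Complex.I * (chi ξ - 1 - (2 * Real.pi * dualPoint L ξ : ℝ) * Complex.I)
        * U1 Φ γ k i j := by
    rw [localSymbol]
    push_cast
    linear_combination (-(2 * Real.pi * dualPoint L ξ * U1 Φ γ k i j : ℂ)) * Complex.I_sq
  rw [e, norm_mul, norm_mul, norm_neg, Complex.norm_I, one_mul, Complex.norm_real]
  exact mul_le_mul_of_nonneg_right h (abs_nonneg _)

theorem summable_gaussian_weight {c : ℝ} (hc : 0 < c) :
    Summable fun n : ℤ => ((n : ℝ) ^ 2 + 1) * Real.exp (-(c * (n : ℝ) ^ 2)) := by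
  have h1 : Summable fun n : ℕ => ((n : ℝ) ^ 2 + 1) * Real.exp (-(c * (n : ℝ) ^ 2)) := by
    refine Summable.of_nonneg_of_le (fun n => by positivity) (fun n => ?_)
      ((Real.summable_pow_mul_exp_neg_nat_mul 2 hc).add
        (Real.summable_pow_mul_exp_neg_nat_mul 0 hc))
    have h2 : (n : ℝ) ≤ (n : ℝ) ^ 2 := by exact_mod_cast Nat.le_self_pow two_ne_zero n
    have h3 : Real.exp (-(c * (n : ℝ) ^ 2)) ≤ Real.exp (-c * n) :=
      Real.exp_le_exp.2 (by nlinarith)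
    rw [pow_zero, ← add_mul]
    gcongr
  refine Summable.of_nat_of_neg ?_ ?_ <;> simpa using h1

variable {S : Type*} [MeasurableSpace S] {P : Measure S} {X : ℝ≥0 → S → Phase L}

theorem wigner_sub_eq (t : ℝ≥0) (x κ : ZMod L) (i j : Fin 2) :
    wigner P X t x (dualPoint L κ) i j
      - ((temp P X t x : ℂ) * (U0 Φ γ (dualPoint L κ) i j : ℂ)
        + Complex.I * (gradTemp P X t x : ℂ) * (U1 Φ γ (dualPoint L κ) i j : ℂ))
      = (L : ℂ)⁻¹ * ∑ ξ, chi (ξ * x) * (fourierKer (corr P X t i j) (ξ - κ) κ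
        - (U0 Φ γ (dualPoint L κ) i j + Complex.I * (chi ξ - 1) * U1 Φ γ (dualPoint L κ) i j)
          * fourierFun (fun x => corr P X t 1 1 x x) ξ) := by
  have h : temp P X t = fun x => corr P X t 1 1 x x := funext fun x => temp_eq_corr t x
  rw [wigner_eq, temp_eq, gradTemp_eq, h]
  have e : ∀ (A B G : ℂ) (u v : ℂ), (L : ℂ)⁻¹ * A - ((L : ℂ)⁻¹ * B * u
      + Complex.I * ((L : ℂ)⁻¹ * G) * v) = (L : ℂ)⁻¹ * (A - B * u - G * (Complex.I * v)) :=
    fun A B G u v => by ring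
  rw [e, Finset.sum_mul, Finset.sum_mul, ← Finset.sum_sub_distrib, ← Finset.sum_sub_distrib]
  congr 1
  exact Finset.sum_congr rfl fun ξ _ => by ring

theorem sum_sq_le_hamiltonian (hs : ∀ x, Φ (-x) = Φ x) {m : ℝ}
    (hm : ∀ a : ZMod L, m ≤ phiHatL Φ a) (X : Phase L) :
    min m 1 / 2 * (∑ x, X 0 x ^ 2 + ∑ x, X 1 x ^ 2) ≤ hamiltonian Φ L X := by
  have h1 := le_potential hs hm (X 0)
  have h2 : 0 ≤ ∑ x, X 0 x ^ 2 := by positivity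
  have h3 : 0 ≤ ∑ x, X 1 x ^ 2 := by positivity
  have h4 := mul_le_mul_of_nonneg_right (min_le_left m 1) h2
  have h5 := mul_le_mul_of_nonneg_right (min_le_right m 1) h3
  have e : hamiltonian Φ L X = 1 / 2 * ∑ x, X 1 x ^ 2
      + 1 / 2 * ∑ x', ∑ x, X 0 x' * X 0 x * PhiL Φ L x' x := by
    simp only [hamiltonian, Finset.mul_sum]
  rw [e]
  linarith

/-- Coercivity of the energy bounds each moment by the total energy, which is `O(L)`. The sum of all
temperatures is bounded by it only once, not once per site, which keeps the temperature modes
`O(L)`. -/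
theorem IsVelocityFlipProcess.momentSol [IsProbabilityMeasure P]
    (h : IsVelocityFlipProcess Φ γ L P X)
    (hs : ∀ x, Φ (-x) = Φ x) {μ E₀ : ℝ} (hμ : 0 < μ)
    (hH : ∀ X : Phase L, μ * (∑ x, X 0 x ^ 2 + ∑ x, X 1 x ^ 2) ≤ hamiltonian Φ L X)
    (hH' : ∀ (X : Phase L) i x, μ * X i x ^ 2 ≤ hamiltonian Φ L X)
    (hI : Integrable (fun s => hamiltonian Φ L (X 0 s)) P)
    (hE : (∫ s, hamiltonian Φ L (X 0 s) ∂P) / L ≤ E₀) :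
    MomentSol Φ γ L (μ⁻¹ * E₀) (corrExt Φ γ P X) := by
  have hL : (0 : ℝ) < L := Nat.cast_pos.2 (NeZero.pos L)
  rw [div_le_iff₀ hL] at hE
  have hμ' : 0 < μ⁻¹ := inv_pos.2 hμ
  have hE' : μ⁻¹ * ∫ s, hamiltonian Φ L (X 0 s) ∂P ≤ μ⁻¹ * E₀ * L := by
    rw [mul_assoc]
    exact mul_le_mul_of_nonneg_left hE hμ'.le
  have he : ∀ t : ℝ, 0 ≤ t → corrExt Φ γ P X t = corr P X t.toNNReal := fun t ht => by
    rw [← h.corrExt_eq hs hμ hH' hI, Real.coe_toNNReal t ht]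
  refine ⟨fun t ht i j x y => h.hasDerivAt_corrExt hs hμ hH' hI ht i j x y,
    fun t ht i j x y => ?_, fun t ht => ?_⟩
  · rw [he t ht]
    exact (h.abs_corr_le hs hμ hH' hI _ i j x y).trans hE'
  · rw [he t ht]
    have hi := h.energy_bound hs hμ hH' hI t.toNNReal
    have hc := fun x => h.integrable_coord_mul hs hμ hH' hI t.toNNReal 1 1 x x
    have h1 : ∑ x, |corr P X t.toNNReal 1 1 x x|
        = ∫ s, ∑ x, X t.toNNReal s 1 x * X t.toNNReal s 1 x ∂P := by
      rw [integral_finsetSum _ fun x _ => hc x]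
      exact Finset.sum_congr rfl fun x _ =>
        abs_of_nonneg (integral_nonneg fun s => mul_self_nonneg _)
    rw [h1]
    calc _ ≤ ∫ s, μ⁻¹ * hamiltonian Φ L (X t.toNNReal s) ∂P := by
          refine integral_mono (integrable_finsetSum _ fun x _ => hc x) (hi.1.const_mul _)
            fun s => ?_
          dsimp only
          rw [le_inv_mul_iff₀ hμ]
          refine le_trans (mul_le_mul_of_nonneg_left ?_ hμ.le) (hH _)
          simp only [← sq]
          exact le_add_of_nonneg_left (by positivity)
      _ ≤ _ := by
          rw [integral_const_mul]
          exact (mul_le_mul_of_nonneg_left hi.2 hμ'.le).trans hE'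

end Wigner

end VelocityFlip

end

/-! ### Assembly of the local equilibrium expansion -/

open VelocityFlip in
theorem theorem1 (Φ : ℤ → ℝ) (γ : ℝ) (hΦ : Admissible Φ γ) :
    -- the symbols are given by convergent integrals, with explicit values
    (∀ (k : ℝ) (i j : Fin 2),
      IntegrableOn (fun t => calA Φ γ t k i j) (Set.Ioi 0) ∧
      IntegrableOn (fun t => calAtilde Φ γ t k i j) (Set.Ioi 0)) ∧
    (∀ k : ℝ, U0 Φ γ k = !![(disp Φ k ^ 2)⁻¹, 0; 0, 1]) ∧
    (∀ k : ℝ, U1 Φ γ k =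
      (-(velocity Φ k / disp Φ k)) • !![(disp Φ k ^ 2)⁻¹, -γ⁻¹; γ⁻¹, 0]) ∧
    -- the expansion of the Wigner-type transform at diffusive times
    ∃ L₀ : ℕ, 0 < L₀ ∧ ∀ E₀ > (0 : ℝ), ∀ c₀ > (0 : ℝ), ∃ c₁ > (0 : ℝ),
      ∀ (L : ℕ) [NeZero L], L₀ ≤ L →
      ∀ {S : Type*} [MeasurableSpace S] (P : Measure S) [IsProbabilityMeasure P]
        (X : ℝ≥0 → S → Phase L),
        IsVelocityFlipProcess Φ γ L P X →
        Integrable (fun s => hamiltonian Φ L (X 0 s)) P →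
        (∫ s, hamiltonian Φ L (X 0 s) ∂P) / L ≤ E₀ →
        (∀ (t : ℝ≥0) (i j : Fin 2) (x y : ZMod L),
          Integrable (fun s => X t s i x * X t s j y) P) ∧
        ∀ t : ℝ≥0, c₀ * (L : ℝ) ^ 2 ≤ t → ∀ (x κ : ZMod L) (i j : Fin 2),
          ‖wigner P X t x (dualPoint L κ) i j
              - ((temp P X t x : ℂ) * (U0 Φ γ (dualPoint L κ) i j : ℂ)
                + Complex.I * (gradTemp P X t x : ℂ) * (U1 Φ γ (dualPoint L κ) i j : ℂ))‖
            ≤ c₁ / (L : ℝ) ^ 2 := by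
  refine ⟨hΦ.integrable_symbols, hΦ.U0_eq, hΦ.U1_eq, ?_⟩
  obtain ⟨L₀, hL₀, m, hm, cD, hcD, hlat⟩ := hΦ.exists_lattice_bounds
  refine ⟨L₀, hL₀, fun E₀ hE₀ c₀ hc₀ => ?_⟩
  obtain ⟨μ, hμe⟩ : ∃ μ, μ = min m 1 / 2 := ⟨_, rfl⟩
  have hμ : 0 < μ := hμe ▸ half_pos (lt_min hm one_pos)
  obtain ⟨C, hC, c, hc, hexp⟩ := hΦ.exists_kernel_expansion hm hcD
    (mul_pos (inv_pos.2 hμ) hE₀) hc₀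
  obtain ⟨B, hB, hU1⟩ := hΦ.exists_U1_bound
  have hsum := summable_gaussian_weight hc
  set Z := ∑' n : ℤ, ((n : ℝ) ^ 2 + 1) * Real.exp (-(c * (n : ℝ) ^ 2))
  have hZ : 0 ≤ Z := tsum_nonneg fun n => by positivity
  -- The factor `12π²B = 3(2π)²B` is the price of passing to the discrete gradient; the `+ 1`
  -- ensures strict positivity.
  refine ⟨C * (1 + 12 * Real.pi ^ 2 * B) * Z + 1, by positivity, ?_⟩
  intro L _ hL S _ P _ X hX hI hE
  obtain ⟨hmL, hcDL⟩ := hlat L hL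
  have hs := hΦ.symm
  have hH : ∀ X : Phase L, μ * (∑ x, X 0 x ^ 2 + ∑ x, X 1 x ^ 2) ≤ hamiltonian Φ L X :=
    hμe ▸ sum_sq_le_hamiltonian hs hmL
  have hH' : ∀ (X : Phase L) i x, μ * X i x ^ 2 ≤ hamiltonian Φ L X := fun X i x => by
    refine le_trans (mul_le_mul_of_nonneg_left ?_ hμ.le) (hH X)
    have h0 : ∀ i, X i x ^ 2 ≤ ∑ x, X i x ^ 2 := fun i =>
      Finset.single_le_sum (f := fun x => X i x ^ 2) (fun _ _ => sq_nonneg _) (Finset.mem_univ x)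
    have h1 : ∀ i, 0 ≤ ∑ x, X i x ^ 2 := fun i => by positivity
    fin_cases i
    · exact le_add_of_le_of_nonneg (h0 0) (h1 1)
    · exact le_add_of_nonneg_of_le (h1 0) (h0 1)
  refine ⟨fun t i j x y => hX.integrable_coord_mul hs hμ hH' hI t i j x y, ?_⟩
  intro t ht x κ i j
  have hLpos : (0 : ℝ) < L := Nat.cast_pos.2 (NeZero.pos L)
  have hsol := hX.momentSol hs hμ hH hH' hI hE
  have hker := fun ξ => hexp L hmL hcDL _ hsol t ht ξ κ i j
  rw [hX.corrExt_eq hs hμ hH' hI t] at hker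
  have hterm : ∀ ξ : ZMod L, ‖chi (ξ * x) * (fourierKer (corr P X t i j) (ξ - κ) κ
      - (U0 Φ γ (dualPoint L κ) i j + Complex.I * (chi ξ - 1) * U1 Φ γ (dualPoint L κ) i j)
        * fourierFun (fun x => corr P X t 1 1 x x) ξ)‖
      ≤ C * (1 + 12 * Real.pi ^ 2 * B) / L * (((ξ.valMinAbs : ℝ) ^ 2 + 1)
        * Real.exp (-(c * (ξ.valMinAbs : ℝ) ^ 2))) := by
    intro ξ
    obtain ⟨h1, h2⟩ := hker ξ
    have h3 := norm_localSymbol_sub_le (Φ := Φ) (γ := γ) ξ (dualPoint L κ) i j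
    -- `localSymbol` is inserted in between. The second error, `h²` times a temperature mode of size
    -- `L e^{-cn²}`, is of order `n²L⁻¹e^{-cn²}`, like the first.
    rw [norm_mul, norm_chi, one_mul, ← sub_add_sub_cancel _ ((localSymbol Φ γ (dualPoint L κ)
      (dualPoint L ξ) i j : ℂ) * fourierFun (fun x => corr P X t 1 1 x x) ξ), ← sub_mul]
    refine (norm_add_le _ _).trans ?_
    rw [norm_mul]
    calc _ ≤ C * (((ξ.valMinAbs : ℝ) ^ 2 + 1) / L * Real.exp (-(c * (ξ.valMinAbs : ℝ) ^ 2)))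
          + 3 * (2 * Real.pi * dualPoint L ξ) ^ 2 * B
            * (C * (L * Real.exp (-(c * (ξ.valMinAbs : ℝ) ^ 2)))) := by
          gcongr
          refine h3.trans ?_
          have := hU1 (dualPoint L κ) i j
          gcongr
      _ = C / L * (((ξ.valMinAbs : ℝ) ^ 2 + 1) * Real.exp (-(c * (ξ.valMinAbs : ℝ) ^ 2)))
          + C * (12 * Real.pi ^ 2 * B) / L * ((ξ.valMinAbs : ℝ) ^ 2
            * Real.exp (-(c * (ξ.valMinAbs : ℝ) ^ 2))) := by
          rw [dualPoint]
          field_simp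
          ring
      _ ≤ C / L * (((ξ.valMinAbs : ℝ) ^ 2 + 1) * Real.exp (-(c * (ξ.valMinAbs : ℝ) ^ 2)))
          + C * (12 * Real.pi ^ 2 * B) / L * (((ξ.valMinAbs : ℝ) ^ 2 + 1)
            * Real.exp (-(c * (ξ.valMinAbs : ℝ) ^ 2))) := by
          gcongr
          linarith
      _ = _ := by ring
  rw [wigner_sub_eq, norm_mul, norm_inv, Complex.norm_natCast]
  -- One factor `L⁻¹` comes from Fourier inversion, the other from each summand; the Gaussian sum
  -- over `Λ_L` is at most the one over `ℤ`.
  calc _ ≤ (L : ℝ)⁻¹ * ∑ ξ : ZMod L, C * (1 + 12 * Real.pi ^ 2 * B) / L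
        * (((ξ.valMinAbs : ℝ) ^ 2 + 1) * Real.exp (-(c * (ξ.valMinAbs : ℝ) ^ 2))) := by
        gcongr
        exact (norm_sum_le _ _).trans (Finset.sum_le_sum fun ξ _ => hterm ξ)
    _ = C * (1 + 12 * Real.pi ^ 2 * B) / (L : ℝ) ^ 2 * ∑ n ∈ sites L, ((n : ℝ) ^ 2 + 1)
        * Real.exp (-(c * (n : ℝ) ^ 2)) := by
        rw [← Finset.mul_sum, sum_valMinAbs (L := L)
          fun n => ((n : ℝ) ^ 2 + 1) * Real.exp (-(c * (n : ℝ) ^ 2)), ← mul_assoc]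
        congr 1
        field_simp
    _ ≤ C * (1 + 12 * Real.pi ^ 2 * B) / (L : ℝ) ^ 2 * Z := by
        gcongr
        exact hsum.sum_le_tsum _ fun n _ => by positivity
    _ ≤ _ := by
        rw [div_mul_eq_mul_div]
        gcongr
        linarith
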